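/- Let $d\ge 1$, let $\Omega\subset\mathbb R^d$ be a bounded domain with Lipschitz boundary $\Gamma$, let $\Gamma_N\subset\Gamma$ be relatively open and $\Gamma_D=\Gamma\setminus\Gamma_N$. All function spaces are complex valued; $(\cdot,\cdot)$ and $\|\cdot\|$ are the inner product and norm of $L^2(\Omega)$, $\|v\|_1^2=\|v\|^2+\|\nabla v\|^2$, and $\mathbb V=\{v\in H^1(\Omega): v=0\text{ on }\Gamma_D\}$ (vanishing trace), with the norm $\|\cdot\|_1$. Let $$A(u,v)=\int_\Omega\Big(\sum_{i,j=1}^d a_{i,j}u_i\overline{v_j}+\sum_{i=1}^d\big(a_{i,0}u_i\overline v+a_{0,i}u\overline{v_i}\big)+a_{0,0}u\overline v\Big),\qquad u,v\in\mathbb V,$$ where $u_i=\partial u/\partial x_i$ and the coefficients are complex valued functions for which the integrand is integrable for all $u,v\in\mathbb V$. Assume that there are $c_0,c_1>0$ with $$\Re A(v,v)\ge c_0\|v\|_1^2,\qquad |A(u,v)|\le c_1\|u\|_1\|v\|_1\qquad\text{for all }u,v\in\mathbb V.$$ Let $A$ also denote the unbounded operator on $L^2(\Omega)$ associated with the form: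 $u\in D(A)$ and $Au=f\in L^2(\Omega)$ if and only if $u\in\mathbb V$ and $A(u,\phi)=(f,\phi)$ for all $\phi\in\mathbb V$. Put $A^0=I$ and, for $0<\beta<1$, $$A^{-\beta}f=\frac{\sin(\beta\pi)}\pi\int_0^\infty\mu^{-\beta}(\mu I+A)^{-1}f\,d\mu .$$ For $0<\beta\le 1$ let $D(A^\beta)=\{u\in L^2(\Omega): A^{\beta-1}u\in D(A)\}$ and $A^\beta u=A(A^{\beta-1}u)$, with norm $\|A^\beta u\|$ on $D(A^\beta)$. Let $S$ be the operator associated in the same way with the form $\frac12\big(A(u,v)+\overline{A(v,u)}\big)$ on $\mathbb V$. For $0\le t<1$ let $\dot H^t=D(S^{t/2})$ with norm $\|u\|_{\dot H^t}=\|S^{t/2}u\|$, and let $\dot H_a^{-t}$ be the space of bounded antilinear functionals $F$ on $\mathbb V$ that are bounded in the norm of $\dot H^t$, with the dual norm $\sup_{0\ne\theta\in\mathbb V}|\langle F,\theta\rangle|/\|\theta\|_{\dot H^t}$. For a bounded antilinear functional $F$ on $\mathbb V$ let $T_aF\in\mathbb V$ be the solution of $A(T_aF,\phi)=\langle F,\phi\rangle$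 for all $\phi\in\mathbb V$. Let $0<\alpha\le1$ and $s\in(0,\alpha]$, and give $H^{1+s}(\Omega)\cap\mathbb V$ the norm of $H^{1+s}(\Omega)$ (the Sobolev–Slobodeckij norm if $s<1$, the $H^2(\Omega)$ norm if $s=1$). Assume that $T_a$ is an isomorphism (a bijection, bounded with bounded inverse) from $\dot H_a^{-1+s}$ onto $H^{1+s}(\Omega)\cap\mathbb V$. Then $$D(A^{(1+s)/2})=H^{1+s}(\Omega)\cap\mathbb V$$ with equivalent norms. -/

import Mathlib

open MeasureTheory Set Filter Topology
open scoped ContDiff ENNReal NNReal ComplexConjugate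

noncomputable section

namespace FracPow

/-! ### Domains -/

/-- Euclidean space `ℝᵈ`. -/
abbrev E (d : ℕ) := EuclideanSpace ℝ (Fin d)

/-- A bounded domain (non-empty, open, connected) whose boundary is Lipschitz: near every boundary
point `x` there are a unit vector `n` and a Lipschitz function `f` such that `Ω` is the part of a
ball about `x` lying strictly above the graph of `f` over the hyperplane orthogonal to `n`. -/
def IsBoundedLipschitzDomain {d : ℕ} (Ω : Set (E d)) : Prop :=
  IsOpen Ω ∧ IsConnected Ω ∧ Bornology.IsBounded Ω ∧
    ∀ x ∈ frontier Ω, ∃ (n : E d) (r : ℝ) (K : ℝ≥0) (f : E d → ℝ),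
      ‖n‖ = 1 ∧ 0 < r ∧ LipschitzWith K f ∧
        ∀ y ∈ Metric.ball x r, (y ∈ Ω ↔ f (y - (inner ℝ n y) • n) < inner ℝ n y)

/-! ### Lebesgue and Sobolev spaces -/

/-- Complex `L²(Ω)`. -/
abbrev L2 {d : ℕ} (Ω : Set (E d)) := Lp ℂ 2 (volume.restrict Ω)

/-- `L²(Ω)^{d+1}` as a Hilbert space. A function in `H¹(Ω)` is represented by the tuple
`(u, ∂₁u, …, ∂_d u)`: entry `0` is the function, entry `i.succ` its `i`-th weak derivative. The
norm of this space is then the norm `‖u‖₁ = (∫ |u|² + ∫ |∇u|²)^{1/2}` of `H¹(Ω)`. -/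
abbrev Jet {d : ℕ} (Ω : Set (E d)) := PiLp 2 (fun _ : Fin (d + 1) => L2 Ω)

/-- The `i`-th partial derivative of a function on `ℝᵈ`. -/
def pderiv {d : ℕ} {F : Type*} [NormedAddCommGroup F] [NormedSpace ℝ F]
    (φ : E d → F) (i : Fin d) (x : E d) : F :=
  fderiv ℝ φ x (EuclideanSpace.single i 1)

/-- `g` is the `i`-th weak derivative of `u` in `Ω`. -/
def IsWeakDeriv {d : ℕ} {Ω : Set (E d)} (i : Fin d) (u g : L2 Ω) : Prop :=
  ∀ φ : E d → ℝ, ContDiff ℝ ∞ φ → HasCompactSupport φ → tsupport φ ⊆ Ω →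
    ∫ x in Ω, pderiv φ i x • u x = - ∫ x in Ω, φ x • g x

theorem integrable_smul_L2 {d : ℕ} {Ω : Set (E d)} {ψ : E d → ℝ} (hψ : Continuous ψ)
    (hc : HasCompactSupport ψ) (u : L2 Ω) :
    Integrable (fun x => ψ x • u x) (volume.restrict Ω) := by
  have h1 : MemLp ψ 2 (volume.restrict Ω) := hψ.memLp_of_hasCompactSupport hc
  have h2 : MemLp (u : E d → ℂ) 2 (volume.restrict Ω) := Lp.memLp u
  exact memLp_one_iff_integrable.1 (h2.smul h1)

theorem continuous_pderiv {d : ℕ} {F : Type*} [NormedAddCommGroup F] [NormedSpace ℝ F]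
    {φ : E d → F} (hφ : ContDiff ℝ ∞ φ) (i : Fin d) : Continuous (pderiv φ i) :=
  (hφ.continuous_fderiv (by simp)).clm_apply continuous_const

theorem hasCompactSupport_pderiv {d : ℕ} {F : Type*} [NormedAddCommGroup F] [NormedSpace ℝ F]
    {φ : E d → F} (hφ : HasCompactSupport φ) (i : Fin d) : HasCompactSupport (pderiv φ i) :=
  (hφ.fderiv (𝕜 := ℝ)).comp_left
    (g := fun L : E d →L[ℝ] F => L (EuclideanSpace.single i 1)) rfl

theorem IsWeakDeriv.add {d : ℕ} {Ω : Set (E d)} {i : Fin d} {u g u' g' : L2 Ω}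
    (h : IsWeakDeriv i u g) (h' : IsWeakDeriv i u' g') : IsWeakDeriv i (u + u') (g + g') := by
  intro φ hφ hc hs
  have e1 : ∫ x in Ω, pderiv φ i x • (u + u' : L2 Ω) x
      = ∫ x in Ω, (pderiv φ i x • u x + pderiv φ i x • u' x) := by
    refine integral_congr_ae ?_
    filter_upwards [Lp.coeFn_add u u'] with x hx
    simp only [hx, Pi.add_apply, smul_add]
  have e2 : ∫ x in Ω, φ x • (g + g' : L2 Ω) x = ∫ x in Ω, (φ x • g x + φ x • g' x) := by
    refine integral_congr_ae ?_
    filter_upwards [Lp.coeFn_add g g'] with x hx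
    simp only [hx, Pi.add_apply, smul_add]
  have c1 := continuous_pderiv hφ i
  have s1 := hasCompactSupport_pderiv hc i
  rw [e1, e2, integral_add (integrable_smul_L2 c1 s1 u) (integrable_smul_L2 c1 s1 u'),
    integral_add (integrable_smul_L2 hφ.continuous hc g) (integrable_smul_L2 hφ.continuous hc g'),
    h φ hφ hc hs, h' φ hφ hc hs]
  ring

theorem IsWeakDeriv.smul {d : ℕ} {Ω : Set (E d)} {i : Fin d} {u g : L2 Ω} (c : ℂ)
    (h : IsWeakDeriv i u g) : IsWeakDeriv i (c • u) (c • g) := by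
  intro φ hφ hc hs
  have e1 : ∫ x in Ω, pderiv φ i x • (c • u : L2 Ω) x = ∫ x in Ω, c • (pderiv φ i x • u x) := by
    refine integral_congr_ae ?_
    filter_upwards [Lp.coeFn_smul c u] with x hx
    simp only [hx, Pi.smul_apply]
    exact smul_comm _ _ _
  have e2 : ∫ x in Ω, φ x • (c • g : L2 Ω) x = ∫ x in Ω, c • (φ x • g x) := by
    refine integral_congr_ae ?_
    filter_upwards [Lp.coeFn_smul c g] with x hx
    simp only [hx, Pi.smul_apply]
    exact smul_comm _ _ _
  rw [e1, e2, integral_smul, integral_smul, h φ hφ hc hs, smul_neg]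

theorem isWeakDeriv_zero {d : ℕ} {Ω : Set (E d)} (i : Fin d) :
    IsWeakDeriv i (0 : L2 Ω) (0 : L2 Ω) := by
  intro φ _ _ _
  have e : ∀ ψ : E d → ℝ, ∫ x in Ω, ψ x • (0 : L2 Ω) x = 0 := by
    intro ψ
    rw [← integral_zero (E d) ℂ (μ := volume.restrict Ω)]
    refine integral_congr_ae ?_
    filter_upwards [Lp.coeFn_zero ℂ 2 (volume.restrict Ω)] with x hx
    simp only [hx, Pi.zero_apply, smul_zero]
  rw [e, e, neg_zero]

/-- The Sobolev space `H¹(Ω)`: tuples `(u, ∂₁u, …, ∂_d u)` of a function and its weak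
derivatives, all in `L²(Ω)`. -/
def H1 {d : ℕ} (Ω : Set (E d)) : Submodule ℂ (Jet Ω) where
  carrier := {u | ∀ i : Fin d, IsWeakDeriv i (u 0) (u i.succ)}
  add_mem' := fun hu hv i => (hu i).add (hv i)
  zero_mem' := fun i => isWeakDeriv_zero i
  smul_mem' := fun c _ hu i => (hu i).smul c

/-- The trace of `u` on the part `ΓD` of the boundary vanishes. The trace is the continuous
extension to `H¹(Ω)` of the restriction map from `C_c^∞(ℝᵈ)` to `L²(ΓD)` with respect to the
surface (`(d-1)`-dimensional Hausdorff) measure; so `u` has trace zero when there are smooth `φₙ`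
converging to `u` in `H¹(Ω)` and to `0` in `L²(ΓD)`. -/
def HasZeroTrace {d : ℕ} {Ω : Set (E d)} (ΓD : Set (E d)) (u : Jet Ω) : Prop :=
  ∃ φ : ℕ → E d → ℂ, (∀ n, ContDiff ℝ ∞ (φ n)) ∧ (∀ n, HasCompactSupport (φ n)) ∧
    Tendsto (fun n => eLpNorm (fun x => φ n x - u 0 x) 2 (volume.restrict Ω)) atTop (𝓝 0) ∧
    (∀ i : Fin d, Tendsto (fun n =>
      eLpNorm (fun x => pderiv (φ n) i x - u i.succ x) 2 (volume.restrict Ω)) atTop (𝓝 0)) ∧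
    Tendsto (fun n => eLpNorm (φ n) 2 ((μH[(d : ℝ) - 1]).restrict ΓD)) atTop (𝓝 0)

theorem tendsto_eLpNorm_add {X : Type*} [MeasurableSpace X] {μ : Measure X}
    {f g h : ℕ → X → ℂ} (hf : ∀ n, AEStronglyMeasurable (f n) μ)
    (hg : ∀ n, AEStronglyMeasurable (g n) μ) (e : ∀ n, h n =ᵐ[μ] f n + g n)
    (tf : Tendsto (fun n => eLpNorm (f n) 2 μ) atTop (𝓝 0))
    (tg : Tendsto (fun n => eLpNorm (g n) 2 μ) atTop (𝓝 0)) :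
    Tendsto (fun n => eLpNorm (h n) 2 μ) atTop (𝓝 0) := by
  have t : Tendsto (fun n => eLpNorm (f n) 2 μ + eLpNorm (g n) 2 μ) atTop (𝓝 0) := by
    simpa using tf.add tg
  refine tendsto_of_tendsto_of_tendsto_of_le_of_le tendsto_const_nhds t (fun _ => zero_le) ?_
  intro n
  simp only
  rw [eLpNorm_congr_ae (e n)]
  exact eLpNorm_add_le (hf n) (hg n) (by norm_num)

theorem tendsto_eLpNorm_smul {X : Type*} [MeasurableSpace X] {μ : Measure X} (c : ℂ)
    {f h : ℕ → X → ℂ} (e : ∀ n, h n =ᵐ[μ] c • f n)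
    (tf : Tendsto (fun n => eLpNorm (f n) 2 μ) atTop (𝓝 0)) :
    Tendsto (fun n => eLpNorm (h n) 2 μ) atTop (𝓝 0) := by
  have t : Tendsto (fun n => ‖c‖ₑ * eLpNorm (f n) 2 μ) atTop (𝓝 0) := by
    simpa using ENNReal.Tendsto.const_mul tf (Or.inr enorm_ne_top)
  refine t.congr ?_
  intro n
  rw [eLpNorm_congr_ae (e n), eLpNorm_const_smul]

theorem HasZeroTrace.add {d : ℕ} {Ω ΓD : Set (E d)} {u v : Jet Ω}
    (hu : HasZeroTrace ΓD u) (hv : HasZeroTrace ΓD v) : HasZeroTrace ΓD (u + v) := by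
  obtain ⟨φ, s, c, t0, t1, tb⟩ := hu
  obtain ⟨φ', s', c', t0', t1', tb'⟩ := hv
  refine ⟨fun n => φ n + φ' n, fun n => (s n).add (s' n), fun n => (c n).add (c' n), ?_, ?_, ?_⟩
  · refine tendsto_eLpNorm_add
      (fun n => (s n).continuous.aestronglyMeasurable.sub (Lp.aestronglyMeasurable _))
      (fun n => (s' n).continuous.aestronglyMeasurable.sub (Lp.aestronglyMeasurable _)) ?_ t0 t0'
    intro n
    filter_upwards [Lp.coeFn_add (u 0) (v 0)] with x hx
    simp only [PiLp.add_apply, hx, Pi.add_apply, Pi.sub_apply]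
    ring
  · intro i
    refine tendsto_eLpNorm_add
      (fun n => (continuous_pderiv (s n) i).aestronglyMeasurable.sub (Lp.aestronglyMeasurable _))
      (fun n => (continuous_pderiv (s' n) i).aestronglyMeasurable.sub (Lp.aestronglyMeasurable _))
      ?_ (t1 i) (t1' i)
    intro n
    filter_upwards [Lp.coeFn_add (u i.succ) (v i.succ)] with x hx
    have hd : pderiv (φ n + φ' n) i x = pderiv (φ n) i x + pderiv (φ' n) i x := by
      unfold pderiv
      rw [fderiv_add ((s n).differentiable (by simp) x) ((s' n).differentiable (by simp) x)]
      rfl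
    simp only [PiLp.add_apply, hx, Pi.add_apply, Pi.sub_apply, hd]
    ring
  · exact tendsto_eLpNorm_add (fun n => (s n).continuous.aestronglyMeasurable)
      (fun n => (s' n).continuous.aestronglyMeasurable) (fun n => EventuallyEq.rfl) tb tb'

theorem HasZeroTrace.smul {d : ℕ} {Ω ΓD : Set (E d)} {u : Jet Ω} (k : ℂ)
    (hu : HasZeroTrace ΓD u) : HasZeroTrace ΓD (k • u) := by
  obtain ⟨φ, s, c, t0, t1, tb⟩ := hu
  refine ⟨fun n => k • φ n, fun n => (s n).const_smul k, fun n => ?_, ?_, ?_, ?_⟩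
  · exact (c n).comp_left (g := fun z : ℂ => k • z) (smul_zero k)
  · refine tendsto_eLpNorm_smul k ?_ t0
    intro n
    filter_upwards [Lp.coeFn_smul k (u 0)] with x hx
    simp only [PiLp.smul_apply, hx, Pi.smul_apply, smul_sub]
  · intro i
    refine tendsto_eLpNorm_smul k ?_ (t1 i)
    intro n
    filter_upwards [Lp.coeFn_smul k (u i.succ)] with x hx
    have hd : pderiv (k • φ n) i x = k • pderiv (φ n) i x := by
      unfold pderiv
      rw [fderiv_const_smul ((s n).differentiable (by simp) x)]
      rfl
    simp only [PiLp.smul_apply, hx, Pi.smul_apply, hd, smul_sub]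
  · exact tendsto_eLpNorm_smul k (fun n => EventuallyEq.rfl) tb

theorem hasZeroTrace_zero {d : ℕ} {Ω : Set (E d)} (ΓD : Set (E d)) :
    HasZeroTrace ΓD (0 : Jet Ω) := by
  have z : eLpNorm (fun x => (0 : ℂ) - (0 : L2 Ω) x) 2 (volume.restrict Ω) = 0 := by
    rw [← eLpNorm_zero (p := 2) (μ := volume.restrict Ω) (α := E d) (ε := ℂ)]
    refine eLpNorm_congr_ae ?_
    filter_upwards [Lp.coeFn_zero ℂ 2 (volume.restrict Ω)] with x hx
    simp only [hx, Pi.zero_apply, sub_zero]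
  refine ⟨fun _ => 0, fun _ => contDiff_const, fun _ => HasCompactSupport.zero, ?_, ?_, ?_⟩
  · simpa using z
  · intro i
    simpa [pderiv] using z
  · simp

/-- `𝕍`: the functions in `H¹(Ω)` with vanishing trace on `ΓD`, with the norm of `H¹(Ω)`. -/
def V {d : ℕ} (Ω ΓD : Set (E d)) : Submodule ℂ (Jet Ω) where
  carrier := {u | u ∈ H1 Ω ∧ HasZeroTrace ΓD u}
  add_mem' := fun hu hv => ⟨(H1 Ω).add_mem hu.1 hv.1, hu.2.add hv.2⟩
  zero_mem' := ⟨(H1 Ω).zero_mem, hasZeroTrace_zero ΓD⟩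
  smul_mem' := fun c _ hu => ⟨(H1 Ω).smul_mem c hu.1, hu.2.smul c⟩

/-- The `L²(Ω)` function underlying an element of `𝕍`. -/
def fn {d : ℕ} {Ω ΓD : Set (E d)} (w : V Ω ΓD) : L2 Ω := (w : Jet Ω) 0

/-- The square of the `H^s(Ω)` seminorm of `g`, for `0 < s ≤ 1`, with value `∞` if `g` is not in
`H^s(Ω)`: the Sobolev-Slobodeckij (Gagliardo) double integral if `s < 1`, and `∫ |∇g|²` if
`s = 1` (an infimum over the at most one element of `H¹(Ω)` represented by `g`). -/
def sobolevSeminormSq {d : ℕ} {Ω : Set (E d)} (s : ℝ) (g : L2 Ω) : ℝ≥0∞ :=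
  if s < 1 then
    ∫⁻ x in Ω, ∫⁻ y in Ω, ENNReal.ofReal (‖g x - g y‖ ^ 2 / ‖x - y‖ ^ ((d : ℝ) + 2 * s))
  else ⨅ h : H1 Ω, ⨅ _ : (h : Jet Ω) 0 = g, ∑ i : Fin d, ‖(h : Jet Ω) i.succ‖ₑ ^ 2

/-- `u ∈ H¹(Ω)` belongs to `H^{1+s}(Ω)`, `0 < s ≤ 1`: all first derivatives are in `H^s(Ω)`. -/
def MemSobolev {d : ℕ} {Ω : Set (E d)} (s : ℝ) (u : Jet Ω) : Prop :=
  u ∈ H1 Ω ∧ ∀ i : Fin d, sobolevSeminormSq s (u i.succ) < ⊤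

/-- The norm of `H^{1+s}(Ω)`, `0 < s ≤ 1`. -/
def sobolevNorm {d : ℕ} {Ω : Set (E d)} (s : ℝ) (u : Jet Ω) : ℝ :=
  Real.sqrt (‖u‖ ^ 2 + ∑ i : Fin d, (sobolevSeminormSq s (u i.succ)).toReal)

/-- `H^{1+s}(Ω) ∩ 𝕍`. -/
def sobolevV {d : ℕ} (Ω ΓD : Set (E d)) (s : ℝ) : Set (V Ω ΓD) :=
  {w | MemSobolev s (w : Jet Ω)}

/-! ### The sesquilinear form -/

/-- The integrand of the form: index `0` stands for the function, index `i.succ` for the `i`-th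
derivative, so that this is
`∑ a_{ij} u_i v̄_j + ∑ (a_{i0} u_i v̄ + a_{0i} u v̄_i) + a_{00} u v̄`. -/
def formIntegrand {d : ℕ} {Ω : Set (E d)} (a : Fin (d + 1) → Fin (d + 1) → E d → ℂ)
    (u v : Jet Ω) (x : E d) : ℂ :=
  ∑ i, ∑ j, a i j x * u i x * conj (v j x)

/-- The form `A(u,v)` on `𝕍`. -/
def form {d : ℕ} (Ω ΓD : Set (E d)) (a : Fin (d + 1) → Fin (d + 1) → E d → ℂ)
    (u v : V Ω ΓD) : ℂ :=
  ∫ x in Ω, formIntegrand a (u : Jet Ω) (v : Jet Ω) x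

/-- The Hermitian part `(A(u,v) + conj A(v,u)) / 2` of a form. -/
def rePart {d : ℕ} {Ω ΓD : Set (E d)} (B : V Ω ΓD → V Ω ΓD → ℂ) (u v : V Ω ΓD) : ℂ :=
  (B u v + conj (B v u)) / 2

/-! ### The operator of a form and its fractional powers

In this section `B` is a form on `𝕍`; the definitions are used for coercive bounded forms, where
all the objects chosen below exist and are unique. -/

/-- `u ∈ D(A)` and `A u = f` for the operator `A` of the form `B`: `u ∈ 𝕍` and
`B(u,φ) = (f,φ)` for all `φ ∈ 𝕍`. -/
def IsOp {d : ℕ} {Ω ΓD : Set (E d)} (B : V Ω ΓD → V Ω ΓD → ℂ) (u f : L2 Ω) : Prop :=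
  ∃ w : V Ω ΓD, fn w = u ∧ ∀ φ : V Ω ΓD, B w φ = inner ℂ (fn φ) f

open Classical in
/-- `(μ I + A)⁻¹ f`: the `u ∈ D(A)` with `A u = f - μ u`. -/
def resolvent {d : ℕ} {Ω ΓD : Set (E d)} (B : V Ω ΓD → V Ω ΓD → ℂ) (μ : ℝ) (f : L2 Ω) : L2 Ω :=
  if h : ∃ u : L2 Ω, IsOp B u (f - (μ : ℂ) • u) then h.choose else 0

open Classical in
/-- The negative power `A^{-β} f`, `0 ≤ β < 1`, by the Balakrishnan formula
`A^{-β} f = (sin(βπ)/π) ∫₀^∞ μ^{-β} (μ I + A)⁻¹ f dμ` for `β > 0`, and `A⁰ = I`. -/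
def negPow {d : ℕ} {Ω ΓD : Set (E d)} (B : V Ω ΓD → V Ω ΓD → ℂ) (β : ℝ) (f : L2 Ω) : L2 Ω :=
  if β = 0 then f
  else ((Real.sin (β * Real.pi) / Real.pi : ℝ) : ℂ) •
    ∫ μ in Ioi (0 : ℝ), ((μ ^ (-β) : ℝ) : ℂ) • resolvent B μ f

/-- `u ∈ D(A^β)` and `A^β u = f`, `0 ≤ β ≤ 1`: for `β > 0`, `A^{β-1} u ∈ D(A)` and
`f = A (A^{β-1} u)`; for `β = 0`, `A⁰ = I`. -/
def IsPow {d : ℕ} {Ω ΓD : Set (E d)} (B : V Ω ΓD → V Ω ΓD → ℂ) (β : ℝ) (u f : L2 Ω) : Prop :=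
  if β = 0 then f = u else IsOp B (negPow B (1 - β) u) f

/-- The domain `D(A^β)`, `0 ≤ β ≤ 1`. -/
def powDomain {d : ℕ} {Ω ΓD : Set (E d)} (B : V Ω ΓD → V Ω ΓD → ℂ) (β : ℝ) : Set (L2 Ω) :=
  {u | ∃ f, IsPow B β u f}

open Classical in
/-- `A^β u` for `u ∈ D(A^β)`. The norm of `D(A^β)` is `‖A^β u‖`. -/
def opPow {d : ℕ} {Ω ΓD : Set (E d)} (B : V Ω ΓD → V Ω ΓD → ℂ) (β : ℝ) (u : L2 Ω) : L2 Ω :=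
  if h : ∃ f, IsPow B β u f then h.choose else 0

/-! ### Dotted spaces, the solution operator `T_a` -/

/-- The norm `‖S^{t/2} u‖` of the dotted space `Ḣᵗ = D(S^{t/2})`, `0 ≤ t < 1`, where `S` is the
operator of the Hermitian part of the form `B`. -/
def dotNorm {d : ℕ} {Ω ΓD : Set (E d)} (B : V Ω ΓD → V Ω ΓD → ℂ) (t : ℝ) (u : L2 Ω) : ℝ :=
  ‖opPow (rePart B) (t / 2) u‖

/-- The bounded antilinear functionals on `𝕍`. -/
abbrev Va {d : ℕ} (Ω ΓD : Set (E d)) := V Ω ΓD →SL[starRingEnd ℂ] ℂ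

/-- The space `Ḣ_a^{-t}`, `0 ≤ t < 1`, of antilinear functionals dual to `Ḣᵗ`: those functionals
on the dense subspace `𝕍` of `Ḣᵗ` that are bounded in the norm of `Ḣᵗ`. -/
def dotDual {d : ℕ} {Ω ΓD : Set (E d)} (B : V Ω ΓD → V Ω ΓD → ℂ) (t : ℝ) : Set (Va Ω ΓD) :=
  {F | ∃ C : ℝ, ∀ θ : V Ω ΓD, ‖F θ‖ ≤ C * dotNorm B t (fn θ)}

/-- The (dual) norm of `Ḣ_a^{-t}`, i.e. `sup |⟨F,θ⟩| / ‖θ‖_{Ḣᵗ}`. -/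
def dotDualNorm {d : ℕ} {Ω ΓD : Set (E d)} (B : V Ω ΓD → V Ω ΓD → ℂ) (t : ℝ)
    (F : Va Ω ΓD) : ℝ :=
  sInf {C : ℝ | 0 ≤ C ∧ ∀ θ : V Ω ΓD, ‖F θ‖ ≤ C * dotNorm B t (fn θ)}

open Classical in
/-- `T_a F`: the solution `u ∈ 𝕍` of `B(u,φ) = ⟨F,φ⟩` for all `φ ∈ 𝕍`. -/
def Ta {d : ℕ} {Ω ΓD : Set (E d)} (B : V Ω ΓD → V Ω ΓD → ℂ) (F : Va Ω ΓD) : V Ω ΓD :=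
  if h : ∃ u : V Ω ΓD, ∀ φ : V Ω ΓD, B u φ = F φ then h.choose else 0

/-- `T_a` is an isomorphism (bijective, bounded with bounded inverse) of `Ḣ_a^{-1+s}` onto
`H^{1+s}(Ω) ∩ 𝕍`. -/
def TaIsIso {d : ℕ} {Ω ΓD : Set (E d)} (B : V Ω ΓD → V Ω ΓD → ℂ) (s : ℝ) : Prop :=
  BijOn (Ta B) (dotDual B (1 - s)) (sobolevV Ω ΓD s) ∧
    ∃ c C : ℝ, 0 < c ∧ 0 < C ∧ ∀ F ∈ dotDual B (1 - s),
      c * dotDualNorm B (1 - s) F ≤ sobolevNorm s (Ta B F : Jet Ω) ∧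
        sobolevNorm s (Ta B F : Jet Ω) ≤ C * dotDualNorm B (1 - s) F

/-- The form is coercive on `𝕍`. -/
def IsCoerciveForm {d : ℕ} {Ω ΓD : Set (E d)} (B : V Ω ΓD → V Ω ΓD → ℂ) : Prop :=
  ∃ c₀ : ℝ, 0 < c₀ ∧ ∀ v : V Ω ΓD, c₀ * ‖v‖ ^ 2 ≤ (B v v).re

/-- The form is bounded on `𝕍`. -/
def IsBoundedForm {d : ℕ} {Ω ΓD : Set (E d)} (B : V Ω ΓD → V Ω ΓD → ℂ) : Prop :=
  ∃ c₁ : ℝ, 0 < c₁ ∧ ∀ u v : V Ω ΓD, ‖B u v‖ ≤ c₁ * ‖u‖ * ‖v‖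

end FracPow

end

/-!
# Fractional power domains of coercive forms

The proof transfers the hypothesis on `T_a` to `D(A^{(1+s)/2})` through Kato's theorem that the
domains of the powers `A^γ`, `A*^γ`, `S^γ` of an accretive operator, its adjoint and its real part
agree for `γ < 1/2`. Put `γ = (1 - s) / 2`. If `g = A^{1-γ} u`, then `u = A^{γ-1} g`, and formally
`A(u, θ) = (g, A*^γ θ)`, which Kato's theorem bounds by `‖g‖ ‖S^γ θ‖`; so `u = T_a F` with `F` in the
dual of `Ḣ^{1-s}` (`exists_form_le_of_isPow`). Conversely, if `u = T_a F` with such an `F`, then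
`A(A^{-γ} u, φ) = A(u, A*^{-γ} φ) = F(A*^{-γ} φ)` is bounded by `‖S^γ A*^{-γ} φ‖`, hence by `‖φ‖`, and
`A^{-γ} u` is in `D(A)` (`exists_isPow_of_form_le`).

All powers are Balakrishnan integrals of resolvents, regarded as maps `R(μ) : H → W` into the form
domain `W`, and no spectral theorem is used. Three facts carry the argument.

* The quadratic estimate `∫₀^∞ ‖R(μ) g‖₁² dμ ≤ C ‖g‖²`
  (`Coercive.exists_lintegral_sq_norm_res_le`). It follows from the energy identity for an implicit
  Euler scheme whose step sizes run through the powers of two: the resolvents are geometrically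
  weighted sums of the Euler steps.
* Kato's theorem in bilinear form (`Coercive.exists_norm_inner_balLift_le`): for two coercive forms
  on `W`, `|A₁(A₁^{-(1-γ)} g, A₂^{-γ} f)| ≤ C ‖g‖ ‖f‖`. With the Balakrishnan integrals rewritten so
  that the integrands are `R₁(2μ) R₁(μ) g` and `A₂ R₂(2ν) R₂(ν) f`, the form is at most
  `C ‖R₁(μ) g‖₁ ‖R₂(ν) f‖₁ min(μ⁻¹, (μ ν)^{-1/2})`, and a Schur test together with the quadratic
  estimate finishes the proof. The test needs exactly `0 < γ < 1/2`.
* The semigroup law `A^{-(1-γ)} A^{-γ} = κ A⁻¹` with `κ ≠ 0` (`Coercive.exists_bal_bal_eq`), by the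
  resolvent identity and Frullani's integral. The value of `κ`, like that of every constant in the
  Balakrishnan formula, is irrelevant for an equivalence of norms.

The space `𝕍` enters only as a Hilbert space that embeds injectively and densely into `L²(Ω)`:
it is closed in the space of jets, it contains the test functions, and weak derivatives are unique.
The case `s = 1`, where `γ = 0`, needs only the representation of bounded functionals on `L²(Ω)`.
-/

noncomputable section

namespace FracPow


section

variable {H W : Type*} [NormedAddCommGroup H] [InnerProductSpace ℂ H] [CompleteSpace H]
  [NormedAddCommGroup W] [InnerProductSpace ℂ W] [CompleteSpace W]

/-! ### Resolvents of coercive forms -/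

/-- The bounded form `(u, v) ↦ ⟪v, T u⟫` on `W` is coercive with constant `c`. -/
def Coercive (T : W →L[ℂ] W) (c : ℝ) : Prop :=
  0 < c ∧ ∀ v : W, c * ‖v‖ ^ 2 ≤ (inner ℂ v (T v)).re

/-- The operator on `W` of the shifted form `⟪v, T u⟫ + μ (ι u, ι v)`. -/
def shift (T : W →L[ℂ] W) (ι : W →L[ℂ] H) (μ : ℝ) : W →L[ℂ] W :=
  T + (μ : ℂ) • (ContinuousLinearMap.adjoint ι ∘L ι)

/-- The resolvent `(μ + A)⁻¹` of the operator `A` on `H` of the form `⟪v, T u⟫`, as an operator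
from `H` into the form domain `W`. -/
def res (T : W →L[ℂ] W) (ι : W →L[ℂ] H) (μ : ℝ) : H →L[ℂ] W :=
  Ring.inverse (shift T ι μ) ∘L ContinuousLinearMap.adjoint ι

variable {T : W →L[ℂ] W} {ι : W →L[ℂ] H} {c μ ν : ℝ}

theorem inner_shift (u v : W) :
    inner ℂ v (shift T ι μ u) = inner ℂ v (T u) + μ * inner ℂ (ι v) (ι u) := by
  simp [shift, ContinuousLinearMap.adjoint_inner_right]

theorem re_inner_shift_self (v : W) :
    (inner ℂ v (shift T ι μ v)).re = (inner ℂ v (T v)).re + μ * ‖ι v‖ ^ 2 := by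
  rw [inner_shift, inner_self_eq_norm_sq_to_K]
  simp [← Complex.ofReal_pow]

theorem Coercive.le_re_inner_shift (hT : Coercive T c) (v : W) :
    c * ‖v‖ ^ 2 + μ * ‖ι v‖ ^ 2 ≤ (inner ℂ v (shift T ι μ v)).re := by
  rw [re_inner_shift_self]
  linarith [hT.2 v]

theorem Coercive.isUnit_shift (hT : Coercive T c) (hμ : 0 ≤ μ) : IsUnit (shift T ι μ) := by
  refine ContinuousLinearMap.isUnit_of_forall_le_norm_inner_map _ (c := ⟨c, hT.1.le⟩) hT.1
    fun x => ?_
  have h1 := hT.le_re_inner_shift (ι := ι) (μ := μ) x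
  have h2 : 0 ≤ μ * ‖ι x‖ ^ 2 := by positivity
  have h3 := Complex.re_le_norm (inner ℂ x (shift T ι μ x))
  rw [norm_inner_symm]
  change ‖x‖ ^ 2 * c ≤ _
  linarith

theorem Coercive.inverse_shift_apply (hT : Coercive T c) (hμ : 0 ≤ μ) (v : W) :
    Ring.inverse (shift T ι μ) (shift T ι μ v) = v := by
  have := Ring.inverse_mul_cancel _ (hT.isUnit_shift (ι := ι) hμ)
  exact DFunLike.congr_fun this v

theorem Coercive.shift_inverse_apply (hT : Coercive T c) (hμ : 0 ≤ μ) (v : W) :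
    shift T ι μ (Ring.inverse (shift T ι μ) v) = v := by
  have := Ring.mul_inverse_cancel _ (hT.isUnit_shift (ι := ι) hμ)
  exact DFunLike.congr_fun this v

theorem Coercive.shift_res (hT : Coercive T c) (hμ : 0 ≤ μ) (f : H) :
    shift T ι μ (res T ι μ f) = ContinuousLinearMap.adjoint ι f :=
  hT.shift_inverse_apply hμ _

theorem Coercive.inner_res (hT : Coercive T c) (hμ : 0 ≤ μ) (f : H) (v : W) :
    inner ℂ v (T (res T ι μ f)) = inner ℂ (ι v) (f - (μ : ℂ) • ι (res T ι μ f)) := by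
  have h := congrArg (inner ℂ v) (hT.shift_res (ι := ι) hμ f)
  rw [inner_shift, ContinuousLinearMap.adjoint_inner_right] at h
  rw [inner_sub_right, inner_smul_right, ← h]
  ring

theorem Coercive.eq_of_shift_eq (hT : Coercive T c) (hμ : 0 ≤ μ) {u v : W}
    (h : shift T ι μ u = shift T ι μ v) : u = v := by
  rw [← hT.inverse_shift_apply (ι := ι) hμ u, h, hT.inverse_shift_apply hμ]

theorem Coercive.eq_res (hT : Coercive T c) (hμ : 0 ≤ μ) {f : H} {w : W}
    (h : ∀ v, inner ℂ v (T w) = inner ℂ (ι v) (f - (μ : ℂ) • ι w)) : w = res T ι μ f := by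
  refine hT.eq_of_shift_eq (ι := ι) hμ ?_
  refine ext_inner_left ℂ fun v => ?_
  rw [hT.shift_res hμ, ContinuousLinearMap.adjoint_inner_right, inner_shift, h, inner_sub_right,
    inner_smul_right]
  ring

/-- The energy identity, as an inequality. -/
theorem Coercive.energy_res (hT : Coercive T c) (hμ : 0 ≤ μ) (f : H) :
    c * ‖res T ι μ f‖ ^ 2 + μ * ‖ι (res T ι μ f)‖ ^ 2 ≤ (inner ℂ (ι (res T ι μ f)) f).re := by
  have h := hT.le_re_inner_shift (ι := ι) (μ := μ) (res T ι μ f)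
  rwa [hT.shift_res hμ, ContinuousLinearMap.adjoint_inner_right] at h

theorem Coercive.energy_res' (hT : Coercive T c) (hμ : 0 ≤ μ) (f : H) :
    c * ‖res T ι μ f‖ ^ 2 + μ * ‖ι (res T ι μ f)‖ ^ 2 ≤ ‖ι (res T ι μ f)‖ * ‖f‖ :=
  (hT.energy_res hμ f).trans ((Complex.re_le_norm _).trans (norm_inner_le_norm _ _))

theorem Coercive.norm_res_le (hT : Coercive T c) (hι : ‖ι‖ ≤ 1) (hμ : 0 ≤ μ) (f : H) :
    ‖res T ι μ f‖ ≤ c⁻¹ * ‖f‖ := by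
  have h := hT.energy_res' (ι := ι) hμ f
  have h1 : ‖ι (res T ι μ f)‖ ≤ ‖res T ι μ f‖ := by
    simpa using ι.le_of_opNorm_le hι (res T ι μ f)
  have hc := hT.1
  rcases (norm_nonneg (res T ι μ f)).eq_or_lt with h0 | h0
  · rw [← h0]; positivity
  have h2 : 0 ≤ μ * ‖ι (res T ι μ f)‖ ^ 2 := by positivity
  have h3 := mul_le_mul_of_nonneg_right h1 (norm_nonneg f)
  rw [inv_mul_eq_div, le_div_iff₀ hc]
  refine le_of_mul_le_mul_right (a := ‖res T ι μ f‖) ?_ h0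
  nlinarith

theorem Coercive.mul_norm_map_res_le (hT : Coercive T c) (hμ : 0 ≤ μ) (f : H) :
    μ * ‖ι (res T ι μ f)‖ ≤ ‖f‖ := by
  have h := hT.energy_res' (ι := ι) hμ f
  have hc := hT.1
  rcases (norm_nonneg (ι (res T ι μ f))).eq_or_lt with h0 | h0
  · rw [← h0]; simp
  have h2 : 0 ≤ c * ‖res T ι μ f‖ ^ 2 := by positivity
  refine le_of_mul_le_mul_right (a := ‖ι (res T ι μ f)‖) ?_ h0
  nlinarith

theorem Coercive.sq_norm_res_le (hT : Coercive T c) (hμ : 0 ≤ μ) (f : H) :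
    c * μ * ‖res T ι μ f‖ ^ 2 ≤ ‖f‖ ^ 2 := by
  have h := hT.energy_res' (ι := ι) hμ f
  have h1 := hT.mul_norm_map_res_le (ι := ι) hμ f
  have h2 : c * ‖res T ι μ f‖ ^ 2 ≤ ‖ι (res T ι μ f)‖ * ‖f‖ := by
    have : 0 ≤ μ * ‖ι (res T ι μ f)‖ ^ 2 := by positivity
    linarith
  calc c * μ * ‖res T ι μ f‖ ^ 2 = μ * (c * ‖res T ι μ f‖ ^ 2) := by ring
    _ ≤ μ * (‖ι (res T ι μ f)‖ * ‖f‖) := by gcongr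
    _ = (μ * ‖ι (res T ι μ f)‖) * ‖f‖ := by ring
    _ ≤ ‖f‖ * ‖f‖ := by gcongr
    _ = ‖f‖ ^ 2 := by ring

theorem Coercive.norm_res_le_rpow (hT : Coercive T c) (hμ : 0 < μ) (f : H) :
    ‖res T ι μ f‖ ≤ c ^ (-(1 / 2) : ℝ) * μ ^ (-(1 / 2) : ℝ) * ‖f‖ := by
  have h := hT.sq_norm_res_le (ι := ι) hμ.le f
  have hc := hT.1
  rw [← Real.mul_rpow hc.le hμ.le, Real.rpow_neg (by positivity), ← Real.sqrt_eq_rpow,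
    inv_mul_eq_div, le_div_iff₀ (by positivity)]
  refine abs_le_of_sq_le_sq' ?_ (by positivity) |>.2
  rw [mul_pow, Real.sq_sqrt (by positivity)]
  linarith

/-- `(μ + A)⁻¹ A w`, for `w` in the form domain. -/
def resOp (T : W →L[ℂ] W) (ι : W →L[ℂ] H) (μ : ℝ) (w : W) : W := Ring.inverse (shift T ι μ) (T w)

theorem Coercive.resOp_eq (hT : Coercive T c) (hμ : 0 ≤ μ) (w : W) :
    resOp T ι μ w = w - (μ : ℂ) • res T ι μ (ι w) := by
  refine hT.eq_of_shift_eq (ι := ι) hμ ?_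
  rw [resOp, hT.shift_inverse_apply hμ, map_sub, map_smul, hT.shift_res hμ]
  simp [shift]

theorem Coercive.energy_resOp (hT : Coercive T c) (hμ : 0 ≤ μ) (w : W) :
    c * ‖resOp T ι μ w‖ ^ 2 + μ * ‖ι (resOp T ι μ w)‖ ^ 2 ≤
      ‖resOp T ι μ w‖ * (‖T‖ * ‖w‖) := by
  have h := hT.le_re_inner_shift (ι := ι) (μ := μ) (resOp T ι μ w)
  rw [resOp, hT.shift_inverse_apply hμ, ← resOp] at h
  refine h.trans ((Complex.re_le_norm _).trans ((norm_inner_le_norm _ _).trans ?_))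
  gcongr
  exact T.le_opNorm w

theorem Coercive.norm_resOp_le (hT : Coercive T c) (hμ : 0 ≤ μ) (w : W) :
    ‖resOp T ι μ w‖ ≤ ‖T‖ / c * ‖w‖ := by
  have h := hT.energy_resOp (ι := ι) hμ w
  have hc := hT.1
  rcases (norm_nonneg (resOp T ι μ w)).eq_or_lt with h0 | h0
  · rw [← h0]; positivity
  have h2 : 0 ≤ μ * ‖ι (resOp T ι μ w)‖ ^ 2 := by positivity
  rw [div_mul_eq_mul_div, le_div_iff₀ hc]
  refine le_of_mul_le_mul_right (a := ‖resOp T ι μ w‖) ?_ h0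
  nlinarith

theorem Coercive.sq_norm_map_resOp_le (hT : Coercive T c) (hμ : 0 ≤ μ) (w : W) :
    μ * ‖ι (resOp T ι μ w)‖ ^ 2 ≤ ‖T‖ ^ 2 / c * ‖w‖ ^ 2 := by
  have h := hT.energy_resOp (ι := ι) hμ w
  have h1 := hT.norm_resOp_le (ι := ι) hμ w
  have hc := hT.1
  have h2 : 0 ≤ c * ‖resOp T ι μ w‖ ^ 2 := by positivity
  calc μ * ‖ι (resOp T ι μ w)‖ ^ 2 ≤ ‖resOp T ι μ w‖ * (‖T‖ * ‖w‖) := by linarith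
    _ ≤ (‖T‖ / c * ‖w‖) * (‖T‖ * ‖w‖) := by gcongr
    _ = _ := by ring

theorem Coercive.norm_map_resOp_le (hT : Coercive T c) (hμ : 0 < μ) (w : W) :
    ‖ι (resOp T ι μ w)‖ ≤ ‖T‖ * c ^ (-(1 / 2) : ℝ) * μ ^ (-(1 / 2) : ℝ) * ‖w‖ := by
  have h := hT.sq_norm_map_resOp_le (ι := ι) hμ.le w
  have hc := hT.1
  have e : ‖T‖ * c ^ (-(1 / 2) : ℝ) * μ ^ (-(1 / 2) : ℝ) * ‖w‖
      = (‖T‖ * ‖w‖) / √(c * μ) := by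
    rw [mul_assoc ‖T‖, ← Real.mul_rpow hc.le hμ.le, Real.rpow_neg (by positivity),
      ← Real.sqrt_eq_rpow]
    field_simp
  rw [e, le_div_iff₀ (by positivity)]
  refine abs_le_of_sq_le_sq' ?_ (by positivity) |>.2
  rw [mul_pow, Real.sq_sqrt (by positivity)]
  calc ‖ι (resOp T ι μ w)‖ ^ 2 * (c * μ) = c * (μ * ‖ι (resOp T ι μ w)‖ ^ 2) := by ring
    _ ≤ c * (‖T‖ ^ 2 / c * ‖w‖ ^ 2) := by gcongr
    _ = _ := by field_simp

theorem Coercive.mul_norm_res_map_le (hT : Coercive T c) (hμ : 0 ≤ μ) (w : W) :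
    μ * ‖res T ι μ (ι w)‖ ≤ (1 + ‖T‖ / c) * ‖w‖ := by
  have h := hT.norm_resOp_le (ι := ι) hμ w
  rw [hT.resOp_eq hμ] at h
  have h1 : ‖(μ : ℂ) • res T ι μ (ι w)‖ = μ * ‖res T ι μ (ι w)‖ := by
    rw [norm_smul, Complex.norm_real, Real.norm_of_nonneg hμ]
  rw [← h1]
  have := norm_sub_norm_le ((μ : ℂ) • res T ι μ (ι w)) w
  rw [norm_sub_rev] at this
  linarith

/-- The resolvent identity. -/
theorem Coercive.res_sub_res (hT : Coercive T c) (hμ : 0 ≤ μ) (hν : 0 ≤ ν) (f : H) :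
    res T ι μ f - res T ι ν f = ((ν - μ : ℝ) : ℂ) • res T ι ν (ι (res T ι μ f)) := by
  refine hT.eq_of_shift_eq (ι := ι) hν ?_
  rw [map_sub, map_smul, hT.shift_res hν, hT.shift_res hν]
  have e : shift T ι ν (res T ι μ f) = shift T ι μ (res T ι μ f) +
      ((ν - μ : ℝ) : ℂ) • ContinuousLinearMap.adjoint ι (ι (res T ι μ f)) := by
    simp [shift, sub_smul]
  rw [e, hT.shift_res hμ]
  abel

theorem Coercive.res_map_res_comm (hT : Coercive T c) (hμ : 0 ≤ μ) (hν : 0 ≤ ν) (f : H) :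
    res T ι μ (ι (res T ι ν f)) = res T ι ν (ι (res T ι μ f)) := by
  rcases eq_or_ne μ ν with rfl | hne
  · rfl
  have h1 := hT.res_sub_res (ι := ι) hμ hν f
  have h2 := hT.res_sub_res (ι := ι) hν hμ f
  have h3 : ((ν - μ : ℝ) : ℂ) • res T ι μ (ι (res T ι ν f)) =
      ((ν - μ : ℝ) : ℂ) • res T ι ν (ι (res T ι μ f)) := by
    rw [← h1, ← neg_sub (res T ι ν f), h2, ← neg_smul]
    push_cast
    congr 1
    ring
  exact smul_right_injective _ (by exact_mod_cast sub_ne_zero.2 hne.symm) h3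

theorem Coercive.continuousOn_res (hT : Coercive T c) :
    ContinuousOn (res T ι) (Ici 0) := by
  intro μ hμ
  obtain ⟨x, hx⟩ := hT.isUnit_shift (ι := ι) hμ
  have h1 : Continuous (shift T ι) := by
    unfold shift
    fun_prop
  have h2 := NormedRing.inverse_continuousAt x
  rw [hx] at h2
  have h3 : ContinuousAt (fun μ => Ring.inverse (shift T ι μ)) μ :=
    ContinuousAt.comp (f := shift T ι) h2 h1.continuousAt
  exact (h3.clm_comp continuousAt_const).continuousWithinAt

theorem Coercive.continuousOn_res_apply (hT : Coercive T c) (f : H) :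
    ContinuousOn (fun μ => res T ι μ f) (Ici 0) :=
  hT.continuousOn_res.clm_apply continuousOn_const

/-- Comparison of resolvents at comparable points. -/
theorem Coercive.norm_res_le_norm_res (hT : Coercive T c) (hμ : 0 < μ) (h1 : μ ≤ ν)
    (f : H) : ‖res T ι ν f‖ ≤ (2 + ‖T‖ / c) * ‖res T ι μ f‖ := by
  have hν : 0 < ν := hμ.trans_le h1
  have e := hT.res_sub_res (ι := ι) hμ.le hν.le f
  have e' : res T ι ν f = res T ι μ f - ((ν - μ : ℝ) : ℂ) • res T ι ν (ι (res T ι μ f)) := by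
    rw [← e]; abel
  have h2 := hT.mul_norm_res_map_le (ι := ι) hν.le (res T ι μ f)
  rw [e']
  refine (norm_sub_le _ _).trans ?_
  rw [norm_smul, Complex.norm_real, Real.norm_of_nonneg (sub_nonneg.2 h1)]
  have h3 : (ν - μ) * ‖res T ι ν (ι (res T ι μ f))‖ ≤ ν * ‖res T ι ν (ι (res T ι μ f))‖ := by
    gcongr; linarith
  linarith

end

section

variable {H W : Type*} [NormedAddCommGroup H] [InnerProductSpace ℂ H] [CompleteSpace H]
  [NormedAddCommGroup W] [InnerProductSpace ℂ W] [CompleteSpace W]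
variable {T : W →L[ℂ] W} {ι : W →L[ℂ] H} {c μ ν : ℝ}

/-! ### The quadratic estimate for the resolvent -/

/-- The implicit Euler scheme for `u' + A u = 0`, `u(0) = g`, with the growing step sizes
`2 / Λ, 4 / Λ, 8 / Λ, …`. -/
def euler (T : W →L[ℂ] W) (ι : W →L[ℂ] H) (Λ : ℝ) (g : H) : ℕ → H
  | 0 => g
  | k + 1 => ((Λ / 2 ^ (k + 1) : ℝ) : ℂ) • ι (res T ι (Λ / 2 ^ (k + 1)) (euler T ι Λ g k))

/-- The weighted sum `∑ j ≤ k, 2 ^ (j - k) ‖uⱼ‖` over the Euler steps `uⱼ` in the norm of the form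
domain. -/
def eulerSum (T : W →L[ℂ] W) (ι : W →L[ℂ] H) (Λ : ℝ) (g : H) : ℕ → ℝ
  | 0 => 0
  | k + 1 => eulerSum T ι Λ g k / 2 +
      Λ / 2 ^ (k + 1) * ‖res T ι (Λ / 2 ^ (k + 1)) (euler T ι Λ g k)‖

theorem eulerSum_nonneg {Λ : ℝ} (hΛ : 0 ≤ Λ) (g : H) (k : ℕ) : 0 ≤ eulerSum T ι Λ g k := by
  induction k with
  | zero => exact le_rfl
  | succ k ih => rw [eulerSum]; positivity

theorem Coercive.res_sub_smul_res (hT : Coercive T c) (hμ : 0 ≤ μ) (f : H) :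
    res T ι ν (f - (μ : ℂ) • ι (res T ι μ f)) = resOp T ι ν (res T ι μ f) := by
  have h := hT.shift_res (ι := ι) hμ f
  simp only [res, resOp, ContinuousLinearMap.comp_apply] at h ⊢
  congr 1
  rw [map_sub, map_smul]
  nth_rewrite 1 [← h]
  simp [shift]

/-- `g` minus the `k`-th Euler value is a sum of terms `mⱼ⁻¹ A uⱼ`, and the resolvent maps each of
them into the form domain with norm at most a multiple of `mⱼ⁻¹ ‖uⱼ‖`. -/
theorem Coercive.norm_res_sub_euler_le (hT : Coercive T c) {Λ : ℝ} (hΛ : 0 < Λ) (hμ : 0 ≤ μ)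
    (g : H) (k : ℕ) :
    ‖res T ι μ (g - euler T ι Λ g k)‖ ≤ ‖T‖ / c * (eulerSum T ι Λ g k / (Λ / 2 ^ k)) := by
  induction k with
  | zero => simp [euler, eulerSum]
  | succ k ih =>
    have hm : 0 < Λ / 2 ^ (k + 1) := by positivity
    have e : g - euler T ι Λ g (k + 1) = (g - euler T ι Λ g k) +
        (euler T ι Λ g k -
          ((Λ / 2 ^ (k + 1) : ℝ) : ℂ) • ι (res T ι (Λ / 2 ^ (k + 1)) (euler T ι Λ g k))) := by
      rw [euler]; abel
    rw [e, map_add, hT.res_sub_smul_res hm.le]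
    refine (norm_add_le _ _).trans ((add_le_add ih (hT.norm_resOp_le hμ _)).trans (le_of_eq ?_))
    rw [← mul_add, eulerSum]
    congr 1
    have : (2 : ℝ) ^ k ≠ 0 := by positivity
    have := hΛ.ne'
    field_simp
    ring

theorem Coercive.mul_norm_res_le_eulerSum (hT : Coercive T c) {Λ : ℝ} (hΛ : 0 < Λ)
    (g : H) (k : ℕ) :
    Λ / 2 ^ (k + 1) * ‖res T ι (Λ / 2 ^ (k + 1)) g‖ ≤
      (1 + 2 * (‖T‖ / c)) * eulerSum T ι Λ g (k + 1) := by
  have hm : 0 < Λ / 2 ^ (k + 1) := by positivity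
  have hc := hT.1
  set m := Λ / 2 ^ (k + 1) with hmdef
  have h1 := hT.norm_res_sub_euler_le (ι := ι) hΛ hm.le g (k + 1)
  rw [← hmdef] at h1
  have h2 := hT.mul_norm_res_map_le (ι := ι) hm.le ((m : ℂ) • res T ι m (euler T ι Λ g k))
  have e2 : ι ((m : ℂ) • res T ι m (euler T ι Λ g k)) = euler T ι Λ g (k + 1) := by
    rw [map_smul, euler]
  have h4 : ‖(m : ℂ) • res T ι m (euler T ι Λ g k)‖ ≤ eulerSum T ι Λ g (k + 1) := by
    rw [norm_smul, Complex.norm_real, Real.norm_of_nonneg hm.le, eulerSum]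
    have := eulerSum_nonneg (T := T) (ι := ι) hΛ.le g k
    linarith
  rw [e2] at h2
  have h3 : m * ‖res T ι m (g - euler T ι Λ g (k + 1))‖ ≤ ‖T‖ / c * eulerSum T ι Λ g (k + 1) := by
    calc _ ≤ m * (‖T‖ / c * (eulerSum T ι Λ g (k + 1) / m)) := by gcongr
      _ = _ := by field_simp
  have h5 : ‖res T ι m g‖ ≤ ‖res T ι m (euler T ι Λ g (k + 1))‖ +
      ‖res T ι m (g - euler T ι Λ g (k + 1))‖ := by
    refine le_of_eq_of_le ?_ (norm_add_le _ _)
    rw [← map_add, add_sub_cancel]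
  have h6 := mul_le_mul_of_nonneg_left h5 hm.le
  have h7 := mul_le_mul_of_nonneg_left h4 (show 0 ≤ 1 + ‖T‖ / c by positivity)
  linarith

theorem Coercive.euler_energy (hT : Coercive T c) {Λ : ℝ} (hΛ : 0 < Λ) (g : H) (k : ℕ) :
    2 * c * (Λ / 2 ^ (k + 1) * ‖res T ι (Λ / 2 ^ (k + 1)) (euler T ι Λ g k)‖ ^ 2) ≤
      ‖euler T ι Λ g k‖ ^ 2 - ‖euler T ι Λ g (k + 1)‖ ^ 2 := by
  have hm : 0 < Λ / 2 ^ (k + 1) := by positivity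
  rw [euler]
  set m := Λ / 2 ^ (k + 1)
  set f := euler T ι Λ g k
  have h1 := mul_le_mul_of_nonneg_left (hT.energy_res' (ι := ι) hm.le f) hm.le
  rw [norm_smul, Complex.norm_real, Real.norm_of_nonneg hm.le]
  nlinarith [sq_nonneg (m * ‖ι (res T ι m f)‖ - ‖f‖)]

/-- The recursion for `eulerSum` halves the weight while the step size doubles, so that the squares
contract by `3 / 4` up to the energy dissipated in one step; the two extra terms on the left make
the bound telescope. -/
theorem Coercive.sum_eulerSum_le (hT : Coercive T c) {Λ : ℝ} (hΛ : 0 < Λ) (g : H) (n : ℕ) :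
    ∑ k ∈ Finset.range n, eulerSum T ι Λ g (k + 1) ^ 2 / (Λ / 2 ^ (k + 1)) +
      3 * (eulerSum T ι Λ g n ^ 2 / (Λ / 2 ^ n)) + 6 / c * ‖euler T ι Λ g n‖ ^ 2
        ≤ 6 / c * ‖g‖ ^ 2 := by
  have hc := hT.1
  induction n with
  | zero => simp [euler, eulerSum]
  | succ n ih =>
    have hm : 0 < Λ / 2 ^ (n + 1) := by positivity
    have h1 := hT.euler_energy (ι := ι) hΛ g n
    rw [Finset.sum_range_succ]
    have h2 : eulerSum T ι Λ g (n + 1) ^ 2 / (Λ / 2 ^ (n + 1)) ≤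
        3 / 4 * (eulerSum T ι Λ g n ^ 2 / (Λ / 2 ^ n)) +
        3 * (Λ / 2 ^ (n + 1) * ‖res T ι (Λ / 2 ^ (n + 1)) (euler T ι Λ g n)‖ ^ 2) := by
      have e : Λ / 2 ^ n = 2 * (Λ / 2 ^ (n + 1)) := by
        have : (2 : ℝ) ^ n ≠ 0 := by positivity
        field_simp
        ring
      rw [e, eulerSum]
      set m := Λ / 2 ^ (n + 1)
      set x := eulerSum T ι Λ g n
      set y := ‖res T ι m (euler T ι Λ g n)‖
      rw [div_le_iff₀ hm]
      have e3 : (3 / 4 * (x ^ 2 / (2 * m)) + 3 * (m * y ^ 2)) * m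
          = 3 / 8 * x ^ 2 + 3 * (m * y) ^ 2 := by
        field_simp
        ring
      rw [e3]
      nlinarith [sq_nonneg (x - 4 * (m * y))]
    have h3 : 6 / c * ‖euler T ι Λ g (n + 1)‖ ^ 2 +
        12 * (Λ / 2 ^ (n + 1) * ‖res T ι (Λ / 2 ^ (n + 1)) (euler T ι Λ g n)‖ ^ 2) ≤
          6 / c * ‖euler T ι Λ g n‖ ^ 2 := by
      have := mul_le_mul_of_nonneg_left h1 (show 0 ≤ 6 / c by positivity)
      have e : 6 / c * (2 * c * (Λ / 2 ^ (n + 1) *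
          ‖res T ι (Λ / 2 ^ (n + 1)) (euler T ι Λ g n)‖ ^ 2)) =
          12 * (Λ / 2 ^ (n + 1) * ‖res T ι (Λ / 2 ^ (n + 1)) (euler T ι Λ g n)‖ ^ 2) := by
        field_simp
        ring
      rw [e] at this
      linarith
    linarith

theorem Coercive.sum_sq_norm_res_le (hT : Coercive T c) {Λ : ℝ} (hΛ : 0 < Λ)
    (g : H) (n : ℕ) :
    ∑ k ∈ Finset.range n, Λ / 2 ^ (k + 1) * ‖res T ι (Λ / 2 ^ (k + 1)) g‖ ^ 2 ≤
      (1 + 2 * (‖T‖ / c)) ^ 2 * (6 / c * ‖g‖ ^ 2) := by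
  have hc := hT.1
  have h := hT.sum_eulerSum_le (ι := ι) hΛ g n
  have h1 : 0 ≤ 3 * (eulerSum T ι Λ g n ^ 2 / (Λ / 2 ^ n)) := by positivity
  have h2 : 0 ≤ 6 / c * ‖euler T ι Λ g n‖ ^ 2 := by positivity
  calc _ ≤ ∑ k ∈ Finset.range n, (1 + 2 * (‖T‖ / c)) ^ 2 *
        (eulerSum T ι Λ g (k + 1) ^ 2 / (Λ / 2 ^ (k + 1))) := by
        refine Finset.sum_le_sum fun k _ => ?_
        have hm : 0 < Λ / 2 ^ (k + 1) := by positivity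
        rw [← mul_div_assoc, le_div_iff₀ hm, ← mul_pow]
        refine le_trans (le_of_eq ?_)
          (pow_le_pow_left₀ (by positivity) (hT.mul_norm_res_le_eulerSum hΛ g k) 2)
        ring
    _ = (1 + 2 * (‖T‖ / c)) ^ 2 * ∑ k ∈ Finset.range n,
        (eulerSum T ι Λ g (k + 1) ^ 2 / (Λ / 2 ^ (k + 1))) := by rw [Finset.mul_sum]
    _ ≤ _ := by
        gcongr
        linarith

theorem Coercive.lintegral_Ioc_sq_norm_res_le (hT : Coercive T c) {m : ℝ} (hm : 0 < m) (g : H) :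
    ∫⁻ μ in Ioc m (2 * m), ENNReal.ofReal (‖res T ι μ g‖ ^ 2) ≤
      ENNReal.ofReal ((2 + ‖T‖ / c) ^ 2 * (m * ‖res T ι m g‖ ^ 2)) := by
  have hc := hT.1
  calc _ ≤ ∫⁻ μ in Ioc m (2 * m), ENNReal.ofReal (((2 + ‖T‖ / c) * ‖res T ι m g‖) ^ 2) := by
        refine setLIntegral_mono measurable_const fun μ hμ => ENNReal.ofReal_le_ofReal ?_
        exact pow_le_pow_left₀ (norm_nonneg _) (hT.norm_res_le_norm_res hm hμ.1.le g) 2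
    _ = _ := by
        rw [setLIntegral_const, Real.volume_Ioc, ← ENNReal.ofReal_mul (by positivity)]
        congr 1
        ring

theorem Coercive.lintegral_dyadic_sq_norm_res_le (hT : Coercive T c) {Λ : ℝ} (hΛ : 0 < Λ)
    (g : H) (n : ℕ) :
    ∫⁻ μ in Ioc (Λ / 2 ^ n) Λ, ENNReal.ofReal (‖res T ι μ g‖ ^ 2) ≤
      ENNReal.ofReal ((2 + ‖T‖ / c) ^ 2 * ∑ k ∈ Finset.range n,
        Λ / 2 ^ (k + 1) * ‖res T ι (Λ / 2 ^ (k + 1)) g‖ ^ 2) := by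
  have hc := hT.1
  induction n with
  | zero => simp
  | succ n ih =>
    have e : Λ / 2 ^ n = 2 * (Λ / 2 ^ (n + 1)) := by
      have : (2 : ℝ) ^ n ≠ 0 := by positivity
      field_simp
      ring
    have hsub : Ioc (Λ / 2 ^ (n + 1)) Λ ⊆
        Ioc (Λ / 2 ^ n) Λ ∪ Ioc (Λ / 2 ^ (n + 1)) (2 * (Λ / 2 ^ (n + 1))) := by
      intro x hx
      by_cases h : x ≤ Λ / 2 ^ n
      · exact Or.inr ⟨hx.1, e ▸ h⟩
      · exact Or.inl ⟨not_le.1 h, hx.2⟩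
    rw [Finset.sum_range_succ, mul_add, ENNReal.ofReal_add (by positivity) (by positivity)]
    exact (lintegral_mono_set hsub).trans ((lintegral_union_le _ _ _).trans
      (add_le_add ih (hT.lintegral_Ioc_sq_norm_res_le (by positivity) g)))

/-- The quadratic estimate `∫₀^∞ ‖(μ + A)⁻¹ g‖₁² dμ ≤ C ‖g‖²`, in the norm of the form domain.
The energy identity bounds the sum over the steps of an implicit Euler scheme at dyadic step
sizes, and the resolvents differ from these steps by geometrically weighted sums of them. -/
theorem Coercive.exists_lintegral_sq_norm_res_le (hT : Coercive T c) :
    ∃ C : ℝ, 0 ≤ C ∧ ∀ g : H, ∫⁻ μ in Ioi (0 : ℝ), ENNReal.ofReal (‖res T ι μ g‖ ^ 2) ≤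
      ENNReal.ofReal (C * ‖g‖ ^ 2) := by
  have hc := hT.1
  refine ⟨(2 + ‖T‖ / c) ^ 2 * ((1 + 2 * (‖T‖ / c)) ^ 2 * (6 / c)), by positivity, fun g => ?_⟩
  have hU : Ioi (0 : ℝ) = ⋃ N : ℕ, Ioc ((2 : ℝ) ^ N / 2 ^ (2 * N)) (2 ^ N) := by
    ext x
    simp only [mem_Ioi, mem_iUnion, mem_Ioc]
    constructor
    · intro hx
      obtain ⟨N, hN⟩ := pow_unbounded_of_one_lt (max x x⁻¹) (one_lt_two (α := ℝ))
      refine ⟨N, ?_, (le_max_left _ _).trans hN.le⟩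
      have h1 : x⁻¹ < 2 ^ N := (le_max_right _ _).trans_lt hN
      rw [two_mul, pow_add, div_mul_cancel_left₀ (by positivity)]
      exact inv_lt_of_inv_lt₀ hx h1
    · rintro ⟨N, h, -⟩
      exact lt_trans (by positivity) h
  have hmono : Monotone fun N : ℕ => Ioc ((2 : ℝ) ^ N / 2 ^ (2 * N)) (2 ^ N) := by
    intro M N h
    refine Ioc_subset_Ioc ?_ (pow_le_pow_right₀ one_le_two h)
    rw [two_mul, pow_add, div_mul_cancel_left₀ (by positivity), two_mul, pow_add,
      div_mul_cancel_left₀ (by positivity)]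
    gcongr
    exact one_le_two
  rw [hU, setLIntegral_iUnion_of_directed _ (directed_of_isDirected_le hmono)]
  refine iSup_le fun N => ?_
  refine (hT.lintegral_dyadic_sq_norm_res_le (by positivity) g (2 * N)).trans
    (ENNReal.ofReal_le_ofReal ?_)
  have := hT.sum_sq_norm_res_le (ι := ι) (Λ := 2 ^ N) (by positivity) g (2 * N)
  calc _ ≤ (2 + ‖T‖ / c) ^ 2 * ((1 + 2 * (‖T‖ / c)) ^ 2 * (6 / c * ‖g‖ ^ 2)) := by gcongr
    _ = _ := by ring

end

/-! ### Weighted integrals over the half line -/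

theorem integrableOn_rpow_mul_min {β δ : ℝ} (hβ : β < 1) (hδ : 1 < β + δ) :
    IntegrableOn (fun μ : ℝ => μ ^ (-β) * min 1 (μ ^ (-δ))) (Ioi 0) := by
  have hm : Measurable fun μ : ℝ => μ ^ (-β) * min 1 (μ ^ (-δ)) := by fun_prop
  rw [← Ioc_union_Ioi_eq_Ioi zero_le_one]
  refine IntegrableOn.union ?_ ?_
  · have h : IntegrableOn (fun μ : ℝ => μ ^ (-β)) (Ioc 0 1) := by
      rw [integrableOn_Ioc_iff_integrableOn_Ioo,
        intervalIntegral.integrableOn_Ioo_rpow_iff zero_lt_one]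
      linarith
    refine h.mono' hm.aestronglyMeasurable ?_
    filter_upwards [ae_restrict_mem measurableSet_Ioc] with μ hμ
    have h0 : 0 < μ := hμ.1
    rw [Real.norm_of_nonneg (by positivity)]
    exact mul_le_of_le_one_right (by positivity) (min_le_left _ _)
  · have h : IntegrableOn (fun μ : ℝ => μ ^ (-β - δ)) (Ioi 1) :=
      integrableOn_Ioi_rpow_of_lt (by linarith) zero_lt_one
    refine h.mono' hm.aestronglyMeasurable ?_
    filter_upwards [ae_restrict_mem measurableSet_Ioi] with μ hμ
    have h0 : 0 < μ := zero_lt_one.trans hμ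
    rw [Real.norm_of_nonneg (by positivity), sub_eq_add_neg, Real.rpow_add h0]
    gcongr
    exact min_le_right _ _

theorem integrableOn_rpow_smul {E : Type*} [NormedAddCommGroup E] [NormedSpace ℂ E]
    {f : ℝ → E} {β δ M : ℝ} (hβ : β < 1) (hδ : 1 < β + δ) (hf : ContinuousOn f (Ici 0))
    (h0 : ∀ μ, 0 < μ → ‖f μ‖ ≤ M) (h1 : ∀ μ, 0 < μ → ‖f μ‖ ≤ M * μ ^ (-δ)) :
    IntegrableOn (fun μ : ℝ => ((μ ^ (-β) : ℝ) : ℂ) • f μ) (Ioi 0) := by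
  have hM : 0 ≤ M := (norm_nonneg _).trans (h0 1 zero_lt_one)
  refine ((integrableOn_rpow_mul_min hβ hδ).const_mul M).mono' ?_ ?_
  · have hm : Measurable fun μ : ℝ => ((μ ^ (-β) : ℝ) : ℂ) := by fun_prop
    exact hm.aestronglyMeasurable.smul
      ((hf.mono Ioi_subset_Ici_self).aestronglyMeasurable measurableSet_Ioi)
  · filter_upwards [ae_restrict_mem measurableSet_Ioi] with μ hμ
    have hμ' : 0 < μ := hμ
    rw [norm_smul, Complex.norm_real, Real.norm_of_nonneg (by positivity), mul_left_comm,
      mul_min_of_nonneg _ _ hM, mul_one]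
    gcongr
    exact le_min (h0 μ hμ) (h1 μ hμ)

/-- Dilation in an integral with a power weight. -/
theorem integral_rpow_smul_comp_mul {E : Type*} [NormedAddCommGroup E] [NormedSpace ℂ E]
    (f : ℝ → E) (β : ℝ) {b : ℝ} (hb : 0 < b) :
    ∫ μ in Ioi (0 : ℝ), ((μ ^ (-β) : ℝ) : ℂ) • f (b * μ) =
      ((b ^ (β - 1) : ℝ) : ℂ) • ∫ μ in Ioi (0 : ℝ), ((μ ^ (-β) : ℝ) : ℂ) • f μ := by
  have h := integral_comp_mul_left_Ioi (fun μ => ((μ ^ (-β) : ℝ) : ℂ) • f μ) 0 hb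
  rw [mul_zero] at h
  have e : ∫ μ in Ioi (0 : ℝ), (((b * μ) ^ (-β) : ℝ) : ℂ) • f (b * μ) =
      ((b ^ (-β) : ℝ) : ℂ) • ∫ μ in Ioi (0 : ℝ), ((μ ^ (-β) : ℝ) : ℂ) • f (b * μ) := by
    rw [← integral_smul]
    refine setIntegral_congr_fun measurableSet_Ioi fun μ hμ => ?_
    rw [Real.mul_rpow hb.le (le_of_lt hμ), smul_smul]
    push_cast
    rfl
  rw [e] at h
  have hb1 : ((b ^ (-β) : ℝ) : ℂ) ≠ 0 := by
    exact_mod_cast (Real.rpow_pos_of_pos hb _).ne'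
  rw [← smul_right_injective E hb1 |>.eq_iff, h, smul_smul, ← Complex.ofReal_mul,
    ← Real.rpow_add hb, ← Complex.coe_smul]
  congr 2
  rw [show -β + (β - 1) = -1 by ring, Real.rpow_neg_one]

theorem eq_of_inner_map_eq {H W : Type*} [NormedAddCommGroup H] [InnerProductSpace ℂ H]
    [NormedAddCommGroup W] [InnerProductSpace ℂ W] {ι : W →L[ℂ] H} (hd : DenseRange ι) {f g : H}
    (h : ∀ v, inner ℂ (ι v) f = inner ℂ (ι v) g) : f = g := by
  have e := hd.equalizer (g := fun x => inner ℂ x f) (h := fun x => inner ℂ x g) (by fun_prop)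
    (by fun_prop) (funext h)
  exact ext_inner_left ℂ (congrFun e)

section

variable {H W : Type*} [NormedAddCommGroup H] [InnerProductSpace ℂ H] [CompleteSpace H]
  [NormedAddCommGroup W] [InnerProductSpace ℂ W] [CompleteSpace W]
variable {T : W →L[ℂ] W} {ι : W →L[ℂ] H} {c μ ν β γ : ℝ}

/-! ### Balakrishnan integrals -/

/-- The Balakrishnan integral `∫₀^∞ μ^{-β} (μ + A)⁻¹ g dμ` in `H`, a multiple of `A^{-β} g`. -/
def bal (T : W →L[ℂ] W) (ι : W →L[ℂ] H) (β : ℝ) (g : H) : H :=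
  ∫ μ in Ioi (0 : ℝ), ((μ ^ (-β) : ℝ) : ℂ) • ι (res T ι μ g)

/-- The Balakrishnan integral as an integral in the form domain. -/
def balLift (T : W →L[ℂ] W) (ι : W →L[ℂ] H) (β : ℝ) (g : H) : W :=
  ∫ μ in Ioi (0 : ℝ), ((μ ^ (-β) : ℝ) : ℂ) • res T ι μ g

theorem Coercive.norm_map_res_le_rpow (hT : Coercive T c) (hι : ‖ι‖ ≤ 1) (g : H) (hμ : 0 < μ) :
    ‖ι (res T ι μ g)‖ ≤ (1 + c⁻¹) * ‖g‖ ∧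
      ‖ι (res T ι μ g)‖ ≤ (1 + c⁻¹) * ‖g‖ * μ ^ (-1 : ℝ) := by
  have hc := hT.1
  constructor
  · have h1 : ‖ι (res T ι μ g)‖ ≤ ‖res T ι μ g‖ := by
      simpa using ι.le_of_opNorm_le hι (res T ι μ g)
    have h2 := hT.norm_res_le hι hμ.le g
    nlinarith [norm_nonneg g]
  · have h := hT.mul_norm_map_res_le (ι := ι) hμ.le g
    rw [Real.rpow_neg_one, ← div_eq_mul_inv, le_div_iff₀ hμ, mul_comm]
    have : 0 ≤ c⁻¹ * ‖g‖ := by positivity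
    linarith

theorem Coercive.integrableOn_bal (hT : Coercive T c) (hι : ‖ι‖ ≤ 1) (h0 : 0 < β) (h1 : β < 1)
    (g : H) : IntegrableOn (fun μ : ℝ => ((μ ^ (-β) : ℝ) : ℂ) • ι (res T ι μ g)) (Ioi 0) :=
  integrableOn_rpow_smul h1 (by linarith) (ι.continuous.comp_continuousOn
    (hT.continuousOn_res_apply g)) (fun _ hμ => (hT.norm_map_res_le_rpow hι g hμ).1)
    (fun _ hμ => (hT.norm_map_res_le_rpow hι g hμ).2)

theorem Coercive.integrableOn_balLift (hT : Coercive T c) (hι : ‖ι‖ ≤ 1) (h0 : 1 / 2 < β)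
    (h1 : β < 1) (g : H) :
    IntegrableOn (fun μ : ℝ => ((μ ^ (-β) : ℝ) : ℂ) • res T ι μ g) (Ioi 0) := by
  have hc := hT.1
  refine integrableOn_rpow_smul (M := (c⁻¹ + c ^ (-(1 / 2) : ℝ)) * ‖g‖) (δ := 1 / 2) h1
    (by linarith) (hT.continuousOn_res_apply g) (fun μ hμ => ?_) (fun μ hμ => ?_)
  · refine (hT.norm_res_le hι hμ.le g).trans ?_
    gcongr
    exact le_add_of_nonneg_right (by positivity)
  · refine (hT.norm_res_le_rpow hμ g).trans ?_
    rw [mul_right_comm]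
    gcongr
    exact le_add_of_nonneg_left (by positivity)

theorem Coercive.integrableOn_balLift_map (hT : Coercive T c) (hι : ‖ι‖ ≤ 1) (h0 : 0 < β)
    (h1 : β < 1) (w : W) :
    IntegrableOn (fun μ : ℝ => ((μ ^ (-β) : ℝ) : ℂ) • res T ι μ (ι w)) (Ioi 0) := by
  have hc := hT.1
  refine integrableOn_rpow_smul (M := c⁻¹ * ‖ι w‖ + (1 + ‖T‖ / c) * ‖w‖) (δ := 1) h1
    (by linarith) (hT.continuousOn_res_apply _) (fun μ hμ => ?_) (fun μ hμ => ?_)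
  · exact (hT.norm_res_le hι hμ.le _).trans (le_add_of_nonneg_right (by positivity))
  · have h := hT.mul_norm_res_map_le (ι := ι) hμ.le w
    rw [Real.rpow_neg_one, ← div_eq_mul_inv, le_div_iff₀ hμ, mul_comm]
    have : 0 ≤ c⁻¹ * ‖ι w‖ := by positivity
    linarith

theorem Coercive.map_balLift (hT : Coercive T c) (hι : ‖ι‖ ≤ 1) (h0 : 1 / 2 < β)
    (h1 : β < 1) (g : H) : ι (balLift T ι β g) = bal T ι β g := by
  rw [balLift, ← ι.integral_comp_comm (hT.integrableOn_balLift hι h0 h1 g)]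
  simp [bal]

theorem Coercive.map_balLift_map (hT : Coercive T c) (hι : ‖ι‖ ≤ 1) (h0 : 0 < β)
    (h1 : β < 1) (w : W) : ι (balLift T ι β (ι w)) = bal T ι β (ι w) := by
  rw [balLift, ← ι.integral_comp_comm (hT.integrableOn_balLift_map hι h0 h1 w)]
  simp [bal]

theorem Coercive.map_res_bal (hT : Coercive T c) (hι : ‖ι‖ ≤ 1) (h0 : 0 < β)
    (h1 : β < 1) (hν : 0 ≤ ν) (g : H) :
    ι (res T ι ν (bal T ι β g)) = bal T ι β (ι (res T ι ν g)) := by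
  have h := (ι ∘L res T ι ν).integral_comp_comm (hT.integrableOn_bal hι h0 h1 g)
  rw [bal, bal]
  refine Eq.trans h.symm (setIntegral_congr_fun measurableSet_Ioi fun μ hμ => ?_)
  simp only [ContinuousLinearMap.comp_apply, map_smul]
  rw [hT.res_map_res_comm hν (le_of_lt hμ)]

theorem bal_smul (k : ℂ) (g : H) : bal T ι β (k • g) = k • bal T ι β g := by
  rw [bal, bal, ← integral_smul]
  simp only [map_smul]
  simp only [smul_comm k]

/-! ### The semigroup law -/

theorem Coercive.norm_map_res_le_min (hT : Coercive T c) (hι : ‖ι‖ ≤ 1) (g : H) (hμ : 0 < μ) :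
    ‖ι (res T ι μ g)‖ ≤ (1 + c⁻¹) * ‖g‖ * min 1 (μ ^ (-1 : ℝ)) := by
  have hc := hT.1
  rw [mul_min_of_nonneg _ _ (by positivity), mul_one]
  exact le_min (hT.norm_map_res_le_rpow hι g hμ).1 (hT.norm_map_res_le_rpow hι g hμ).2

theorem min_one_rpow_neg_one_le {x a : ℝ} (hx : 0 < x) (h0 : 0 ≤ a) (h1 : a ≤ 1) :
    min 1 (x ^ (-1 : ℝ)) ≤ x ^ (-a) := by
  rcases le_total x 1 with h | h
  · exact (min_le_left _ _).trans (Real.one_le_rpow_of_pos_of_le_one_of_nonpos hx h (by linarith))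
  · exact (min_le_right _ _).trans (Real.rpow_le_rpow_of_exponent_le h (by linarith))

/-- Integrability of the double integral in the semigroup law, in the variables `μ` and
`t = ν / μ`. -/
theorem Coercive.integrable_prod_res_res (hT : Coercive T c) (hι : ‖ι‖ ≤ 1) (h0 : 0 < γ)
    (h1 : γ < 1) (u : H) :
    Integrable (fun p : ℝ × ℝ => ((p.2 ^ (-γ) : ℝ) : ℂ) •
      ι (res T ι p.1 (ι (res T ι (p.2 * p.1) u))))
      ((volume.restrict (Ioi 0)).prod (volume.restrict (Ioi 0))) := by
  have hc := hT.1
  set K : ℝ := (1 + c⁻¹) * ((1 + c⁻¹) * ‖u‖) with hK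
  have hK0 : 0 ≤ K := by positivity
  set a₁ : ℝ := (1 - γ) / 2 with ha₁
  set a₂ : ℝ := 1 - γ / 2 with ha₂
  have i1 : IntegrableOn (fun μ : ℝ => μ ^ (-a₁) * min 1 (μ ^ (-1 : ℝ))) (Ioi 0) :=
    integrableOn_rpow_mul_min (by linarith) (by linarith)
  have i2 : IntegrableOn (fun μ : ℝ => μ ^ (-a₂) * min 1 (μ ^ (-1 : ℝ))) (Ioi 0) :=
    integrableOn_rpow_mul_min (by linarith) (by linarith)
  have j1 : IntegrableOn (fun t : ℝ => (Iic (1 : ℝ)).indicator (fun t => t ^ (-γ - a₁)) t)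
      (Ioi 0) := by
    rw [IntegrableOn, integrable_indicator_iff measurableSet_Iic, IntegrableOn,
      Measure.restrict_restrict measurableSet_Iic, inter_comm, Ioi_inter_Iic]
    change IntegrableOn _ _ _
    rw [integrableOn_Ioc_iff_integrableOn_Ioo,
      intervalIntegral.integrableOn_Ioo_rpow_iff zero_lt_one]
    linarith
  have j2 : IntegrableOn (fun t : ℝ => (Ioi (1 : ℝ)).indicator (fun t => t ^ (-γ - a₂)) t)
      (Ioi 0) := by
    rw [IntegrableOn, integrable_indicator_iff measurableSet_Ioi, IntegrableOn,
      Measure.restrict_restrict measurableSet_Ioi, Ioi_inter_Ioi]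
    change IntegrableOn _ _ _
    rw [max_eq_left zero_le_one]
    exact integrableOn_Ioi_rpow_of_lt (by linarith) zero_lt_one
  have dom := ((i1.mul_prod j1).add (i2.mul_prod j2)).const_mul K
  rw [Measure.prod_restrict] at dom ⊢
  refine dom.mono' ?_ ?_
  · refine ContinuousOn.aestronglyMeasurable ?_ (measurableSet_Ioi.prod measurableSet_Ioi)
    have c1 : ContinuousOn (fun p : ℝ × ℝ => res T ι (p.2 * p.1) u) (Ioi 0 ×ˢ Ioi 0) :=
      (hT.continuousOn_res_apply u).comp (by fun_prop)
        (fun p hp => mem_Ici.2 (mul_nonneg (le_of_lt hp.2) (le_of_lt hp.1)))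
    have c2 : ContinuousOn (fun p : ℝ × ℝ => res T ι p.1) (Ioi 0 ×ˢ Ioi 0) :=
      hT.continuousOn_res.comp (by fun_prop) (fun p hp => mem_Ici.2 (le_of_lt hp.1))
    have c3 : ContinuousOn (fun p : ℝ × ℝ => ((p.2 ^ (-γ) : ℝ) : ℂ)) (Ioi 0 ×ˢ Ioi 0) := by
      refine Complex.continuous_ofReal.comp_continuousOn ?_
      exact ContinuousOn.rpow_const (by fun_prop) (fun p hp => Or.inl (ne_of_gt hp.2))
    exact c3.smul (ι.continuous.comp_continuousOn
      (c2.clm_apply (ι.continuous.comp_continuousOn c1)))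
  · filter_upwards [ae_restrict_mem (measurableSet_Ioi.prod measurableSet_Ioi)] with p hp
    obtain ⟨μ, t⟩ := p
    have hμ : 0 < μ := hp.1
    have ht : 0 < t := hp.2
    simp only [Pi.add_apply]
    rw [norm_smul, Complex.norm_real, Real.norm_of_nonneg (by positivity)]
    have e1 := hT.norm_map_res_le_min hι (ι (res T ι (t * μ) u)) hμ
    have e2 := hT.norm_map_res_le_min hι u (mul_pos ht hμ)
    have e3 : ‖ι (res T ι μ (ι (res T ι (t * μ) u)))‖ ≤
        K * (min 1 (μ ^ (-1 : ℝ)) * min 1 ((t * μ) ^ (-1 : ℝ))) := by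
      refine e1.trans ?_
      calc _ ≤ (1 + c⁻¹) * ((1 + c⁻¹) * ‖u‖ * min 1 ((t * μ) ^ (-1 : ℝ))) *
            min 1 (μ ^ (-1 : ℝ)) := by gcongr
        _ = _ := by rw [hK]; ring
    have key : ∀ a : ℝ, 0 ≤ a → a ≤ 1 →
        t ^ (-γ) * ‖ι (res T ι μ (ι (res T ι (t * μ) u)))‖ ≤
        K * (μ ^ (-a) * min 1 (μ ^ (-1 : ℝ)) * t ^ (-γ - a)) := by
      intro a ha0 ha1
      have e4 := min_one_rpow_neg_one_le (mul_pos ht hμ) ha0 ha1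
      rw [Real.mul_rpow (z := -a) ht.le hμ.le] at e4
      calc _ ≤ t ^ (-γ) * (K * (min 1 (μ ^ (-1 : ℝ)) * (t ^ (-a) * μ ^ (-a)))) := by
            gcongr
            refine e3.trans ?_
            gcongr
        _ = K * (μ ^ (-a) * min 1 (μ ^ (-1 : ℝ)) * (t ^ (-γ) * t ^ (-a))) := by ring
        _ = _ := by rw [← Real.rpow_add ht, ← sub_eq_add_neg]
    rcases le_or_gt t 1 with h | h
    · have hn : t ∉ Ioi (1 : ℝ) := not_lt.2 h
      rw [indicator_of_mem (show t ∈ Iic (1 : ℝ) from h), indicator_of_notMem hn, mul_zero,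
        add_zero]
      exact key a₁ (by linarith) (by linarith)
    · have hn : t ∉ Iic (1 : ℝ) := not_le.2 h
      rw [indicator_of_mem (show t ∈ Ioi (1 : ℝ) from h), indicator_of_notMem hn, mul_zero,
        zero_add]
      exact key a₂ (by linarith) (by linarith)

/-- Frullani's integral, applied to `(t - 1) R(μ) R(tμ) = μ⁻¹ (R(μ) - R(tμ))`. -/
theorem Coercive.integral_res_res (hT : Coercive T c) (hι : ‖ι‖ ≤ 1) (u : H) {t : ℝ}
    (ht : 0 < t) (ht1 : t ≠ 1)
    (hi : IntegrableOn (fun μ : ℝ => ι (res T ι μ (ι (res T ι (t * μ) u)))) (Ioi 0)) :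
    ∫ μ in Ioi (0 : ℝ), ι (res T ι μ (ι (res T ι (t * μ) u))) =
      (Real.log t / (t - 1)) • ι (res T ι 0 u) := by
  have hc := hT.1
  have ht1' : t - 1 ≠ 0 := sub_ne_zero.2 ht1
  set f : ℝ → H := fun μ => ι (res T ι μ u) with hf
  have hfc : ContinuousOn f (Ici 0) :=
    ι.continuous.comp_continuousOn (hT.continuousOn_res_apply u)
  have e : ∀ μ ∈ Ioi (0 : ℝ), μ⁻¹ • (f (1 * μ) - f (t * μ)) =
      (t - 1) • ι (res T ι μ (ι (res T ι (t * μ) u))) := by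
    intro μ hμ
    have hμ' : 0 < μ := hμ
    have htμ : 0 < t * μ := mul_pos ht hμ'
    rw [one_mul, hf]
    simp only
    rw [← map_sub, hT.res_sub_res hμ'.le htμ.le, map_smul, hT.res_map_res_comm hμ'.le htμ.le,
      Complex.coe_smul, smul_smul]
    congr 1
    field_simp
  have hR : Tendsto f atTop (𝓝 0) := by
    refine squeeze_zero_norm' (a := fun μ => (1 + c⁻¹) * ‖u‖ * μ ^ (-1 : ℝ)) ?_ ?_
    · filter_upwards [eventually_gt_atTop 0] with μ hμ
      exact (hT.norm_map_res_le_rpow hι u hμ).2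
    · simpa using (tendsto_rpow_neg_atTop zero_lt_one).const_mul ((1 + c⁻¹) * ‖u‖)
  have hL : Tendsto f (𝓝[>] 0) (𝓝 (f 0)) :=
    (hfc 0 self_mem_Ici).mono_left (nhdsWithin_mono 0 Ioi_subset_Ici_self)
  have hF := Frullani.integral_Ioi_eq (f := f)
    ((hfc.mono Ioi_subset_Ici_self).locallyIntegrableOn measurableSet_Ioi) one_pos ht hL hR
    (IntegrableOn.congr_fun (hi.smul (t - 1)) (fun μ hμ => (e μ hμ).symm) measurableSet_Ioi)
  rw [setIntegral_congr_fun measurableSet_Ioi e, integral_smul, sub_zero, div_one] at hF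
  rw [div_eq_inv_mul, mul_smul, ← hF, smul_smul, inv_mul_cancel₀ ht1', one_smul]

/-- The substitution `ν = t μ` turns the weight `μ^{γ-1} ν^{-γ}` of the double integral into
`t^{-γ}`, and leaves Frullani's integral in `μ`. -/
theorem Coercive.bal_bal (hT : Coercive T c) (hι : ‖ι‖ ≤ 1) (h0 : 0 < γ) (h1 : γ < 1) (u : H) :
    IntegrableOn (fun t : ℝ => (t ^ (-γ) * (Real.log t / (t - 1))) • ι (res T ι 0 u)) (Ioi 0) ∧
    bal T ι (1 - γ) (bal T ι γ u) =
      (∫ t in Ioi (0 : ℝ), t ^ (-γ) * (Real.log t / (t - 1))) • ι (res T ι 0 u) := by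
  have hint := hT.integrable_prod_res_res hι h0 h1 u
  have e1 : bal T ι (1 - γ) (bal T ι γ u) = ∫ μ in Ioi (0 : ℝ), ∫ t in Ioi (0 : ℝ),
      ((t ^ (-γ) : ℝ) : ℂ) • ι (res T ι μ (ι (res T ι (t * μ) u))) := by
    rw [bal]
    refine setIntegral_congr_fun measurableSet_Ioi fun μ hμ => ?_
    have hμ' : 0 < μ := hμ
    have h := integral_rpow_smul_comp_mul (fun ν => ι (res T ι μ (ι (res T ι ν u)))) γ hμ'
    simp_rw [mul_comm _ μ]
    rw [h]
    have h2 := (ι ∘L res T ι μ).integral_comp_comm (hT.integrableOn_bal hι h0 h1 u)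
    simp only [ContinuousLinearMap.comp_apply, map_smul] at h2
    rw [h2, bal, neg_sub]
  have e2 : ∀ᵐ t ∂(volume.restrict (Ioi (0 : ℝ))), ∫ μ in Ioi (0 : ℝ),
      ((t ^ (-γ) : ℝ) : ℂ) • ι (res T ι μ (ι (res T ι (t * μ) u))) =
      (t ^ (-γ) * (Real.log t / (t - 1))) • ι (res T ι 0 u) := by
    have hne : ∀ᵐ t ∂(volume.restrict (Ioi (0 : ℝ))), t ≠ 1 :=
      ae_restrict_of_ae (Measure.ae_ne volume 1)
    filter_upwards [hint.prod_left_ae, hne, ae_restrict_mem measurableSet_Ioi] with t hi ht1 ht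
    have ht' : 0 < t := ht
    have hk : ((t ^ (-γ) : ℝ) : ℂ) ≠ 0 := by
      exact_mod_cast (Real.rpow_pos_of_pos ht' _).ne'
    have hi' : IntegrableOn (fun μ : ℝ => ι (res T ι μ (ι (res T ι (t * μ) u)))) (Ioi 0) := by
      have := hi.smul (((t ^ (-γ) : ℝ) : ℂ)⁻¹)
      refine this.congr (ae_of_all _ fun μ => ?_)
      simp only [Pi.smul_apply]
      rw [inv_smul_smul₀ hk]
    rw [integral_smul, hT.integral_res_res hι u ht' ht1 hi', mul_smul, Complex.coe_smul]
  refine ⟨hint.integral_prod_right.congr e2, ?_⟩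
  rw [e1, integral_integral_swap hint, integral_congr_ae e2, integral_smul_const]

theorem rpow_mul_log_div_pos (γ : ℝ) {t : ℝ} (ht : 0 < t) (ht1 : t ≠ 1) :
    0 < t ^ (-γ) * (Real.log t / (t - 1)) := by
  refine mul_pos (Real.rpow_pos_of_pos ht _) ?_
  rcases lt_or_gt_of_ne ht1 with h | h
  · exact div_pos_of_neg_of_neg (Real.log_neg ht h) (by linarith)
  · exact div_pos (Real.log_pos h) (by linarith)

/-- The semigroup law `A^{-(1-γ)} A^{-γ} = A⁻¹`, up to a non-zero constant. -/
theorem Coercive.exists_bal_bal_eq (hT : Coercive T c) (hι : ‖ι‖ ≤ 1) (h0 : 0 < γ) (h1 : γ < 1) :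
    ∃ κ : ℝ, κ ≠ 0 ∧ ∀ u : H, bal T ι (1 - γ) (bal T ι γ u) = (κ : ℂ) • ι (res T ι 0 u) := by
  by_cases h : ∀ u : H, ι (res T ι 0 u) = 0
  · refine ⟨1, one_ne_zero, fun u => ?_⟩
    rw [(hT.bal_bal hι h0 h1 u).2, h]
    simp
  · push Not at h
    obtain ⟨u₀, hu₀⟩ := h
    refine ⟨_, ?_, fun u => (hT.bal_bal hι h0 h1 u).2.trans (Complex.coe_smul _ _).symm⟩
    have hi := (integrable_smul_const hu₀).1 (hT.bal_bal hι h0 h1 u₀).1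
    refine ne_of_gt ((setIntegral_pos_iff_support_of_nonneg_ae ?_ hi).2 ?_)
    · have hne : ∀ᵐ t ∂(volume.restrict (Ioi (0 : ℝ))), t ≠ 1 :=
        ae_restrict_of_ae (Measure.ae_ne volume 1)
      filter_upwards [hne, ae_restrict_mem measurableSet_Ioi] with t ht1 ht
      exact (rpow_mul_log_div_pos γ ht ht1).le
    · refine lt_of_lt_of_le ?_ (measure_mono (s := Ioi (1 : ℝ)) fun t ht => ⟨?_, ?_⟩)
      · simp
      · exact (rpow_mul_log_div_pos γ (zero_lt_one.trans (mem_Ioi.1 ht)) (ne_of_gt ht)).ne'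
      · exact zero_lt_one.trans (mem_Ioi.1 ht)

theorem Coercive.map_res_zero_injective (hT : Coercive T c) (hd : DenseRange ι) :
    Function.Injective fun f => ι (res T ι 0 f) := by
  intro f g h
  have h0 : ι (res T ι 0 (f - g)) = 0 := by
    rw [map_sub, map_sub]
    exact sub_eq_zero.2 h
  have h1 : res T ι 0 (f - g) = 0 := by
    have h2 := hT.energy_res' (ι := ι) le_rfl (f - g)
    rw [h0, norm_zero, zero_mul, zero_mul, add_zero] at h2
    have hc := hT.1
    by_contra hne
    have : 0 < ‖res T ι 0 (f - g)‖ := norm_pos_iff.2 hne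
    have : 0 < c * ‖res T ι 0 (f - g)‖ ^ 2 := by positivity
    linarith
  refine eq_of_inner_map_eq hd fun v => ?_
  have h3 := hT.inner_res (ι := ι) le_rfl (f - g) v
  rw [h1] at h3
  simp only [map_zero, inner_zero_right, Complex.ofReal_zero, zero_smul, sub_zero] at h3
  rw [inner_sub_right] at h3
  exact (sub_eq_zero.1 h3.symm)

/-- If `A^{-γ} u = A⁻¹ g`, then `u` is a multiple of `A^{-(1-γ)} g`. -/
theorem Coercive.exists_eq_smul_bal (hT : Coercive T c) (hι : ‖ι‖ ≤ 1) (hd : DenseRange ι)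
    (h0 : 0 < γ) (h1 : γ < 1) :
    ∃ κ : ℂ, ∀ u g : H, bal T ι γ u = ι (res T ι 0 g) → u = κ • bal T ι (1 - γ) g := by
  obtain ⟨κ, hκ, h⟩ := hT.exists_bal_bal_eq hι h0 h1
  refine ⟨(κ : ℂ)⁻¹, fun u g hu => hT.map_res_zero_injective hd ?_⟩
  have hκ' : (κ : ℂ) ≠ 0 := by exact_mod_cast hκ
  simp only [map_smul]
  rw [hT.map_res_bal hι (by linarith) (by linarith) le_rfl, ← hu, h, inv_smul_smul₀ hκ']

end

/-! ### A Schur test -/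

theorem lintegral_mul_comp_mul {φ : ℝ → ℝ} (hφ : IntegrableOn φ (Ioi 0))
    (h0 : ∀ t, 0 < t → 0 ≤ φ t) {b : ℝ} (hb : 0 < b) :
    ∫⁻ ν in Ioi (0 : ℝ), ENNReal.ofReal (b * φ (b * ν)) =
      ENNReal.ofReal (∫ t in Ioi (0 : ℝ), φ t) := by
  have hi : IntegrableOn (fun ν => b * φ (b * ν)) (Ioi 0) := by
    refine Integrable.const_mul ?_ b
    have := (integrableOn_Ioi_comp_mul_left_iff φ 0 hb).2 (by rwa [mul_zero])
    exact this
  rw [← ofReal_integral_eq_lintegral_ofReal hi, integral_const_mul,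
    integral_comp_mul_left_Ioi φ 0 hb, mul_zero, smul_eq_mul, mul_inv_cancel_left₀ hb.ne']
  filter_upwards [ae_restrict_mem measurableSet_Ioi] with ν hν
  exact mul_nonneg hb.le (h0 _ (mul_pos hb hν))

theorem rpow_mul_min_nonneg {β δ t : ℝ} (ht : 0 < t) : 0 ≤ t ^ (-β) * min 1 (t ^ (-δ)) := by
  positivity

/-- The kernel `μ^γ ν^{-γ} min(μ⁻¹, (μ ν)^{-1/2})`, multiplied by `p q`, is split by the AM-GM
inequality with the weight `(μ / ν)^{1/2}`. -/
theorem le_schur_kernels {γ μ ν p q X : ℝ} (hμ : 0 < μ) (hν : 0 < ν) (hp : 0 ≤ p) (hq : 0 ≤ q)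
    (h1 : X ≤ p * q * (μ ^ (γ - 1) * ν ^ (-γ)))
    (h2 : X ≤ p * q * (μ ^ (γ - 1 / 2) * ν ^ (-γ - 1 / 2))) :
    X ≤ μ⁻¹ * ((μ⁻¹ * ν) ^ (-(γ + 1 / 2)) * min 1 ((μ⁻¹ * ν) ^ (-(1 / 2) : ℝ))) * p ^ 2 +
      ν⁻¹ * ((ν⁻¹ * μ) ^ (-(1 - γ)) * min 1 ((ν⁻¹ * μ) ^ (-(1 / 2) : ℝ))) * q ^ 2 := by
  obtain ⟨a, rfl⟩ : ∃ a, μ = Real.exp a := ⟨Real.log μ, (Real.exp_log hμ).symm⟩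
  obtain ⟨b, rfl⟩ : ∃ b, ν = Real.exp b := ⟨Real.log ν, (Real.exp_log hν).symm⟩
  simp only [← Real.exp_neg, ← Real.exp_add, ← Real.exp_mul] at h1 h2 ⊢
  have amgm : ∀ x y : ℝ, p * q * Real.exp (x + y) ≤
      Real.exp (2 * x) * p ^ 2 + Real.exp (2 * y) * q ^ 2 := by
    intro x y
    rw [Real.exp_add, two_mul, two_mul, Real.exp_add, Real.exp_add]
    nlinarith [sq_nonneg (Real.exp x * p - Real.exp y * q), Real.exp_pos x, Real.exp_pos y,
      mul_nonneg (mul_nonneg (Real.exp_pos x).le hp) (mul_nonneg (Real.exp_pos y).le hq)]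
  rcases le_total a b with h | h
  · have m1 : min 1 (Real.exp ((-a + b) * (-(1 / 2)))) = Real.exp ((-a + b) * (-(1 / 2))) :=
      min_eq_right (Real.exp_le_one_iff.2 (by nlinarith))
    have m2 : min 1 (Real.exp ((-b + a) * (-(1 / 2)))) = 1 :=
      min_eq_left (Real.one_le_exp (by nlinarith))
    rw [m1, m2, mul_one, ← Real.exp_add, ← Real.exp_add, ← Real.exp_add]
    refine h2.trans ((le_of_eq ?_).trans ((amgm
      ((-a + ((-a + b) * (-(γ + 1 / 2)) + (-a + b) * (-(1 / 2)))) / 2)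
      ((-b + (-b + a) * (-(1 - γ))) / 2)).trans (le_of_eq ?_)))
    · congr 2; ring
    · congr 3 <;> ring
  · have m1 : min 1 (Real.exp ((-a + b) * (-(1 / 2)))) = 1 :=
      min_eq_left (Real.one_le_exp (by nlinarith))
    have m2 : min 1 (Real.exp ((-b + a) * (-(1 / 2)))) = Real.exp ((-b + a) * (-(1 / 2))) :=
      min_eq_right (Real.exp_le_one_iff.2 (by nlinarith))
    rw [m1, m2, mul_one, ← Real.exp_add, ← Real.exp_add, ← Real.exp_add]
    refine h1.trans ((le_of_eq ?_).trans ((amgm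
      ((-a + (-a + b) * (-(γ + 1 / 2))) / 2)
      ((-b + ((-b + a) * (-(1 - γ)) + (-b + a) * (-(1 / 2)))) / 2)).trans (le_of_eq ?_)))
    · congr 2; ring
    · congr 3 <;> ring

/-- Schur test with AM-GM weights for two homogeneous kernels of degree `-1`. -/
theorem lintegral_schur_le {φ ψ p q : ℝ → ℝ} (hφ : IntegrableOn φ (Ioi 0))
    (hψ : IntegrableOn ψ (Ioi 0)) (hφm : Measurable φ) (hψm : Measurable ψ)
    (hφ0 : ∀ t, 0 < t → 0 ≤ φ t) (hψ0 : ∀ t, 0 < t → 0 ≤ ψ t)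
    (hp : ContinuousOn p (Ici 0)) (hq : ContinuousOn q (Ici 0)) :
    ∫⁻ μ in Ioi (0 : ℝ), ∫⁻ ν in Ioi (0 : ℝ), ENNReal.ofReal
        (μ⁻¹ * φ (μ⁻¹ * ν) * p μ ^ 2 + ν⁻¹ * ψ (ν⁻¹ * μ) * q ν ^ 2) ≤
      ENNReal.ofReal (∫ t in Ioi (0 : ℝ), φ t) * (∫⁻ μ in Ioi (0 : ℝ), ENNReal.ofReal (p μ ^ 2)) +
      ENNReal.ofReal (∫ t in Ioi (0 : ℝ), ψ t) *
        ∫⁻ ν in Ioi (0 : ℝ), ENNReal.ofReal (q ν ^ 2) := by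
  have hpm : AEMeasurable (fun μ => ENNReal.ofReal (p μ ^ 2)) (volume.restrict (Ioi 0)) :=
    (((hp.mono Ioi_subset_Ici_self).aemeasurable measurableSet_Ioi).pow_const 2).ennreal_ofReal
  have hqm : AEMeasurable (fun μ => ENNReal.ofReal (q μ ^ 2)) (volume.restrict (Ioi 0)) :=
    (((hq.mono Ioi_subset_Ici_self).aemeasurable measurableSet_Ioi).pow_const 2).ennreal_ofReal
  have e1 : ∀ μ ∈ Ioi (0 : ℝ), ∫⁻ ν in Ioi (0 : ℝ), ENNReal.ofReal
        (μ⁻¹ * φ (μ⁻¹ * ν) * p μ ^ 2 + ν⁻¹ * ψ (ν⁻¹ * μ) * q ν ^ 2) =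
      ENNReal.ofReal (∫ t in Ioi (0 : ℝ), φ t) * ENNReal.ofReal (p μ ^ 2) +
      ∫⁻ ν in Ioi (0 : ℝ), ENNReal.ofReal (ν⁻¹ * ψ (ν⁻¹ * μ)) * ENNReal.ofReal (q ν ^ 2) := by
    intro μ hμ
    have hμ' : 0 < μ := hμ
    rw [← lintegral_mul_comp_mul hφ hφ0 (inv_pos.2 hμ'), ← lintegral_mul_const _ (by fun_prop),
      ← lintegral_add_left (by fun_prop)]
    refine setLIntegral_congr_fun measurableSet_Ioi fun ν hν => ?_
    have hν' : 0 < ν := hν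
    have n1 : 0 ≤ φ (μ⁻¹ * ν) := hφ0 _ (by positivity)
    have n2 : 0 ≤ ψ (ν⁻¹ * μ) := hψ0 _ (by positivity)
    rw [ENNReal.ofReal_add (by positivity) (by positivity), ENNReal.ofReal_mul (by positivity),
      ENNReal.ofReal_mul (p := ν⁻¹ * ψ (ν⁻¹ * μ)) (by positivity)]
  rw [setLIntegral_congr_fun measurableSet_Ioi e1, lintegral_add_left' (by fun_prop)]
  refine add_le_add (le_of_eq (lintegral_const_mul'' _ hpm)) (le_of_eq ?_)
  rw [lintegral_lintegral_swap, ← lintegral_const_mul'' _ hqm]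
  · refine setLIntegral_congr_fun measurableSet_Ioi fun ν hν => ?_
    rw [lintegral_mul_const _ (by fun_prop), lintegral_mul_comp_mul hψ hψ0 (inv_pos.2 hν)]
  · refine AEMeasurable.mul ?_ hqm.comp_snd
    exact Measurable.aemeasurable (by fun_prop)

/-- A bound by a sum of squares that is invariant under scaling gives a bound by the product. -/
theorem le_two_mul_of_forall_scale {X C a b : ℝ} (hC : 0 ≤ C) (ha : 0 ≤ a) (hb : 0 ≤ b)
    (h : ∀ s : ℝ, 0 < s → X ≤ C * (s ^ 2 * a ^ 2 + (s⁻¹) ^ 2 * b ^ 2)) : X ≤ 2 * C * a * b := by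
  have key : ∀ ε : ℝ, 0 < ε → X ≤ C * (a * (b + ε) + b * (a + ε)) := by
    intro ε hε
    refine (h (√((b + ε) / (a + ε))) (by positivity)).trans ?_
    rw [inv_pow, Real.sq_sqrt (by positivity), inv_div]
    gcongr C * (?_ + ?_)
    · rw [div_mul_eq_mul_div, div_le_iff₀ (by positivity)]
      nlinarith [mul_nonneg ha (add_pos_of_nonneg_of_pos hb hε).le]
    · rw [div_mul_eq_mul_div, div_le_iff₀ (by positivity)]
      nlinarith [mul_nonneg hb (add_pos_of_nonneg_of_pos ha hε).le]
  have hlim : Tendsto (fun ε : ℝ => C * (a * (b + ε) + b * (a + ε))) (𝓝[>] 0)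
      (𝓝 (C * (a * (b + 0) + b * (a + 0)))) := by
    refine Tendsto.mono_left ?_ nhdsWithin_le_nhds
    exact Continuous.tendsto (by fun_prop) 0
  have := ge_of_tendsto hlim (eventually_nhdsWithin_of_forall key)
  linarith

section

variable {H W : Type*} [NormedAddCommGroup H] [InnerProductSpace ℂ H] [CompleteSpace H]
  [NormedAddCommGroup W] [InnerProductSpace ℂ W] [CompleteSpace W]
variable {T T₁ T₂ : W →L[ℂ] W} {ι : W →L[ℂ] H} {c c₁ c₂ μ ν β γ : ℝ}

/-! ### Kato's comparison of fractional powers of two forms -/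

/-- `A R(2μ) R(μ) g`, weakly: the operator turns into the smoothing `resOp`. -/
theorem Coercive.inner_res_two_mul (hT : Coercive T c) (hμ : 0 < μ) (g : H) (v : W) :
    inner ℂ v (T (res T ι (2 * μ) (ι (res T ι μ g)))) =
      inner ℂ (ι v) (ι (resOp T ι (2 * μ) (res T ι μ g))) := by
  have h2 : 0 ≤ 2 * μ := by linarith
  rw [hT.inner_res h2, hT.resOp_eq h2, map_sub, map_smul]

/-- The Balakrishnan integral of order `1 - γ` with an integrand that decays faster, from
`R(μ) - R(2μ) = μ R(2μ) R(μ)` and dilation. -/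
theorem Coercive.smul_balLift_eq (hT : Coercive T c) (hι : ‖ι‖ ≤ 1) (h0 : 0 < γ)
    (h1 : γ < 1 / 2) (g : H) :
    IntegrableOn (fun μ : ℝ => ((μ ^ γ : ℝ) : ℂ) • res T ι (2 * μ) (ι (res T ι μ g))) (Ioi 0) ∧
    ((1 - 2 ^ (-γ) : ℝ) : ℂ) • balLift T ι (1 - γ) g =
      ∫ μ in Ioi (0 : ℝ), ((μ ^ γ : ℝ) : ℂ) • res T ι (2 * μ) (ι (res T ι μ g)) := by
  have i1 := hT.integrableOn_balLift hι (β := 1 - γ) (by linarith) (by linarith) g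
  have i2 : IntegrableOn (fun μ : ℝ => ((μ ^ (-(1 - γ)) : ℝ) : ℂ) • res T ι (2 * μ) g) (Ioi 0) := by
    have h := (integrableOn_Ioi_comp_mul_left_iff
      (fun μ : ℝ => ((μ ^ (-(1 - γ)) : ℝ) : ℂ) • res T ι μ g) 0 two_pos).2 (by rwa [mul_zero])
    refine IntegrableOn.congr_fun (h.smul (((2 : ℝ) ^ (1 - γ) : ℝ) : ℂ)) (fun μ hμ => ?_)
      measurableSet_Ioi
    have hμ' : 0 < μ := hμ
    simp only [Pi.smul_apply]
    rw [smul_smul, ← Complex.ofReal_mul, Real.mul_rpow two_pos.le hμ'.le, ← mul_assoc,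
      ← Real.rpow_add two_pos, add_neg_cancel, Real.rpow_zero, one_mul]
  have e : ∀ μ ∈ Ioi (0 : ℝ), ((μ ^ (-(1 - γ)) : ℝ) : ℂ) • res T ι μ g -
      ((μ ^ (-(1 - γ)) : ℝ) : ℂ) • res T ι (2 * μ) g =
      ((μ ^ γ : ℝ) : ℂ) • res T ι (2 * μ) (ι (res T ι μ g)) := by
    intro μ hμ
    have hμ' : 0 < μ := hμ
    rw [← smul_sub, hT.res_sub_res hμ'.le (by linarith), smul_smul, ← Complex.ofReal_mul]
    congr 3
    rw [show 2 * μ - μ = μ by ring, ← Real.rpow_add_one hμ'.ne']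
    congr 1
    ring
  refine ⟨IntegrableOn.congr_fun (i1.sub i2) e measurableSet_Ioi, ?_⟩
  rw [← setIntegral_congr_fun measurableSet_Ioi e, integral_sub i1 i2,
    integral_rpow_smul_comp_mul (fun μ => res T ι μ g) (1 - γ) two_pos, balLift]
  rw [show 1 - γ - 1 = -γ by ring]
  push_cast
  rw [sub_smul, one_smul]

/-- The Balakrishnan integral of order `γ` with integrand `A R(2ν) R(ν) f`, from
`A R(2ν) R(ν) = 2 R(2ν) - R(ν)` and dilation. -/
theorem Coercive.smul_bal_eq (hT : Coercive T c) (hι : ‖ι‖ ≤ 1) (h0 : 0 < γ)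
    (h1 : γ < 1) (f : H) :
    IntegrableOn (fun ν : ℝ => ((ν ^ (-γ) : ℝ) : ℂ) • ι (resOp T ι (2 * ν) (res T ι ν f)))
      (Ioi 0) ∧
    ((2 ^ γ - 1 : ℝ) : ℂ) • bal T ι γ f =
      ∫ ν in Ioi (0 : ℝ), ((ν ^ (-γ) : ℝ) : ℂ) • ι (resOp T ι (2 * ν) (res T ι ν f)) := by
  have i1 := hT.integrableOn_bal hι h0 h1 f
  have i2 : IntegrableOn (fun μ : ℝ => ((μ ^ (-γ) : ℝ) : ℂ) • ι (res T ι (2 * μ) f)) (Ioi 0) := by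
    have h := (integrableOn_Ioi_comp_mul_left_iff
      (fun μ : ℝ => ((μ ^ (-γ) : ℝ) : ℂ) • ι (res T ι μ f)) 0 two_pos).2 (by rwa [mul_zero])
    refine IntegrableOn.congr_fun (h.smul (((2 : ℝ) ^ γ : ℝ) : ℂ)) (fun μ hμ => ?_)
      measurableSet_Ioi
    have hμ' : 0 < μ := hμ
    simp only [Pi.smul_apply]
    rw [smul_smul, ← Complex.ofReal_mul, Real.mul_rpow two_pos.le hμ'.le, ← mul_assoc,
      ← Real.rpow_add two_pos, add_neg_cancel, Real.rpow_zero, one_mul]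
  have e : ∀ ν ∈ Ioi (0 : ℝ), (2 : ℂ) • (((ν ^ (-γ) : ℝ) : ℂ) • ι (res T ι (2 * ν) f)) -
      ((ν ^ (-γ) : ℝ) : ℂ) • ι (res T ι ν f) =
      ((ν ^ (-γ) : ℝ) : ℂ) • ι (resOp T ι (2 * ν) (res T ι ν f)) := by
    intro ν hν
    have hν' : 0 < ν := hν
    have hr := hT.res_sub_res (ι := ι) hν'.le (show 0 ≤ 2 * ν by linarith) f
    rw [show 2 * ν - ν = ν by ring] at hr
    rw [hT.resOp_eq (by linarith), smul_comm, ← smul_sub, ← map_smul, ← map_sub]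
    congr 2
    push_cast
    rw [mul_smul, ← hr, smul_sub, two_smul, two_smul]
    abel
  have i3 : IntegrableOn (fun ν : ℝ => (2 : ℂ) • (((ν ^ (-γ) : ℝ) : ℂ) • ι (res T ι (2 * ν) f)))
    (Ioi 0) := i2.smul (2 : ℂ)
  refine ⟨IntegrableOn.congr_fun (i3.sub i1) e measurableSet_Ioi, ?_⟩
  rw [← setIntegral_congr_fun measurableSet_Ioi e, integral_sub i3 i1,
    integral_smul, integral_rpow_smul_comp_mul (fun μ => ι (res T ι μ f)) γ two_pos, smul_smul,
    bal]
  have e2 : (2 : ℂ) * (((2 : ℝ) ^ (γ - 1) : ℝ) : ℂ) = (((2 : ℝ) ^ γ : ℝ) : ℂ) := by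
    rw [Real.rpow_sub_one two_ne_zero]
    push_cast
    ring
  rw [e2, Complex.ofReal_sub, sub_smul, Complex.ofReal_one, one_smul]

/-- The two bounds of `⟪A₁ R₁(2μ) R₁(μ) g, A₂ R₂(2ν) R₂(ν) f⟫`: by continuity of the form, and by
the Cauchy-Schwarz inequality in `H`. -/
theorem Coercive.exists_norm_inner_resOp_le (hT₁ : Coercive T₁ c₁) (hT₂ : Coercive T₂ c₂) :
    ∃ C : ℝ, 0 ≤ C ∧ ∀ (g f : H) (μ ν : ℝ), 0 < μ → 0 < ν →
      ‖inner ℂ (ι (resOp T₂ ι (2 * ν) (res T₂ ι ν f))) (ι (resOp T₁ ι (2 * μ) (res T₁ ι μ g)))‖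
        ≤ C * (‖res T₁ ι μ g‖ * ‖res T₂ ι ν f‖ * μ⁻¹) ∧
      ‖inner ℂ (ι (resOp T₂ ι (2 * ν) (res T₂ ι ν f))) (ι (resOp T₁ ι (2 * μ) (res T₁ ι μ g)))‖
        ≤ C * (‖res T₁ ι μ g‖ * ‖res T₂ ι ν f‖ * (μ ^ (-(1 / 2) : ℝ) * ν ^ (-(1 / 2) : ℝ))) := by
  have hc₁ := hT₁.1
  have hc₂ := hT₂.1
  set C₁ := ‖T₂‖ / c₂ * (‖T₁‖ * (1 + ‖T₁‖ / c₁)) with hC₁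
  set C₂ := (‖T₂‖ * c₂ ^ (-(1 / 2) : ℝ)) * (‖T₁‖ * c₁ ^ (-(1 / 2) : ℝ)) with hC₂
  have hC₁0 : 0 ≤ C₁ := by positivity
  have hC₂0 : 0 ≤ C₂ := by positivity
  refine ⟨C₁ + C₂, by positivity, fun g f μ ν hμ hν => ⟨?_, ?_⟩⟩
  · rw [← hT₁.inner_res_two_mul hμ]
    have a1 := hT₂.norm_resOp_le (ι := ι) (μ := 2 * ν) (by linarith) (res T₂ ι ν f)
    have a2 := hT₁.mul_norm_res_map_le (ι := ι) (μ := 2 * μ) (by linarith) (res T₁ ι μ g)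
    have a3 : ‖res T₁ ι (2 * μ) (ι (res T₁ ι μ g))‖ ≤
        (1 + ‖T₁‖ / c₁) * ‖res T₁ ι μ g‖ * μ⁻¹ := by
      rw [← div_eq_mul_inv, le_div_iff₀ hμ]
      have : 0 ≤ μ * ‖res T₁ ι (2 * μ) (ι (res T₁ ι μ g))‖ := by positivity
      linarith
    calc _ ≤ ‖resOp T₂ ι (2 * ν) (res T₂ ι ν f)‖ *
          (‖T₁‖ * ‖res T₁ ι (2 * μ) (ι (res T₁ ι μ g))‖) :=
          (norm_inner_le_norm _ _).trans (by gcongr; exact T₁.le_opNorm _)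
      _ ≤ (‖T₂‖ / c₂ * ‖res T₂ ι ν f‖) *
          (‖T₁‖ * ((1 + ‖T₁‖ / c₁) * ‖res T₁ ι μ g‖ * μ⁻¹)) := by gcongr
      _ = C₁ * (‖res T₁ ι μ g‖ * ‖res T₂ ι ν f‖ * μ⁻¹) := by rw [hC₁]; ring
      _ ≤ _ := by gcongr; linarith
  · have key : ∀ {T : W →L[ℂ] W} {c : ℝ}, Coercive T c → ∀ (x : ℝ), 0 < x → ∀ w : W,
        ‖ι (resOp T ι (2 * x) w)‖ ≤ ‖T‖ * c ^ (-(1 / 2) : ℝ) * x ^ (-(1 / 2) : ℝ) * ‖w‖ := by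
      intro T c hT x hx w
      have hc := hT.1
      refine (hT.norm_map_resOp_le (by linarith) w).trans ?_
      gcongr ?_ * ‖w‖
      gcongr ?_ * ?_
      exact Real.rpow_le_rpow_of_nonpos hx (by linarith) (by norm_num)
    calc _ ≤ ‖ι (resOp T₂ ι (2 * ν) (res T₂ ι ν f))‖ *
          ‖ι (resOp T₁ ι (2 * μ) (res T₁ ι μ g))‖ := norm_inner_le_norm _ _
      _ ≤ (‖T₂‖ * c₂ ^ (-(1 / 2) : ℝ) * ν ^ (-(1 / 2) : ℝ) * ‖res T₂ ι ν f‖) *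
          (‖T₁‖ * c₁ ^ (-(1 / 2) : ℝ) * μ ^ (-(1 / 2) : ℝ) * ‖res T₁ ι μ g‖) := by
          gcongr
          · exact key hT₂ ν hν _
          · exact key hT₁ μ hμ _
      _ = C₂ * (‖res T₁ ι μ g‖ * ‖res T₂ ι ν f‖ *
          (μ ^ (-(1 / 2) : ℝ) * ν ^ (-(1 / 2) : ℝ))) := by rw [hC₂]; ring
      _ ≤ _ := by gcongr; linarith

theorem Coercive.exists_norm_inner_balLift_le_add (hT₁ : Coercive T₁ c₁) (hT₂ : Coercive T₂ c₂)
    (hι : ‖ι‖ ≤ 1) (h0 : 0 < γ) (h1 : γ < 1 / 2) :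
    ∃ C : ℝ, 0 ≤ C ∧ ∀ (g f : H) (θ : W), ι θ = bal T₂ ι γ f →
      ‖inner ℂ θ (T₁ (balLift T₁ ι (1 - γ) g))‖ ≤ C * (‖g‖ ^ 2 + ‖f‖ ^ 2) := by
  obtain ⟨C, hC, hbd⟩ := hT₁.exists_norm_inner_resOp_le (ι := ι) hT₂
  obtain ⟨Q₁, hQ₁, hq₁⟩ := hT₁.exists_lintegral_sq_norm_res_le (ι := ι)
  obtain ⟨Q₂, hQ₂, hq₂⟩ := hT₂.exists_lintegral_sq_norm_res_le (ι := ι)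
  set φ : ℝ → ℝ := fun t => t ^ (-(γ + 1 / 2)) * min 1 (t ^ (-(1 / 2) : ℝ)) with hφ
  set ψ : ℝ → ℝ := fun t => t ^ (-(1 - γ)) * min 1 (t ^ (-(1 / 2) : ℝ)) with hψ
  set K₁ := ∫ t in Ioi (0 : ℝ), φ t
  set K₂ := ∫ t in Ioi (0 : ℝ), ψ t
  have hφ0 : ∀ t, 0 < t → 0 ≤ φ t := fun t ht => rpow_mul_min_nonneg ht
  have hψ0 : ∀ t, 0 < t → 0 ≤ ψ t := fun t ht => rpow_mul_min_nonneg ht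
  have hK₁ : 0 ≤ K₁ := setIntegral_nonneg measurableSet_Ioi hφ0
  have hK₂ : 0 ≤ K₂ := setIntegral_nonneg measurableSet_Ioi hψ0
  set k₁ : ℝ := 1 - 2 ^ (-γ) with hk₁
  set k₂ : ℝ := 2 ^ γ - 1 with hk₂
  have hk₁0 : 0 < k₁ := by
    rw [hk₁, sub_pos]
    exact Real.rpow_lt_one_of_one_lt_of_neg one_lt_two (by linarith)
  have hk₂0 : 0 < k₂ := by
    rw [hk₂, sub_pos]
    exact Real.one_lt_rpow one_lt_two h0
  refine ⟨(k₁ * k₂)⁻¹ * (C * (K₁ * Q₁ + K₂ * Q₂)), by positivity, fun g f θ hθ => ?_⟩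
  obtain ⟨i1, e1⟩ := hT₁.smul_balLift_eq hι h0 h1 g
  obtain ⟨i2, e2⟩ := hT₂.smul_bal_eq hι h0 (by linarith) f
  set z : ℝ → H := fun μ => ι (resOp T₁ ι (2 * μ) (res T₁ ι μ g)) with hz
  set y : ℝ → H := fun ν => ι (resOp T₂ ι (2 * ν) (res T₂ ι ν f)) with hy
  -- `p1` and `p2` expand the two Balakrishnan integrals, so that the pairing is a double integral
  have p1 : (k₁ : ℂ) * inner ℂ θ (T₁ (balLift T₁ ι (1 - γ) g)) =
      ∫ μ in Ioi (0 : ℝ), ((μ ^ γ : ℝ) : ℂ) * inner ℂ (bal T₂ ι γ f) (z μ) := by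
    rw [← inner_smul_right, ← map_smul, e1]
    have h := ((innerSL ℂ θ) ∘L T₁).integral_comp_comm i1
    refine Eq.trans h.symm (setIntegral_congr_fun measurableSet_Ioi fun μ hμ => ?_)
    simp only [ContinuousLinearMap.comp_apply, map_smul, innerSL_apply_apply, smul_eq_mul]
    rw [hT₁.inner_res_two_mul hμ, hθ]
  have p2 : ∀ x : H, ‖(k₂ : ℂ) * inner ℂ (bal T₂ ι γ f) x‖ₑ ≤
      ∫⁻ ν in Ioi (0 : ℝ), ENNReal.ofReal (ν ^ (-γ) * ‖inner ℂ (y ν) x‖) := by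
    intro x
    have h := (innerSL ℂ x).integral_comp_comm i2
    have h' : inner ℂ x ((k₂ : ℂ) • bal T₂ ι γ f) = ∫ ν in Ioi (0 : ℝ),
        ((ν ^ (-γ) : ℝ) : ℂ) * inner ℂ x (y ν) := by
      rw [e2]
      refine Eq.trans h.symm (setIntegral_congr_fun measurableSet_Ioi fun ν _ => ?_)
      simp only [map_smul, innerSL_apply_apply, smul_eq_mul]
      rfl
    have h'' : ‖(k₂ : ℂ) * inner ℂ (bal T₂ ι γ f) x‖ₑ = ‖inner ℂ x ((k₂ : ℂ) • bal T₂ ι γ f)‖ₑ := by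
      rw [inner_smul_right, enorm_mul, enorm_mul, ← ofReal_norm, ← ofReal_norm (inner ℂ x _),
        norm_inner_symm, ofReal_norm, ofReal_norm]
    rw [h'', h']
    refine (enorm_integral_le_lintegral_enorm _).trans (le_of_eq ?_)
    refine setLIntegral_congr_fun measurableSet_Ioi fun ν hν => ?_
    have hν' : 0 < ν := hν
    rw [← ofReal_norm, norm_mul, Complex.norm_real, Real.norm_of_nonneg (by positivity),
      norm_inner_symm]
  have p3 : ENNReal.ofReal (k₁ * k₂ * ‖inner ℂ θ (T₁ (balLift T₁ ι (1 - γ) g))‖) ≤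
      ∫⁻ μ in Ioi (0 : ℝ), ∫⁻ ν in Ioi (0 : ℝ), ENNReal.ofReal
        (μ ^ γ * (ν ^ (-γ) * ‖inner ℂ (y ν) (z μ)‖)) := by
    have q1 : ENNReal.ofReal (k₁ * k₂ * ‖inner ℂ θ (T₁ (balLift T₁ ι (1 - γ) g))‖) =
        ‖(k₂ : ℂ) * ∫ μ in Ioi (0 : ℝ), ((μ ^ γ : ℝ) : ℂ) * inner ℂ (bal T₂ ι γ f) (z μ)‖ₑ := by
      rw [← p1, ← ofReal_norm, norm_mul, norm_mul, Complex.norm_real, Complex.norm_real,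
        Real.norm_of_nonneg hk₁0.le, Real.norm_of_nonneg hk₂0.le]
      congr 1
      ring
    rw [q1, ← integral_const_mul]
    refine (enorm_integral_le_lintegral_enorm _).trans ?_
    refine setLIntegral_mono' measurableSet_Ioi fun μ hμ => ?_
    have hμ' : 0 < μ := hμ
    have hm : ‖((μ ^ γ : ℝ) : ℂ)‖ₑ = ENNReal.ofReal (μ ^ γ) := by
      rw [← ofReal_norm, Complex.norm_real, Real.norm_of_nonneg (by positivity)]
    rw [mul_left_comm, enorm_mul, hm]
    refine (mul_le_mul_right (p2 (z μ)) _).trans (le_of_eq ?_)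
    rw [← lintegral_const_mul' _ _ ENNReal.ofReal_ne_top]
    refine lintegral_congr fun ν => ?_
    rw [← ENNReal.ofReal_mul (by positivity)]
  -- the two bounds of the integrand combine into the homogeneous kernels of the Schur test:
  -- `φ` is integrable at `0` and `ψ` at `∞` because `γ < 1/2`, the other ends need `0 < γ`
  have p4 : ∫⁻ μ in Ioi (0 : ℝ), ∫⁻ ν in Ioi (0 : ℝ), ENNReal.ofReal
        (μ ^ γ * (ν ^ (-γ) * ‖inner ℂ (y ν) (z μ)‖)) ≤
      ENNReal.ofReal C * ∫⁻ μ in Ioi (0 : ℝ), ∫⁻ ν in Ioi (0 : ℝ), ENNReal.ofReal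
        (μ⁻¹ * φ (μ⁻¹ * ν) * ‖res T₁ ι μ g‖ ^ 2 + ν⁻¹ * ψ (ν⁻¹ * μ) * ‖res T₂ ι ν f‖ ^ 2) := by
    rw [← lintegral_const_mul' _ _ ENNReal.ofReal_ne_top]
    refine setLIntegral_mono' measurableSet_Ioi fun μ hμ => ?_
    rw [← lintegral_const_mul' _ _ ENNReal.ofReal_ne_top]
    refine setLIntegral_mono' measurableSet_Ioi fun ν hν => ?_
    have hμ' : 0 < μ := hμ
    have hν' : 0 < ν := hν
    rw [← ENNReal.ofReal_mul hC]
    refine ENNReal.ofReal_le_ofReal ?_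
    obtain ⟨b1, b2⟩ := hbd g f μ ν hμ hν
    set p := ‖res T₁ ι μ g‖
    set q := ‖res T₂ ι ν f‖
    have hp : 0 ≤ p := norm_nonneg _
    have hq : 0 ≤ q := norm_nonneg _
    have b3 : min (p * q * μ⁻¹) (p * q * (μ ^ (-(1 / 2) : ℝ) * ν ^ (-(1 / 2) : ℝ))) *
        (μ ^ γ * ν ^ (-γ)) ≤
        μ⁻¹ * φ (μ⁻¹ * ν) * p ^ 2 + ν⁻¹ * ψ (ν⁻¹ * μ) * q ^ 2 := by
      refine le_schur_kernels hμ hν hp hq ?_ ?_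
      · refine (mul_le_mul_of_nonneg_right (min_le_left _ _) (by positivity)).trans (le_of_eq ?_)
        rw [Real.rpow_sub_one hμ'.ne']
        ring
      · refine (mul_le_mul_of_nonneg_right (min_le_right _ _) (by positivity)).trans (le_of_eq ?_)
        rw [sub_eq_add_neg γ, sub_eq_add_neg (-γ), Real.rpow_add hμ', Real.rpow_add hν']
        ring
    calc _ = ‖inner ℂ (y ν) (z μ)‖ * (μ ^ γ * ν ^ (-γ)) := by ring
      _ ≤ (C * min (p * q * μ⁻¹) (p * q * (μ ^ (-(1 / 2) : ℝ) * ν ^ (-(1 / 2) : ℝ)))) *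
          (μ ^ γ * ν ^ (-γ)) := by
          gcongr
          rw [mul_min_of_nonneg _ _ hC]
          exact le_min b1 b2
      _ ≤ _ := by
          rw [mul_assoc]
          gcongr
  have p5 := lintegral_schur_le (φ := φ) (ψ := ψ)
    (integrableOn_rpow_mul_min (by linarith) (by linarith))
    (integrableOn_rpow_mul_min (by linarith) (by linarith)) (by fun_prop) (by fun_prop) hφ0 hψ0
    (hT₁.continuousOn_res_apply (ι := ι) g).norm (hT₂.continuousOn_res_apply (ι := ι) f).norm
  have p6 : ENNReal.ofReal (k₁ * k₂ * ‖inner ℂ θ (T₁ (balLift T₁ ι (1 - γ) g))‖) ≤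
      ENNReal.ofReal (C * (K₁ * (Q₁ * ‖g‖ ^ 2) + K₂ * (Q₂ * ‖f‖ ^ 2))) := by
    rw [ENNReal.ofReal_mul hC, ENNReal.ofReal_add (by positivity) (by positivity),
      ENNReal.ofReal_mul hK₁, ENNReal.ofReal_mul hK₂]
    refine p3.trans (p4.trans ?_)
    gcongr
    refine p5.trans ?_
    gcongr
    · exact hq₁ g
    · exact hq₂ f
  rw [ENNReal.ofReal_le_ofReal_iff (by positivity)] at p6
  rw [mul_assoc, inv_mul_eq_div, le_div_iff₀ (by positivity), mul_comm]
  refine p6.trans ?_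
  rw [mul_assoc]
  gcongr
  nlinarith [mul_nonneg (mul_nonneg hK₁ hQ₁) (sq_nonneg ‖f‖),
    mul_nonneg (mul_nonneg hK₂ hQ₂) (sq_nonneg ‖g‖)]

/-- Kato's theorem in bilinear form: if `θ = A₂^{-γ} f` with `0 < γ < 1/2`, then
`|⟪A₁ A₁^{-(1-γ)} g, θ⟫| ≤ C ‖g‖ ‖f‖`, for any two coercive forms with the same domain. -/
theorem Coercive.exists_norm_inner_balLift_le (hT₁ : Coercive T₁ c₁) (hT₂ : Coercive T₂ c₂)
    (hι : ‖ι‖ ≤ 1) (h0 : 0 < γ) (h1 : γ < 1 / 2) :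
    ∃ C : ℝ, 0 ≤ C ∧ ∀ (g f : H) (θ : W), ι θ = bal T₂ ι γ f →
      ‖inner ℂ θ (T₁ (balLift T₁ ι (1 - γ) g))‖ ≤ C * ‖g‖ * ‖f‖ := by
  obtain ⟨C, hC, h⟩ := hT₁.exists_norm_inner_balLift_le_add hT₂ hι h0 h1
  refine ⟨2 * C, by positivity, fun g f θ hθ => ?_⟩
  refine le_two_mul_of_forall_scale hC (norm_nonneg _) (norm_nonneg _) fun s hs => ?_
  have h2 := h ((s : ℂ) • g) ((s⁻¹ : ℂ) • f) ((s⁻¹ : ℂ) • θ) (by rw [map_smul, hθ, bal_smul])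
  have e : balLift T₁ ι (1 - γ) ((s : ℂ) • g) = (s : ℂ) • balLift T₁ ι (1 - γ) g := by
    rw [balLift, balLift, ← integral_smul]
    simp only [map_smul]
    simp only [smul_comm (s : ℂ)]
  have hs' : (s : ℂ) ≠ 0 := by exact_mod_cast hs.ne'
  rw [e, map_smul, inner_smul_left, inner_smul_right, ← mul_assoc, map_inv₀, Complex.conj_ofReal,
    inv_mul_cancel₀ hs', one_mul, norm_smul, norm_smul, norm_inv, Complex.norm_real,
    Real.norm_of_nonneg hs.le, mul_pow, mul_pow] at h2
  exact h2

end

section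

variable {H W : Type*} [NormedAddCommGroup H] [InnerProductSpace ℂ H] [CompleteSpace H]
  [NormedAddCommGroup W] [InnerProductSpace ℂ W] [CompleteSpace W]
variable {T S : W →L[ℂ] W} {ι : W →L[ℂ] H} {c c' μ ν β γ : ℝ}

/-! ### Domains of fractional powers -/

theorem Coercive.adjoint (hT : Coercive T c) : Coercive (ContinuousLinearMap.adjoint T) c := by
  refine ⟨hT.1, fun v => ?_⟩
  rw [ContinuousLinearMap.adjoint_inner_right, ← inner_conj_symm, Complex.conj_re]
  exact hT.2 v

/-- A functional on the form domain that is bounded in the norm of `H` is represented in `H`. -/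
theorem exists_adjoint_eq (hinj : Function.Injective ι) {x : W} {C : ℝ} (hC : 0 ≤ C)
    (h : ∀ v, ‖inner ℂ v x‖ ≤ C * ‖ι v‖) :
    ∃ f : H, ‖f‖ ≤ C ∧ ContinuousLinearMap.adjoint ι f = x := by
  set e := LinearEquiv.ofInjective (ι : W →ₗ[ℂ] H) hinj
  have he : ∀ v, (e v : H) = ι v := fun v => rfl
  set l : LinearMap.range (ι : W →ₗ[ℂ] H) →L[ℂ] ℂ :=
    LinearMap.mkContinuous ((innerSL ℂ x : W →ₗ[ℂ] ℂ) ∘ₗ (e.symm : _ →ₗ[ℂ] W)) C (by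
      intro y
      obtain ⟨v, rfl⟩ := e.surjective y
      have := h v
      rw [norm_inner_symm] at this
      simpa [he] using this) with hl
  obtain ⟨k, hk, hkn⟩ := exists_extension_norm_eq _ l
  refine ⟨(InnerProductSpace.toDual ℂ H).symm k, ?_, ?_⟩
  · rw [LinearIsometryEquiv.norm_map, hkn]
    exact LinearMap.mkContinuous_norm_le _ hC _
  · refine ext_inner_right ℂ fun v => ?_
    rw [ContinuousLinearMap.adjoint_inner_left, InnerProductSpace.toDual_symm_apply, ← he, hk]
    simp [hl]

theorem Coercive.eq_res_zero (hT : Coercive T c) {w : W} {f : H}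
    (h : T w = ContinuousLinearMap.adjoint ι f) : w = res T ι 0 f := by
  refine hT.eq_res le_rfl fun v => ?_
  rw [h, ContinuousLinearMap.adjoint_inner_right]
  simp

theorem Coercive.exists_norm_balLift_le (hT : Coercive T c) (hι : ‖ι‖ ≤ 1) (h0 : 1 / 2 < β)
    (h1 : β < 1) : ∃ C : ℝ, 0 ≤ C ∧ ∀ g : H, ‖balLift T ι β g‖ ≤ C * ‖g‖ := by
  have hc := hT.1
  set M : ℝ := c⁻¹ + c ^ (-(1 / 2) : ℝ)
  have hM : 0 ≤ M := by positivity
  have hi := integrableOn_rpow_mul_min (β := β) (δ := 1 / 2) h1 (by linarith)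
  refine ⟨M * ∫ μ in Ioi (0 : ℝ), μ ^ (-β) * min 1 (μ ^ (-(1 / 2) : ℝ)), ?_, fun g => ?_⟩
  · exact mul_nonneg hM (setIntegral_nonneg measurableSet_Ioi fun t ht =>
      rpow_mul_min_nonneg ht)
  · rw [mul_right_comm, ← integral_const_mul]
    refine norm_integral_le_of_norm_le (hi.const_mul _) ?_
    filter_upwards [ae_restrict_mem measurableSet_Ioi] with μ hμ
    have hμ' : 0 < μ := hμ
    rw [norm_smul, Complex.norm_real, Real.norm_of_nonneg (by positivity), mul_left_comm]
    gcongr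
    rw [mul_min_of_nonneg _ _ (by positivity), mul_one]
    refine le_min ((hT.norm_res_le hι hμ'.le g).trans ?_) ((hT.norm_res_le_rpow hμ' g).trans ?_)
    · gcongr
      exact le_add_of_nonneg_right (by positivity)
    · rw [mul_right_comm]
      gcongr
      exact le_add_of_nonneg_left (by positivity)

/-- `A((μ + A)⁻¹ u, φ) = A(u, (μ + A*)⁻¹ φ)`. -/
theorem Coercive.inner_res_map (hT : Coercive T c) (hμ : 0 ≤ μ) (u φ : W) :
    inner ℂ φ (T (res T ι μ (ι u))) =
      inner ℂ (res (ContinuousLinearMap.adjoint T) ι μ (ι φ)) (T u) := by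
  have e1 : T u = shift T ι μ (resOp T ι μ u) := (hT.shift_inverse_apply hμ _).symm
  rw [hT.inner_res hμ, ← map_smul, ← map_sub, ← hT.resOp_eq hμ, e1, inner_shift,
    ← ContinuousLinearMap.adjoint_inner_left ι, ← hT.adjoint.shift_res hμ]
  rw [shift, add_apply, smul_apply, inner_add_left,
    inner_smul_left, Complex.conj_ofReal, ContinuousLinearMap.adjoint_inner_left,
    ContinuousLinearMap.comp_apply, ContinuousLinearMap.adjoint_inner_left]

/-- `A(A^{-β} u, φ) = A(u, A*^{-β} φ)`, up to a constant. -/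
theorem Coercive.inner_balLift_map (hT : Coercive T c) (hι : ‖ι‖ ≤ 1) (h0 : 0 < β) (h1 : β < 1)
    (u φ : W) :
    inner ℂ φ (T (balLift T ι β (ι u))) =
      inner ℂ (balLift (ContinuousLinearMap.adjoint T) ι β (ι φ)) (T u) := by
  have a1 := ((innerSL ℂ φ) ∘L T).integral_comp_comm (hT.integrableOn_balLift_map hι h0 h1 u)
  have a2 := (innerSL ℂ (T u)).integral_comp_comm (hT.adjoint.integrableOn_balLift_map hι h0 h1 φ)
  rw [← inner_conj_symm (balLift _ _ _ _)]
  refine Eq.trans a1.symm (Eq.trans ?_ (congrArg conj a2))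
  rw [← integral_conj]
  refine setIntegral_congr_fun measurableSet_Ioi fun μ hμ => ?_
  simp only [ContinuousLinearMap.comp_apply, map_smul, innerSL_apply_apply, smul_eq_mul, map_mul,
    Complex.conj_ofReal]
  rw [inner_conj_symm, hT.inner_res_map (le_of_lt hμ)]

theorem Coercive.inner_balLift_symm (hS : Coercive S c)
    (hsym : ContinuousLinearMap.adjoint S = S) (hι : ‖ι‖ ≤ 1) (h0 : 0 < β) (h1 : β < 1)
    (θ h : W) :
    ‖inner ℂ h (S (balLift S ι β (ι θ)))‖ = ‖inner ℂ θ (S (balLift S ι β (ι h)))‖ := by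
  rw [hS.inner_balLift_map hι h0 h1, hsym, norm_inner_symm]
  nth_rewrite 1 [← hsym]
  rw [ContinuousLinearMap.adjoint_inner_left]

/-- If the functional `S(S^{-(1-γ)} ·, θ)` is bounded by `M` in the norm of `H`, then `θ` is in the
domain of `S^γ` and `‖S^γ θ‖ ≤ M`, up to a constant. -/
theorem Coercive.exists_bal_eq_of_le (hS : Coercive S c)
    (hsym : ContinuousLinearMap.adjoint S = S) (hι : ‖ι‖ ≤ 1) (hinj : Function.Injective ι)
    (h0 : 0 < γ) (h1 : γ < 1 / 2) {θ : W} {M : ℝ} (hM : 0 ≤ M)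
    (h : ∀ v : W, ‖inner ℂ θ (S (balLift S ι (1 - γ) (ι v)))‖ ≤ M * ‖ι v‖) :
    ∃ f : H, ‖f‖ ≤ M ∧ bal S ι (1 - γ) (ι θ) = ι (res S ι 0 f) := by
  obtain ⟨f, hf, hfe⟩ := exists_adjoint_eq (x := S (balLift S ι (1 - γ) (ι θ))) hinj hM
    (fun v => by
      rw [hS.inner_balLift_symm hsym hι (by linarith) (by linarith)]
      exact h v)
  refine ⟨f, hf, ?_⟩
  rw [← hS.eq_res_zero hfe.symm, hS.map_balLift hι (by linarith) (by linarith)]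

/-- The form domain is contained in the domain of `S^γ` for `γ < 1/2`. -/
theorem Coercive.exists_bal_eq (hS : Coercive S c)
    (hsym : ContinuousLinearMap.adjoint S = S) (hι : ‖ι‖ ≤ 1) (hinj : Function.Injective ι)
    (h0 : 0 < γ) (h1 : γ < 1 / 2) (θ : W) :
    ∃ f : H, bal S ι (1 - γ) (ι θ) = ι (res S ι 0 f) := by
  obtain ⟨C, hC, hb⟩ := hS.exists_norm_balLift_le hι (β := 1 - γ) (by linarith) (by linarith)
  obtain ⟨f, -, hf⟩ := hS.exists_bal_eq_of_le hsym hι hinj h0 h1 (θ := θ)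
    (M := ‖θ‖ * (‖S‖ * C)) (by positivity) (fun v => by
      calc _ ≤ ‖θ‖ * (‖S‖ * ‖balLift S ι (1 - γ) (ι v)‖) :=
            (norm_inner_le_norm _ _).trans (by gcongr; exact S.le_opNorm _)
        _ ≤ ‖θ‖ * (‖S‖ * (C * ‖ι v‖)) := by gcongr; exact hb _
        _ = _ := by ring)
  exact ⟨f, hf⟩

/-- If `A^{1-γ} u = g`, then `u` is in the form domain and `A(u, θ)` is bounded by
`‖g‖ ‖S^γ θ‖`. -/
theorem Coercive.exists_lift_of_bal_eq (hT : Coercive T c) (hS : Coercive S c') (hι : ‖ι‖ ≤ 1)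
    (hd : DenseRange ι) (h0 : 0 < γ) (h1 : γ < 1 / 2) :
    ∃ C : ℝ, 0 ≤ C ∧ ∀ u g : H, bal T ι γ u = ι (res T ι 0 g) →
      ∃ v : W, ι v = u ∧ ∀ (θ : W) (f : H), bal S ι (1 - γ) (ι θ) = ι (res S ι 0 f) →
        ‖inner ℂ θ (T v)‖ ≤ C * ‖g‖ * ‖f‖ := by
  obtain ⟨C, hC, hK⟩ := hT.exists_norm_inner_balLift_le hS hι h0 h1
  obtain ⟨κ, hκ⟩ := hT.exists_eq_smul_bal hι hd h0 (by linarith)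
  obtain ⟨κ', hκ'⟩ := hS.exists_eq_smul_bal hι hd (γ := 1 - γ) (by linarith) (by linarith)
  refine ⟨‖κ‖ * C * ‖κ'‖, by positivity, fun u g hu => ⟨κ • balLift T ι (1 - γ) g, ?_, ?_⟩⟩
  · rw [map_smul, hT.map_balLift hι (by linarith) (by linarith), ← hκ u g hu]
  · intro θ f hθ
    have e := hκ' _ _ hθ
    rw [sub_sub_cancel, ← bal_smul] at e
    have := hK g _ θ e
    rw [map_smul, inner_smul_right, norm_mul]
    rw [norm_smul] at this
    calc _ ≤ ‖κ‖ * (C * ‖g‖ * (‖κ'‖ * ‖f‖)) := by gcongr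
      _ = _ := by ring

/-- If `u` is in the form domain and `A(u, θ)` is bounded by `M ‖S^γ θ‖`, then `u` is in the domain
of `A^{1-γ}` and `‖A^{1-γ} u‖ ≤ C M`. -/
theorem Coercive.exists_bal_eq_of_lift (hT : Coercive T c) (hS : Coercive S c')
    (hsym : ContinuousLinearMap.adjoint S = S) (hι : ‖ι‖ ≤ 1) (hinj : Function.Injective ι)
    (h0 : 0 < γ) (h1 : γ < 1 / 2) :
    ∃ C : ℝ, 0 ≤ C ∧ ∀ (u : W) (M : ℝ), 0 ≤ M →
      (∀ (θ : W) (f : H), bal S ι (1 - γ) (ι θ) = ι (res S ι 0 f) →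
        ‖inner ℂ θ (T u)‖ ≤ M * ‖f‖) →
      ∃ g : H, ‖g‖ ≤ C * M ∧ bal T ι γ (ι u) = ι (res T ι 0 g) := by
  obtain ⟨C, hC, hK⟩ := hS.exists_norm_inner_balLift_le hT.adjoint hι h0 h1
  refine ⟨C, hC, fun u M hM hu => ?_⟩
  obtain ⟨g, hg, hge⟩ := exists_adjoint_eq (x := T (balLift T ι γ (ι u))) hinj
    (C := C * M) (by positivity) (fun φ => by
      rw [hT.inner_balLift_map hι h0 (by linarith)]
      set θ := balLift (ContinuousLinearMap.adjoint T) ι γ (ι φ) with hθ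
      have e : ι θ = bal (ContinuousLinearMap.adjoint T) ι γ (ι φ) :=
        hT.adjoint.map_balLift_map hι h0 (by linarith) φ
      obtain ⟨f, hf, hfe⟩ := hS.exists_bal_eq_of_le hsym hι hinj h0 h1 (θ := θ)
        (M := C * ‖ι φ‖) (by positivity) (fun v => by
          have := hK (ι v) (ι φ) θ e
          linarith)
      calc _ ≤ M * ‖f‖ := hu θ f hfe
        _ ≤ M * (C * ‖ι φ‖) := by gcongr
        _ = _ := by ring)
  refine ⟨g, hg, ?_⟩
  rw [← hT.eq_res_zero hge.symm, hT.map_balLift_map hι h0 (by linarith)]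

/-- `A^β u = f` for `0 < β < 1`, as `A⁻¹ f = A^{β-1} u` with `A^{β-1} = k ∫₀^∞ μ^{β-1} (μ + A)⁻¹ dμ`;
the value of the constant `k` plays no role. -/
def PowRel (T : W →L[ℂ] W) (ι : W →L[ℂ] H) (k : ℂ) (β : ℝ) (u f : H) : Prop :=
  k • bal T ι (1 - β) u = ι (res T ι 0 f)

variable {k k' : ℂ}

theorem powRel_iff (hk : k ≠ 0) (u f : H) :
    PowRel T ι k β u f ↔ bal T ι (1 - β) u = ι (res T ι 0 (k⁻¹ • f)) := by
  rw [PowRel, map_smul, map_smul, eq_inv_smul_iff₀ hk]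

theorem powRel_smul_iff (hk : k ≠ 0) (u f : H) :
    PowRel T ι k β u (k • f) ↔ bal T ι (1 - β) u = ι (res T ι 0 f) := by
  rw [powRel_iff hk, inv_smul_smul₀ hk]

/-- An element `u` of `D(A^{1-γ})` is in the form domain, and
`|A(u, θ)| ≤ C ‖A^{1-γ} u‖ ‖S^γ θ‖`. -/
theorem Coercive.exists_lift_of_powRel (hT : Coercive T c) (hS : Coercive S c') (hι : ‖ι‖ ≤ 1)
    (hd : DenseRange ι) (h0 : 0 < γ) (h1 : γ < 1 / 2) (hk : k ≠ 0) (hk' : k' ≠ 0) :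
    ∃ C : ℝ, 0 ≤ C ∧ ∀ u g : H, PowRel T ι k (1 - γ) u g →
      ∃ v : W, ι v = u ∧ ∀ (θ : W) (f : H), PowRel S ι k' γ (ι θ) f →
        ‖inner ℂ θ (T v)‖ ≤ C * ‖g‖ * ‖f‖ := by
  obtain ⟨C, hC, h⟩ := hT.exists_lift_of_bal_eq hS hι hd h0 h1
  refine ⟨C * ‖k⁻¹‖ * ‖k'⁻¹‖, by positivity, fun u g hu => ?_⟩
  rw [powRel_iff hk, sub_sub_cancel] at hu
  obtain ⟨v, hv, hb⟩ := h _ _ hu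
  refine ⟨v, hv, fun θ f hθ => ?_⟩
  have := hb θ _ ((powRel_iff hk' _ _).1 hθ)
  rw [norm_smul, norm_smul] at this
  refine this.trans (le_of_eq ?_)
  ring

/-- If `|A(u, θ)| ≤ M ‖S^γ θ‖` for all `θ` in the form domain, then `u` is in `D(A^{1-γ})` and
`‖A^{1-γ} u‖ ≤ C M`. -/
theorem Coercive.exists_powRel_of_lift (hT : Coercive T c) (hS : Coercive S c')
    (hsym : ContinuousLinearMap.adjoint S = S) (hι : ‖ι‖ ≤ 1) (hinj : Function.Injective ι)
    (h0 : 0 < γ) (h1 : γ < 1 / 2) (hk : k ≠ 0) (hk' : k' ≠ 0) :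
    ∃ C : ℝ, 0 ≤ C ∧ ∀ (u : W) (M : ℝ), 0 ≤ M →
      (∀ (θ : W) (f : H), PowRel S ι k' γ (ι θ) f → ‖inner ℂ θ (T u)‖ ≤ M * ‖f‖) →
      ∃ g : H, ‖g‖ ≤ C * M ∧ PowRel T ι k (1 - γ) (ι u) g := by
  obtain ⟨C, hC, h⟩ := hT.exists_bal_eq_of_lift hS hsym hι hinj h0 h1
  refine ⟨‖k‖ * C * ‖k'‖, by positivity, fun u M hM hu => ?_⟩
  obtain ⟨g, hg, hge⟩ := h u (M * ‖k'‖) (by positivity) (fun θ f hf => by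
    have := hu θ _ ((powRel_smul_iff hk' _ _).2 hf)
    rw [norm_smul] at this
    linarith)
  refine ⟨k • g, ?_, (powRel_smul_iff hk _ _).2 (by rwa [sub_sub_cancel])⟩
  rw [norm_smul]
  calc ‖k‖ * ‖g‖ ≤ ‖k‖ * (C * (M * ‖k'‖)) := by gcongr
    _ = _ := by ring

theorem Coercive.exists_powRel (hS : Coercive S c)
    (hsym : ContinuousLinearMap.adjoint S = S) (hι : ‖ι‖ ≤ 1) (hinj : Function.Injective ι)
    (h0 : 0 < γ) (h1 : γ < 1 / 2) (hk : k ≠ 0) (θ : W) : ∃ f : H, PowRel S ι k γ (ι θ) f := by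
  obtain ⟨f, hf⟩ := hS.exists_bal_eq hsym hι hinj h0 h1 θ
  exact ⟨k • f, (powRel_smul_iff hk _ _).2 hf⟩

theorem Coercive.norm_inner_res_zero_le (hT : Coercive T c) (g : H) (θ : W) :
    ‖inner ℂ θ (T (res T ι 0 g))‖ ≤ ‖g‖ * ‖ι θ‖ := by
  rw [hT.inner_res le_rfl, mul_comm]
  simpa using norm_inner_le_norm (ι θ) g

theorem Coercive.exists_eq_res_zero (hT : Coercive T c) (hinj : Function.Injective ι) {u : W}
    {M : ℝ} (hM : 0 ≤ M) (h : ∀ θ, ‖inner ℂ θ (T u)‖ ≤ M * ‖ι θ‖) :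
    ∃ g : H, ‖g‖ ≤ M ∧ u = res T ι 0 g := by
  obtain ⟨g, hg, hge⟩ := exists_adjoint_eq (x := T u) hinj hM h
  exact ⟨g, hg, hT.eq_res_zero hge.symm⟩

theorem Coercive.eq_of_inner_eq (hT : Coercive T c) {u v : W}
    (h : ∀ φ, inner ℂ φ (T u) = inner ℂ φ (T v)) : u = v := by
  refine hT.eq_of_shift_eq (ι := (0 : W →L[ℂ] W)) (le_refl 0) (ext_inner_left ℂ fun φ => ?_)
  simpa [shift] using h φ

/-- The Lax-Milgram theorem for antilinear functionals. -/
theorem Coercive.exists_inner_eq (hT : Coercive T c) (F : W →L⋆[ℂ] ℂ) :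
    ∃ u : W, ∀ φ, inner ℂ φ (T u) = F φ := by
  set l : W →L[ℂ] ℂ := LinearMap.mkContinuous
    { toFun := fun φ => conj (F φ)
      map_add' := fun x y => by rw [map_add, map_add]
      map_smul' := fun k x => by
        rw [map_smulₛₗ, smul_eq_mul, map_mul, Complex.conj_conj, RingHom.id_apply, smul_eq_mul] }
    ‖F‖ (fun x => by
      change ‖conj (F x)‖ ≤ _
      rw [RCLike.norm_conj]
      exact F.le_opNorm x) with hl
  set x := (InnerProductSpace.toDual ℂ W).symm l with hx
  refine ⟨Ring.inverse (shift T (0 : W →L[ℂ] W) 0) x, fun φ => ?_⟩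
  have e := inner_shift (T := T) (ι := (0 : W →L[ℂ] W)) (μ := 0)
    (Ring.inverse (shift T (0 : W →L[ℂ] W) 0) x) φ
  rw [hT.shift_inverse_apply le_rfl, Complex.ofReal_zero, zero_mul, add_zero] at e
  rw [← e, ← inner_conj_symm, hx, InnerProductSpace.toDual_symm_apply]
  exact Complex.conj_conj (F φ)

/-- The operator on the form domain that represents the Hermitian part of the form `⟪v, T u⟫`. -/
def symPart (T : W →L[ℂ] W) : W →L[ℂ] W := (1 / 2 : ℂ) • (T + ContinuousLinearMap.adjoint T)

theorem inner_symPart (u v : W) :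
    inner ℂ v (symPart T u) = (inner ℂ v (T u) + conj (inner ℂ u (T v))) / 2 := by
  rw [symPart, smul_apply, add_apply, inner_smul_right, inner_add_right,
    ContinuousLinearMap.adjoint_inner_right, inner_conj_symm]
  ring

theorem Coercive.symPart (hT : Coercive T c) : Coercive (symPart T) c := by
  refine ⟨hT.1, fun v => ?_⟩
  rw [inner_symPart, Complex.add_conj]
  simpa using hT.2 v

theorem adjoint_symPart : ContinuousLinearMap.adjoint (symPart T) = symPart T := by
  rw [symPart, map_smulₛₗ, map_add, ContinuousLinearMap.adjoint_adjoint, add_comm, map_div₀,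
    map_one, map_ofNat]

end

section

/-! ### The space `𝕍` -/

variable {d : ℕ} {Ω ΓD : Set (E d)}

theorem memLp_ofReal {ψ : E d → ℝ} (hψ : Continuous ψ) (hc : HasCompactSupport ψ) :
    MemLp (fun x => (ψ x : ℂ)) 2 (volume.restrict Ω) :=
  (Complex.continuous_ofReal.comp hψ).memLp_of_hasCompactSupport
    (hc.comp_left (g := fun t : ℝ => (t : ℂ)) rfl)

theorem integral_smul_eq_inner {ψ : E d → ℝ} (hψ : Continuous ψ) (hc : HasCompactSupport ψ)
    (g : L2 Ω) :
    ∫ x in Ω, ψ x • g x = inner ℂ ((memLp_ofReal (Ω := Ω) hψ hc).toLp _) g := by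
  rw [L2.inner_def]
  refine integral_congr_ae ?_
  filter_upwards [(memLp_ofReal (Ω := Ω) hψ hc).coeFn_toLp] with x hx
  rw [hx, RCLike.inner_apply, Complex.conj_ofReal, Complex.real_smul, mul_comm]

theorem continuous_integral_smul {ψ : E d → ℝ} (hψ : Continuous ψ) (hc : HasCompactSupport ψ) :
    Continuous fun g : L2 Ω => ∫ x in Ω, ψ x • g x := by
  simp_rw [integral_smul_eq_inner hψ hc]
  fun_prop

theorem isClosed_H1 : IsClosed (H1 Ω : Set (Jet Ω)) := by
  have e : (H1 Ω : Set (Jet Ω)) = {u | ∀ (i : Fin d) (φ : E d → ℝ), ContDiff ℝ ∞ φ →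
      HasCompactSupport φ → tsupport φ ⊆ Ω →
      ∫ x in Ω, pderiv φ i x • u 0 x = - ∫ x in Ω, φ x • u i.succ x} := rfl
  rw [e]
  simp only [ofPred_forall]
  refine isClosed_iInter fun i => isClosed_iInter fun φ => isClosed_iInter fun hφ =>
    isClosed_iInter fun hc => isClosed_iInter fun _ => ?_
  exact isClosed_eq ((continuous_integral_smul (continuous_pderiv hφ i)
      (hasCompactSupport_pderiv hc i)).comp (PiLp.continuous_apply 2 _ 0))
    ((continuous_integral_smul hφ.continuous hc).comp (PiLp.continuous_apply 2 _ i.succ)).neg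

theorem eLpNorm_sub_le_add_edist {φ : E d → ℂ} (hφ : Continuous φ) (u v : L2 Ω) :
    eLpNorm (fun x => φ x - v x) 2 (volume.restrict Ω) ≤
      eLpNorm (fun x => φ x - u x) 2 (volume.restrict Ω) + edist u v := by
  rw [Lp.edist_def]
  have e : (fun x => φ x - v x) = (fun x => φ x - u x) + (u - v : E d → ℂ) := by
    ext x
    simp
  rw [e]
  exact eLpNorm_add_le (hφ.aestronglyMeasurable.sub (Lp.aestronglyMeasurable u))
    ((Lp.aestronglyMeasurable u).sub (Lp.aestronglyMeasurable v)) (by norm_num)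

theorem hasZeroTrace_of_mem_closure {u : Jet Ω} (hu : u ∈ closure {v | HasZeroTrace ΓD v}) :
    HasZeroTrace ΓD u := by
  obtain ⟨v, hv, hlim⟩ := mem_closure_iff_seq_limit.1 hu
  -- the `n`-th function of a diagonal sequence, within `2 / (n + 1)` in all the norms
  have key : ∀ n : ℕ, ∃ φ : E d → ℂ, ContDiff ℝ ∞ φ ∧ HasCompactSupport φ ∧
      eLpNorm (fun x => φ x - u 0 x) 2 (volume.restrict Ω) ≤ (n + 1 : ℝ≥0∞)⁻¹ + (n + 1 : ℝ≥0∞)⁻¹ ∧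
      (∀ i : Fin d, eLpNorm (fun x => pderiv φ i x - u i.succ x) 2 (volume.restrict Ω) ≤
        (n + 1 : ℝ≥0∞)⁻¹ + (n + 1 : ℝ≥0∞)⁻¹) ∧
      eLpNorm φ 2 ((μH[(d : ℝ) - 1]).restrict ΓD) ≤ (n + 1 : ℝ≥0∞)⁻¹ + (n + 1 : ℝ≥0∞)⁻¹ := by
    intro n
    have hε : (0 : ℝ≥0∞) < (n + 1 : ℝ≥0∞)⁻¹ := by simp
    have h1 : ∀ᶠ k in atTop, ∀ j : Fin (d + 1), edist (v k j) (u j) ≤ (n + 1 : ℝ≥0∞)⁻¹ := by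
      refine eventually_all.2 fun j => ?_
      have t := tendsto_iff_edist_tendsto_0.1
        (((PiLp.continuous_apply 2 (fun _ : Fin (d + 1) => L2 Ω) j).tendsto u).comp hlim)
      exact t.eventually_le_const hε
    obtain ⟨k, hk⟩ := h1.exists
    obtain ⟨φ, s, c, t0, t1, tb⟩ := hv k
    have h2 := (t0.eventually_le_const hε).and
      ((eventually_all.2 fun i => (t1 i).eventually_le_const hε).and (tb.eventually_le_const hε))
    obtain ⟨m, m0, m1, mb⟩ := h2.exists
    refine ⟨φ m, s m, c m, ?_, fun i => ?_, mb.trans le_self_add⟩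
    · exact (eLpNorm_sub_le_add_edist (s m).continuous _ _).trans (add_le_add m0 (hk 0))
    · exact (eLpNorm_sub_le_add_edist (continuous_pderiv (s m) i) _ _).trans
        (add_le_add (m1 i) (hk i.succ))
  choose φ h1 h2 h3 h4 h5 using key
  have hlim0 : Tendsto (fun n : ℕ => (n + 1 : ℝ≥0∞)⁻¹ + (n + 1 : ℝ≥0∞)⁻¹) atTop (𝓝 0) := by
    have t : Tendsto (fun n : ℕ => (n + 1 : ℝ≥0∞)⁻¹) atTop (𝓝 0) := by
      have := (tendsto_add_atTop_iff_nat 1).2 ENNReal.tendsto_inv_nat_nhds_zero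
      simpa using this
    simpa using t.add t
  exact ⟨φ, h1, h2, tendsto_of_tendsto_of_tendsto_of_le_of_le tendsto_const_nhds hlim0
      (fun _ => zero_le) h3,
    fun i => tendsto_of_tendsto_of_tendsto_of_le_of_le tendsto_const_nhds hlim0
      (fun _ => zero_le) (fun n => h4 n i),
    tendsto_of_tendsto_of_tendsto_of_le_of_le tendsto_const_nhds hlim0 (fun _ => zero_le) h5⟩

theorem isClosed_V : IsClosed (V Ω ΓD : Set (Jet Ω)) := by
  refine isClosed_H1.inter (isClosed_of_closure_subset fun u hu => ?_)
  exact hasZeroTrace_of_mem_closure hu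

instance : CompleteSpace (V Ω ΓD) := isClosed_V.completeSpace_coe

/-- The embedding of `𝕍` into `L²(Ω)`. -/
def embL (Ω ΓD : Set (E d)) : V Ω ΓD →L[ℂ] L2 Ω :=
  (PiLp.proj (𝕜 := ℂ) 2 (fun _ : Fin (d + 1) => L2 Ω) 0) ∘L (V Ω ΓD).subtypeL

@[simp]
theorem embL_apply (w : V Ω ΓD) : embL Ω ΓD w = fn w := rfl

theorem norm_embL_le : ‖embL Ω ΓD‖ ≤ 1 := by
  refine ContinuousLinearMap.opNorm_le_bound _ zero_le_one fun w => ?_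
  rw [one_mul]
  exact PiLp.norm_apply_le (w : Jet Ω) 0

theorem eq_zero_of_integral_smul_eq_zero (hΩ : IsOpen Ω) {g : L2 Ω}
    (h : ∀ φ : E d → ℝ, ContDiff ℝ ∞ φ → HasCompactSupport φ → tsupport φ ⊆ Ω →
      ∫ x in Ω, φ x • g x = 0) : g = 0 := by
  have hl : LocallyIntegrable g (volume.restrict Ω) := (Lp.memLp g).locallyIntegrable (by norm_num)
  have h1 := hΩ.ae_eq_zero_of_integral_contDiff_smul_eq_zero (hl.locallyIntegrableOn Ω) h
  rw [Lp.eq_zero_iff_ae_eq_zero]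
  filter_upwards [h1, ae_restrict_mem hΩ.measurableSet] with x hx hxΩ
  exact hx hxΩ

theorem embL_injective (hΩ : IsOpen Ω) : Function.Injective (embL Ω ΓD) := by
  refine (injective_iff_map_eq_zero _).2 fun w hw => ?_
  have h0 : (w : Jet Ω) 0 = 0 := hw
  have h1 : ∀ i : Fin d, (w : Jet Ω) i.succ = 0 := by
    intro i
    refine eq_zero_of_integral_smul_eq_zero hΩ fun φ hφ hc hs => ?_
    have h := w.2.1 i φ hφ hc hs
    rw [h0, integral_smul_eq_inner (continuous_pderiv hφ i) (hasCompactSupport_pderiv hc i),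
      inner_zero_right] at h
    exact neg_eq_zero.1 h.symm
  refine Subtype.ext (PiLp.ext fun j => ?_)
  refine Fin.cases ?_ (fun i => ?_) j
  · exact h0
  · exact h1 i

theorem fderiv_ofReal_comp {φ : E d → ℝ} (hφ : ContDiff ℝ ∞ φ) (x v : E d) :
    fderiv ℝ (fun x => (φ x : ℂ)) x v = (fderiv ℝ φ x v : ℂ) := by
  have h := Complex.ofRealCLM.hasFDerivAt.comp x (hφ.differentiable (by simp) x).hasFDerivAt
  have h' : fderiv ℝ (fun x => (φ x : ℂ)) x = Complex.ofRealCLM ∘L fderiv ℝ φ x := h.fderiv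
  rw [h']
  rfl

theorem setIntegral_eq_of_tsupport_subset {F : Type*} [NormedAddCommGroup F] [NormedSpace ℝ F]
    {ψ : E d → ℝ} (hs : tsupport ψ ⊆ Ω) (g : E d → F) :
    ∫ x in Ω, ψ x • g x = ∫ x, ψ x • g x :=
  setIntegral_eq_integral_of_forall_compl_eq_zero fun x hx => by
    rw [image_eq_zero_of_notMem_tsupport fun h => hx (hs h), zero_smul]

/-- Test functions belong to `𝕍`. -/
theorem exists_fn_eq_toLp (hΓD : ΓD ⊆ frontier Ω) (hΩ : IsOpen Ω) {φ : E d → ℝ}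
    (hφ : ContDiff ℝ ∞ φ) (hc : HasCompactSupport φ) (hs : tsupport φ ⊆ Ω) :
    ∃ w : V Ω ΓD, fn w = (memLp_ofReal (Ω := Ω) hφ.continuous hc).toLp _ := by
  have hmem : ∀ i : Fin d, MemLp (fun x => ((pderiv φ i x : ℝ) : ℂ)) 2 (volume.restrict Ω) := fun i =>
    memLp_ofReal (continuous_pderiv hφ i) (hasCompactSupport_pderiv hc i)
  set u : Jet Ω := WithLp.toLp 2 (Fin.cons ((memLp_ofReal (Ω := Ω) hφ.continuous hc).toLp _)
    fun i => (hmem i).toLp _) with hu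
  have u0 : u 0 = (memLp_ofReal (Ω := Ω) hφ.continuous hc).toLp _ := rfl
  have us : ∀ i : Fin d, u i.succ = (hmem i).toLp _ := fun i => rfl
  have hcφ : HasCompactSupport fun x => (φ x : ℂ) :=
    hc.comp_left (g := fun t : ℝ => (t : ℂ)) rfl
  have hsφ : ContDiff ℝ ∞ fun x => (φ x : ℂ) := Complex.ofRealCLM.contDiff.comp hφ
  refine ⟨⟨u, ?_, ?_⟩, rfl⟩
  · intro i ψ hψ hcψ hsψ
    have e1 : ∫ x in Ω, pderiv ψ i x • u 0 x = ∫ x in Ω, ((pderiv ψ i x * φ x : ℝ) : ℂ) := by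
      refine integral_congr_ae ?_
      rw [u0]
      filter_upwards [(memLp_ofReal (Ω := Ω) hφ.continuous hc).coeFn_toLp] with x hx
      rw [hx, Complex.real_smul, Complex.ofReal_mul]
    have e2 : ∫ x in Ω, ψ x • u i.succ x = ∫ x in Ω, ((ψ x * pderiv φ i x : ℝ) : ℂ) := by
      refine integral_congr_ae ?_
      rw [us]
      filter_upwards [(hmem i).coeFn_toLp] with x hx
      rw [hx, Complex.real_smul, Complex.ofReal_mul]
    rw [e1, e2, integral_complex_ofReal, integral_complex_ofReal, ← Complex.ofReal_neg]
    congr 1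
    have f1 : ∫ x in Ω, pderiv ψ i x * φ x = ∫ x, φ x * pderiv ψ i x := by
      simp_rw [mul_comm _ (φ _)]
      exact setIntegral_eq_of_tsupport_subset hs _
    have f2 : ∫ x in Ω, ψ x * pderiv φ i x = ∫ x, pderiv φ i x * ψ x := by
      simp_rw [mul_comm (pderiv φ i _)]
      exact setIntegral_eq_of_tsupport_subset hsψ _
    rw [f1, f2]
    refine integral_mul_fderiv_eq_neg_fderiv_mul_of_integrable (μ := volume) ?_ ?_ ?_ ?_ ?_
    · exact ((continuous_pderiv hφ i).mul hψ.continuous).integrable_of_hasCompactSupport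
        hcψ.mul_left
    · exact (hφ.continuous.mul (continuous_pderiv hψ i)).integrable_of_hasCompactSupport
        hc.mul_right
    · exact (hφ.continuous.mul hψ.continuous).integrable_of_hasCompactSupport hc.mul_right
    · exact fun x _ => hφ.differentiable (by simp) x
    · exact fun x _ => hψ.differentiable (by simp) x
  · refine ⟨fun _ x => (φ x : ℂ), fun _ => hsφ, fun _ => hcφ, ?_, fun i => ?_, ?_⟩
    · have z : eLpNorm (fun x => (φ x : ℂ) - u 0 x) 2 (volume.restrict Ω) = 0 := by
        rw [← eLpNorm_zero (p := 2) (μ := volume.restrict Ω) (α := E d) (ε := ℂ)]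
        refine eLpNorm_congr_ae ?_
        rw [u0]
        filter_upwards [(memLp_ofReal (Ω := Ω) hφ.continuous hc).coeFn_toLp] with x hx
        rw [hx, sub_self, Pi.zero_apply]
      simpa using z
    · have z : eLpNorm (fun x => pderiv (fun x => (φ x : ℂ)) i x - u i.succ x) 2
          (volume.restrict Ω) = 0 := by
        rw [← eLpNorm_zero (p := 2) (μ := volume.restrict Ω) (α := E d) (ε := ℂ)]
        refine eLpNorm_congr_ae ?_
        rw [us]
        filter_upwards [(hmem i).coeFn_toLp] with x hx
        rw [hx, pderiv, fderiv_ofReal_comp hφ, ← pderiv, sub_self, Pi.zero_apply]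
      simpa using z
    · -- a test function vanishes on the boundary
      have hz : ∀ x ∈ ΓD, (φ x : ℂ) = 0 := by
        intro x hx
        have hx' : x ∉ Ω := fun h => by
          have := hΓD hx
          rw [hΩ.frontier_eq] at this
          exact this.2 h
        rw [image_eq_zero_of_notMem_tsupport fun h => hx' (hs h), Complex.ofReal_zero]
      have z : eLpNorm (fun x => (φ x : ℂ)) 2 ((μH[(d : ℝ) - 1]).restrict ΓD) = 0 := by
        rw [← eLpNorm_zero (p := 2) (μ := (μH[(d : ℝ) - 1]).restrict ΓD) (α := E d) (ε := ℂ)]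
        refine eLpNorm_congr_ae ?_
        have hm : MeasurableSet {x : E d | (φ x : ℂ) = 0} :=
          (isClosed_eq hsφ.continuous continuous_const).measurableSet
        exact (ae_restrict_iff hm).2 (ae_of_all _ hz)
      simpa using z

theorem denseRange_embL (hΓD : ΓD ⊆ frontier Ω) (hΩ : IsOpen Ω) : DenseRange (embL Ω ΓD) := by
  have h : (LinearMap.range (embL Ω ΓD : V Ω ΓD →ₗ[ℂ] L2 Ω)).topologicalClosure = ⊤ := by
    rw [Submodule.topologicalClosure_eq_top_iff, Submodule.eq_bot_iff]
    intro g hg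
    refine eq_zero_of_integral_smul_eq_zero hΩ fun φ hφ hc hs => ?_
    obtain ⟨w, hw⟩ := exists_fn_eq_toLp hΓD hΩ hφ hc hs
    rw [integral_smul_eq_inner hφ.continuous hc, ← hw]
    exact hg _ ⟨w, rfl⟩
  exact Submodule.dense_iff_topologicalClosure_eq_top.2 h

/-! ### The operator on `𝕍` of the form -/

theorem formIntegrand_add_left (a : Fin (d + 1) → Fin (d + 1) → E d → ℂ) (u u' v : Jet Ω) :
    formIntegrand a (u + u') v =ᵐ[volume.restrict Ω]
      fun x => formIntegrand a u v x + formIntegrand a u' v x := by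
  have h : ∀ᵐ x ∂(volume.restrict Ω), ∀ i, (u + u') i x = u i x + u' i x :=
    ae_all_iff.2 fun i => Lp.coeFn_add (u i) (u' i)
  filter_upwards [h] with x hx
  simp only [formIntegrand, hx, ← Finset.sum_add_distrib]
  refine Finset.sum_congr rfl fun i _ => Finset.sum_congr rfl fun j _ => ?_
  ring

theorem formIntegrand_add_right (a : Fin (d + 1) → Fin (d + 1) → E d → ℂ) (u v v' : Jet Ω) :
    formIntegrand a u (v + v') =ᵐ[volume.restrict Ω]
      fun x => formIntegrand a u v x + formIntegrand a u v' x := by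
  have h : ∀ᵐ x ∂(volume.restrict Ω), ∀ i, (v + v') i x = v i x + v' i x :=
    ae_all_iff.2 fun i => Lp.coeFn_add (v i) (v' i)
  filter_upwards [h] with x hx
  simp only [formIntegrand, hx, ← Finset.sum_add_distrib, map_add]
  refine Finset.sum_congr rfl fun i _ => Finset.sum_congr rfl fun j _ => ?_
  ring

theorem formIntegrand_smul_left (a : Fin (d + 1) → Fin (d + 1) → E d → ℂ) (k : ℂ) (u v : Jet Ω) :
    formIntegrand a (k • u) v =ᵐ[volume.restrict Ω] fun x => k * formIntegrand a u v x := by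
  have h : ∀ᵐ x ∂(volume.restrict Ω), ∀ i, (k • u) i x = k * u i x :=
    ae_all_iff.2 fun i => Lp.coeFn_smul k (u i)
  filter_upwards [h] with x hx
  simp only [formIntegrand, hx, Finset.mul_sum]
  refine Finset.sum_congr rfl fun i _ => Finset.sum_congr rfl fun j _ => ?_
  ring

theorem formIntegrand_smul_right (a : Fin (d + 1) → Fin (d + 1) → E d → ℂ) (k : ℂ) (u v : Jet Ω) :
    formIntegrand a u (k • v) =ᵐ[volume.restrict Ω]
      fun x => conj k * formIntegrand a u v x := by
  have h : ∀ᵐ x ∂(volume.restrict Ω), ∀ i, (k • v) i x = k * v i x :=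
    ae_all_iff.2 fun i => Lp.coeFn_smul k (v i)
  filter_upwards [h] with x hx
  simp only [formIntegrand, hx, Finset.mul_sum, map_mul]
  refine Finset.sum_congr rfl fun i _ => Finset.sum_congr rfl fun j _ => ?_
  ring

/-- A bounded sesquilinear form is represented by an operator on the Hilbert space. -/
theorem exists_inner_eq {W : Type*} [NormedAddCommGroup W] [InnerProductSpace ℂ W]
    [CompleteSpace W] (B : W → W → ℂ) (al : ∀ u u' v, B (u + u') v = B u v + B u' v)
    (ar : ∀ u v v', B u (v + v') = B u v + B u v') (sl : ∀ (k : ℂ) u v, B (k • u) v = k * B u v)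
    (sr : ∀ (k : ℂ) u v, B u (k • v) = conj k * B u v) {C : ℝ}
    (hB : ∀ u v, ‖B u v‖ ≤ C * ‖u‖ * ‖v‖) :
    ∃ T : W →L[ℂ] W, ∀ u v, B u v = inner ℂ v (T u) := by
  set L : W →ₛₗ[starRingEnd ℂ] W →ₗ[ℂ] ℂ :=
    LinearMap.mk₂'ₛₗ (starRingEnd ℂ) (RingHom.id ℂ) (fun v u => B u v)
      (fun v v' u => ar u v v') (fun k v u => sr k u v) (fun v u u' => al u u' v)
      (fun k v u => sl k u v) with hL
  set M : W →L⋆[ℂ] W →L[ℂ] ℂ := LinearMap.mkContinuous₂ L C (fun v u => by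
    refine (hB u v).trans (le_of_eq ?_)
    ring) with hM
  refine ⟨ContinuousLinearMap.adjoint (InnerProductSpace.continuousLinearMapOfBilin M),
    fun u v => ?_⟩
  rw [ContinuousLinearMap.adjoint_inner_right,
    InnerProductSpace.continuousLinearMapOfBilin_apply]
  rfl

theorem exists_inner_eq_form (a : Fin (d + 1) → Fin (d + 1) → E d → ℂ)
    (ha : ∀ u v : V Ω ΓD, IntegrableOn (formIntegrand a (u : Jet Ω) (v : Jet Ω)) Ω)
    (hbdd : IsBoundedForm (form Ω ΓD a)) :
    ∃ T : V Ω ΓD →L[ℂ] V Ω ΓD, ∀ u v, form Ω ΓD a u v = inner ℂ v (T u) := by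
  obtain ⟨C, -, hC⟩ := hbdd
  have al : ∀ u u' v, form Ω ΓD a (u + u') v = form Ω ΓD a u v + form Ω ΓD a u' v := by
    intro u u' v
    have h := formIntegrand_add_left a (u : Jet Ω) (u' : Jet Ω) (v : Jet Ω)
    rw [form, form, form, ← integral_add (ha u v) (ha u' v), Submodule.coe_add,
      integral_congr_ae h]
  have ar : ∀ u v v', form Ω ΓD a u (v + v') = form Ω ΓD a u v + form Ω ΓD a u v' := by
    intro u v v'
    have h := formIntegrand_add_right a (u : Jet Ω) (v : Jet Ω) (v' : Jet Ω)
    rw [form, form, form, ← integral_add (ha u v) (ha u v'), Submodule.coe_add,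
      integral_congr_ae h]
  have sl : ∀ (k : ℂ) u v, form Ω ΓD a (k • u) v = k * form Ω ΓD a u v := by
    intro k u v
    have h := formIntegrand_smul_left a k (u : Jet Ω) (v : Jet Ω)
    rw [form, form, ← integral_const_mul, Submodule.coe_smul, integral_congr_ae h]
  have sr : ∀ (k : ℂ) u v, form Ω ΓD a u (k • v) = conj k * form Ω ΓD a u v := by
    intro k u v
    have h := formIntegrand_smul_right a k (u : Jet Ω) (v : Jet Ω)
    rw [form, form, ← integral_const_mul, Submodule.coe_smul, integral_congr_ae h]
  exact exists_inner_eq (form Ω ΓD a) al ar sl sr hC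

end

section

variable {d : ℕ} {Ω ΓD : Set (E d)} {B : V Ω ΓD → V Ω ΓD → ℂ}
  {T S : V Ω ΓD →L[ℂ] V Ω ΓD} {c c' β γ μ : ℝ}

/-! ### Fractional powers in terms of resolvents -/

theorem isOp_sub_smul_iff (hT : Coercive T c) (hB : ∀ u v, B u v = inner ℂ v (T u)) (hμ : 0 ≤ μ)
    (u f : L2 Ω) :
    IsOp B u (f - (μ : ℂ) • u) ↔ u = embL Ω ΓD (res T (embL Ω ΓD) μ f) := by
  constructor
  · rintro ⟨w, rfl, hw⟩
    have e : w = res T (embL Ω ΓD) μ f := hT.eq_res hμ fun v => (hB w v).symm.trans (hw v)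
    rw [← e, embL_apply]
  · rintro rfl
    exact ⟨_, rfl, fun φ => (hB _ φ).trans (hT.inner_res hμ f φ)⟩

theorem isOp_iff (hT : Coercive T c) (hB : ∀ u v, B u v = inner ℂ v (T u)) (u f : L2 Ω) :
    IsOp B u f ↔ u = embL Ω ΓD (res T (embL Ω ΓD) 0 f) := by
  simpa using isOp_sub_smul_iff hT hB le_rfl u f

theorem resolvent_eq (hT : Coercive T c) (hB : ∀ u v, B u v = inner ℂ v (T u)) (hμ : 0 ≤ μ)
    (f : L2 Ω) : resolvent B μ f = embL Ω ΓD (res T (embL Ω ΓD) μ f) := by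
  have h : ∃ u : L2 Ω, IsOp B u (f - (μ : ℂ) • u) :=
    ⟨_, (isOp_sub_smul_iff hT hB hμ _ f).2 rfl⟩
  rw [resolvent, dif_pos h]
  exact (isOp_sub_smul_iff hT hB hμ _ f).1 h.choose_spec

theorem negPow_eq (hT : Coercive T c) (hB : ∀ u v, B u v = inner ℂ v (T u)) (hβ : β ≠ 0)
    (f : L2 Ω) :
    negPow B β f = ((Real.sin (β * Real.pi) / Real.pi : ℝ) : ℂ) • bal T (embL Ω ΓD) β f := by
  rw [negPow, if_neg hβ, bal]
  congr 1
  refine setIntegral_congr_fun measurableSet_Ioi fun μ hμ => ?_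
  rw [resolvent_eq hT hB (le_of_lt hμ)]

/-- The constant in the Balakrishnan formula. -/
def balConst (β : ℝ) : ℂ := ((Real.sin ((1 - β) * Real.pi) / Real.pi : ℝ) : ℂ)

theorem balConst_ne_zero (h0 : 0 < β) (h1 : β < 1) : balConst β ≠ 0 := by
  have h : 0 < Real.sin ((1 - β) * Real.pi) :=
    Real.sin_pos_of_pos_of_lt_pi (mul_pos (by linarith) Real.pi_pos) (by nlinarith [Real.pi_pos])
  exact Complex.ofReal_ne_zero.2 (div_pos h Real.pi_pos).ne'

theorem isPow_iff (hT : Coercive T c) (hB : ∀ u v, B u v = inner ℂ v (T u)) (h0 : 0 < β)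
    (h1 : β < 1) (u f : L2 Ω) :
    IsPow B β u f ↔ PowRel T (embL Ω ΓD) (balConst β) β u f := by
  rw [IsPow, if_neg h0.ne', isOp_iff hT hB, negPow_eq hT hB (by linarith), PowRel, balConst]

theorem isPow_zero_iff (u f : L2 Ω) : IsPow B 0 u f ↔ f = u := by
  rw [IsPow, if_pos rfl]

theorem isPow_one_iff (hT : Coercive T c) (hB : ∀ u v, B u v = inner ℂ v (T u)) (u f : L2 Ω) :
    IsPow B 1 u f ↔ u = embL Ω ΓD (res T (embL Ω ΓD) 0 f) := by
  rw [IsPow, if_neg one_ne_zero, sub_self, negPow, if_pos rfl, isOp_iff hT hB]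

theorem IsPow.opPow_eq (hT : Coercive T c) (hB : ∀ u v, B u v = inner ℂ v (T u))
    (hd : DenseRange (embL Ω ΓD)) {u f : L2 Ω} (h : IsPow B β u f) : opPow B β u = f := by
  have he : ∃ f, IsPow B β u f := ⟨f, h⟩
  rw [opPow, dif_pos he]
  have h' := he.choose_spec
  set g := he.choose
  rw [IsPow] at h h'
  split_ifs at h h'
  · rw [h, h']
  · rw [isOp_iff hT hB] at h h'
    exact hT.map_res_zero_injective hd (h'.symm.trans h)

/-- Every element of `𝕍` is in the domain of `S^γ`, `0 < γ < 1/2`. -/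
theorem powRel_opPow_fn {Bs : V Ω ΓD → V Ω ΓD → ℂ} (hS : Coercive S c')
    (hBs : ∀ u v, Bs u v = inner ℂ v (S u)) (hsym : ContinuousLinearMap.adjoint S = S)
    (hinj : Function.Injective (embL Ω ΓD)) (hd : DenseRange (embL Ω ΓD)) (h0 : 0 < γ)
    (h1 : γ < 1 / 2) (θ : V Ω ΓD) :
    PowRel S (embL Ω ΓD) (balConst γ) γ (embL Ω ΓD θ) (opPow Bs γ (fn θ)) := by
  have h2 : γ < 1 := by linarith
  obtain ⟨f, hf⟩ := hS.exists_powRel hsym norm_embL_le hinj h0 h1 (balConst_ne_zero h0 h2) θ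
  have h : opPow Bs γ (fn θ) = f :=
    IsPow.opPow_eq hS hBs hd ((isPow_iff hS hBs h0 h2 _ _).2 hf)
  rwa [h]

theorem opPow_zero (hT : Coercive T c) (hB : ∀ u v, B u v = inner ℂ v (T u))
    (hd : DenseRange (embL Ω ΓD)) (u : L2 Ω) : opPow B 0 u = u :=
  IsPow.opPow_eq hT hB hd ((isPow_zero_iff u u).2 rfl)

/-- An element `u` of `D(A^{1-γ})` is in `𝕍`, and `|A(u, θ)| ≤ C ‖A^{1-γ} u‖ ‖S^γ θ‖`. -/
theorem exists_form_le_of_isPow {Bs : V Ω ΓD → V Ω ΓD → ℂ} (hT : Coercive T c)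
    (hB : ∀ u v, B u v = inner ℂ v (T u)) (hS : Coercive S c')
    (hBs : ∀ u v, Bs u v = inner ℂ v (S u)) (hsym : ContinuousLinearMap.adjoint S = S)
    (hinj : Function.Injective (embL Ω ΓD)) (hd : DenseRange (embL Ω ΓD)) (h0 : 0 ≤ γ)
    (h1 : γ < 1 / 2) :
    ∃ C : ℝ, 0 ≤ C ∧ ∀ u g : L2 Ω, IsPow B (1 - γ) u g → ∃ v : V Ω ΓD, fn v = u ∧
      ∀ θ : V Ω ΓD, ‖B v θ‖ ≤ C * ‖g‖ * ‖opPow Bs γ (fn θ)‖ := by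
  rcases h0.eq_or_lt with rfl | h0
  · refine ⟨1, zero_le_one, fun u g h => ?_⟩
    rw [sub_zero, isPow_one_iff hT hB] at h
    refine ⟨_, h.symm, fun θ => ?_⟩
    rw [hB, opPow_zero hS hBs hd, one_mul]
    exact hT.norm_inner_res_zero_le g θ
  · have h2 : 0 < 1 - γ := by linarith
    have h3 : 1 - γ < 1 := by linarith
    obtain ⟨C, hC, h⟩ := hT.exists_lift_of_powRel hS norm_embL_le hd h0 h1
      (balConst_ne_zero h2 h3) (balConst_ne_zero h0 (by linarith))
    refine ⟨C, hC, fun u g hu => ?_⟩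
    obtain ⟨v, hv, hb⟩ := h u g ((isPow_iff hT hB h2 h3 u g).1 hu)
    refine ⟨v, hv, fun θ => ?_⟩
    rw [hB]
    exact hb θ _ (powRel_opPow_fn hS hBs hsym hinj hd h0 h1 θ)

/-- If `|A(u, θ)| ≤ M ‖S^γ θ‖` for all `θ` in `𝕍`, then `u` is in `D(A^{1-γ})` and
`‖A^{1-γ} u‖ ≤ C M`. -/
theorem exists_isPow_of_form_le {Bs : V Ω ΓD → V Ω ΓD → ℂ} (hT : Coercive T c)
    (hB : ∀ u v, B u v = inner ℂ v (T u)) (hS : Coercive S c')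
    (hBs : ∀ u v, Bs u v = inner ℂ v (S u)) (hsym : ContinuousLinearMap.adjoint S = S)
    (hinj : Function.Injective (embL Ω ΓD)) (hd : DenseRange (embL Ω ΓD)) (h0 : 0 ≤ γ)
    (h1 : γ < 1 / 2) :
    ∃ C : ℝ, 0 ≤ C ∧ ∀ (u : V Ω ΓD) (M : ℝ), 0 ≤ M →
      (∀ θ : V Ω ΓD, ‖B u θ‖ ≤ M * ‖opPow Bs γ (fn θ)‖) →
      ∃ g : L2 Ω, ‖g‖ ≤ C * M ∧ IsPow B (1 - γ) (fn u) g := by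
  rcases h0.eq_or_lt with rfl | h0
  · refine ⟨1, zero_le_one, fun u M hM hu => ?_⟩
    obtain ⟨g, hg, hge⟩ := hT.exists_eq_res_zero hinj hM (u := u) (fun v => by
      rw [← hB]
      refine (hu v).trans (le_of_eq ?_)
      rw [opPow_zero hS hBs hd, embL_apply])
    refine ⟨g, by rwa [one_mul], ?_⟩
    rw [sub_zero, isPow_one_iff hT hB, ← hge, embL_apply]
  · have h2 : 0 < 1 - γ := by linarith
    have h3 : 1 - γ < 1 := by linarith
    have h4 : γ < 1 := by linarith
    obtain ⟨C, hC, h⟩ := hT.exists_powRel_of_lift hS hsym norm_embL_le hinj h0 h1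
      (balConst_ne_zero h2 h3) (balConst_ne_zero h0 h4)
    refine ⟨C, hC, fun u M hM hu => ?_⟩
    obtain ⟨g, hg, hge⟩ := h u M hM (fun θ f hf => by
      have hp : opPow Bs γ (fn θ) = f :=
        IsPow.opPow_eq hS hBs hd ((isPow_iff hS hBs h0 h4 _ _).2 hf)
      rw [← hB, ← hp]
      exact hu θ)
    exact ⟨g, hg, (isPow_iff hT hB h2 h3 _ _).2 hge⟩

/-! ### The solution operator -/

theorem Ta_eq (hT : Coercive T c) (hB : ∀ u v, B u v = inner ℂ v (T u)) {F : Va Ω ΓD}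
    {u : V Ω ΓD} (h : ∀ φ, B u φ = F φ) : Ta B F = u := by
  have he : ∃ u : V Ω ΓD, ∀ φ : V Ω ΓD, B u φ = F φ := ⟨u, h⟩
  rw [Ta, dif_pos he]
  exact hT.eq_of_inner_eq fun φ => by rw [← hB, ← hB, he.choose_spec φ, h φ]

theorem form_Ta (hT : Coercive T c) (hB : ∀ u v, B u v = inner ℂ v (T u)) (F : Va Ω ΓD)
    (φ : V Ω ΓD) : B (Ta B F) φ = F φ := by
  have he : ∃ u : V Ω ΓD, ∀ φ : V Ω ΓD, B u φ = F φ := by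
    obtain ⟨u, hu⟩ := hT.exists_inner_eq F
    exact ⟨u, fun φ => (hB u φ).trans (hu φ)⟩
  rw [Ta, dif_pos he]
  exact he.choose_spec φ

theorem mem_dotDual_innerSLFlip {t C : ℝ} {v : V Ω ΓD}
    (hB : ∀ u v, B u v = inner ℂ v (T u)) (h : ∀ θ, ‖B v θ‖ ≤ C * dotNorm B t (fn θ)) :
    innerSLFlip ℂ (T v) ∈ dotDual B t :=
  ⟨C, fun θ => by rw [innerSLFlip_apply_apply, ← hB]; exact h θ⟩

theorem rePart_eq (hB : ∀ u v, B u v = inner ℂ v (T u)) (u v : V Ω ΓD) :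
    rePart B u v = inner ℂ v (symPart T u) := by
  rw [rePart, hB, hB, inner_symPart]

theorem dotDualNorm_le {t M : ℝ} {F : Va Ω ΓD} (hM : 0 ≤ M)
    (h : ∀ θ, ‖F θ‖ ≤ M * dotNorm B t (fn θ)) : dotDualNorm B t F ≤ M :=
  csInf_le ⟨0, fun _ hM => hM.1⟩ ⟨hM, h⟩

theorem le_mul_dotDualNorm {t C x : ℝ} {F : Va Ω ΓD} (hF : F ∈ dotDual B t) (hC : 0 < C)
    (h : ∀ M : ℝ, 0 ≤ M → (∀ θ, ‖F θ‖ ≤ M * dotNorm B t (fn θ)) → x ≤ C * M) :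
    x ≤ C * dotDualNorm B t F := by
  obtain ⟨M, hM⟩ := hF
  rw [← div_le_iff₀' hC]
  refine le_csInf ⟨max M 0, le_max_right _ _, fun θ => (hM θ).trans
    (mul_le_mul_of_nonneg_right (le_max_left _ _) (norm_nonneg _))⟩ fun M hM => ?_
  rw [div_le_iff₀' hC]
  exact h M hM.1 hM.2

/-- For a coercive bounded form, `T_a` maps the functionals on `Ḣ^{1-s}` onto `D(A^{(1+s)/2})`, with
equivalence of the norms. -/
theorem powDomain_eq_Ta_image (hT : Coercive T c) (hB : ∀ u v, B u v = inner ℂ v (T u))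
    (hinj : Function.Injective (embL Ω ΓD)) (hd : DenseRange (embL Ω ΓD)) {s : ℝ} (h0 : 0 < s)
    (h1 : s ≤ 1) :
    (∀ u, u ∈ powDomain B ((1 + s) / 2) ↔ ∃ F ∈ dotDual B (1 - s), fn (Ta B F) = u) ∧
      ∃ C : ℝ, 0 < C ∧ ∀ F ∈ dotDual B (1 - s),
        dotDualNorm B (1 - s) F ≤ C * ‖opPow B ((1 + s) / 2) (fn (Ta B F))‖ ∧
        ‖opPow B ((1 + s) / 2) (fn (Ta B F))‖ ≤ C * dotDualNorm B (1 - s) F := by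
  have e1 : (1 + s) / 2 = 1 - (1 - s) / 2 := by ring
  obtain ⟨C₁, hC₁, hup⟩ := exists_form_le_of_isPow (γ := (1 - s) / 2) hT hB hT.symPart
    (rePart_eq hB) adjoint_symPart hinj hd (by linarith) (by linarith)
  obtain ⟨C₂, hC₂, hdown⟩ := exists_isPow_of_form_le (γ := (1 - s) / 2) hT hB hT.symPart
    (rePart_eq hB) adjoint_symPart hinj hd (by linarith) (by linarith)
  rw [← e1] at hup hdown
  have hdown' : ∀ (F : Va Ω ΓD) (M : ℝ), 0 ≤ M →
      (∀ θ, ‖F θ‖ ≤ M * dotNorm B (1 - s) (fn θ)) →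
      ∃ g : L2 Ω, ‖g‖ ≤ C₂ * M ∧ IsPow B ((1 + s) / 2) (fn (Ta B F)) g := fun F M hM0 hM =>
    hdown (Ta B F) M hM0 fun θ => by
      rw [form_Ta hT hB]
      exact hM θ
  have hex : ∀ F ∈ dotDual B (1 - s), ∃ g : L2 Ω, IsPow B ((1 + s) / 2) (fn (Ta B F)) g := by
    rintro F ⟨M, hM⟩
    obtain ⟨g, -, hg⟩ := hdown' F (max M 0) (le_max_right _ _) fun θ => (hM θ).trans
      (mul_le_mul_of_nonneg_right (le_max_left _ _) (norm_nonneg _))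
    exact ⟨g, hg⟩
  refine ⟨fun u => ⟨?_, ?_⟩, C₁ + C₂ + 1, by positivity, fun F hF => ⟨?_, ?_⟩⟩
  · rintro ⟨g, hg⟩
    obtain ⟨v, hv, hb⟩ := hup u g hg
    refine ⟨innerSLFlip ℂ (T v), mem_dotDual_innerSLFlip hB hb, ?_⟩
    rw [Ta_eq hT hB (u := v) fun φ => hB v φ, hv]
  · rintro ⟨F, hF, rfl⟩
    exact hex F hF
  · obtain ⟨g, hg⟩ := hex F hF
    obtain ⟨v, hv, hb⟩ := hup _ _ hg
    have hvw : v = Ta B F := hinj hv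
    rw [hg.opPow_eq hT hB hd]
    refine (dotDualNorm_le (M := C₁ * ‖g‖) (by positivity) fun θ => ?_).trans ?_
    · rw [← form_Ta hT hB, ← hvw]
      exact hb θ
    · gcongr
      linarith
  · refine le_mul_dotDualNorm hF (by positivity) fun M hM0 hM => ?_
    obtain ⟨g, hgn, hg⟩ := hdown' F M hM0 hM
    rw [hg.opPow_eq hT hB hd]
    refine hgn.trans ?_
    gcongr
    linarith

end

end FracPow

end

theorem theorem7p1 (d : ℕ) (hd : 1 ≤ d) (Ω ΓN ΓD : Set (FracPow.E d))
    (hΩ : FracPow.IsBoundedLipschitzDomain Ω)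
    (hΓN : ∃ O : Set (FracPow.E d), IsOpen O ∧ ΓN = frontier Ω ∩ O)
    (hΓD : ΓD = frontier Ω \ ΓN)
    (a : Fin (d + 1) → Fin (d + 1) → FracPow.E d → ℂ)
    (ha : ∀ u v : FracPow.V Ω ΓD,
      IntegrableOn (FracPow.formIntegrand a (u : FracPow.Jet Ω) (v : FracPow.Jet Ω)) Ω)
    (hcoer : FracPow.IsCoerciveForm (FracPow.form Ω ΓD a))
    (hbdd : FracPow.IsBoundedForm (FracPow.form Ω ΓD a))
    (α s : ℝ) (hα : α ∈ Set.Ioc (0 : ℝ) 1) (hs : s ∈ Set.Ioc (0 : ℝ) α)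
    (hTa : FracPow.TaIsIso (FracPow.form Ω ΓD a) s) :
    FracPow.powDomain (FracPow.form Ω ΓD a) ((1 + s) / 2)
        = FracPow.fn '' FracPow.sobolevV Ω ΓD s ∧
      ∃ c C : ℝ, 0 < c ∧ 0 < C ∧ ∀ w ∈ FracPow.sobolevV Ω ΓD s,
        c * FracPow.sobolevNorm s (w : FracPow.Jet Ω)
            ≤ ‖FracPow.opPow (FracPow.form Ω ΓD a) ((1 + s) / 2) (FracPow.fn w)‖ ∧
          ‖FracPow.opPow (FracPow.form Ω ΓD a) ((1 + s) / 2) (FracPow.fn w)‖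
            ≤ C * FracPow.sobolevNorm s (w : FracPow.Jet Ω) := by
  have hinj : Function.Injective (FracPow.embL Ω ΓD) := FracPow.embL_injective hΩ.1
  have hde : DenseRange (FracPow.embL Ω ΓD) :=
    FracPow.denseRange_embL (hΓD ▸ sdiff_subset) hΩ.1
  obtain ⟨T, hB⟩ := FracPow.exists_inner_eq_form a ha hbdd
  obtain ⟨c₀, hc₀, hco⟩ := hcoer
  have hT : FracPow.Coercive T c₀ := ⟨hc₀, fun v => by rw [← hB]; exact hco v⟩
  obtain ⟨hdom, C, hC, hpow⟩ :=
    FracPow.powDomain_eq_Ta_image hT hB hinj hde hs.1 (hs.2.trans hα.2)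
  obtain ⟨hbij, k, K, hk, hK, hnorm⟩ := hTa
  refine ⟨?_, (K * C)⁻¹, C / k, by positivity, by positivity, fun w hw => ?_⟩
  · ext u
    rw [hdom u]
    constructor
    · rintro ⟨F, hF, rfl⟩
      exact ⟨_, hbij.mapsTo hF, rfl⟩
    · rintro ⟨w, hw, rfl⟩
      obtain ⟨F, hF, rfl⟩ := hbij.surjOn hw
      exact ⟨F, hF, rfl⟩
  · obtain ⟨F, hF, rfl⟩ := hbij.surjOn hw
    obtain ⟨hn1, hn2⟩ := hnorm F hF
    obtain ⟨hp1, hp2⟩ := hpow F hF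
    constructor
    · rw [inv_mul_le_iff₀ (by positivity), mul_assoc]
      exact hn2.trans (by gcongr)
    · rw [div_mul_eq_mul_div, le_div_iff₀ hk]
      refine (mul_le_mul_of_nonneg_right hp2 hk.le).trans ?_
      rw [mul_assoc, mul_comm _ k]
      gcongr
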